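/- Let $\zeta$ be the Riemann zeta-function. Define $\log\zeta(\sigma+it)$ for $\sigma,t\in\mathbb R$ as follows. If $t$ is neither $0$ nor the imaginary part of a nontrivial zero of $\zeta$, then $\sigma\mapsto\log\zeta(\sigma+it)$ is the continuous branch of the logarithm along the horizontal line at height $t$ with $\lim_{\sigma\to+\infty}\log\zeta(\sigma+it)=0$. If $t=0$, then $\log\zeta(\sigma)=\lim_{\varepsilon\downarrow0}\log\zeta(\sigma+i\varepsilon)$. If $t=\gamma$ is the imaginary part of a nontrivial zero, then $\log\zeta(\sigma+i\gamma)=\lim_{\varepsilon\downarrow0}\log\zeta(\sigma+i(\gamma-\operatorname{sgn}(\gamma)\varepsilon))$. (At a zero or pole of $\zeta$ itself the value is immaterial.) Put $\tilde\eta_0(\sigma+it)=\log\zeta(\sigma+it)$ and, for $m\ge1$, $$\tilde\eta_m(\sigma+it)=\int_\sigma^\infty\tilde\eta_{m-1}(\alpha+it)\,d\alpha .$$ Then for every integer $m\ge1$ the Lindelöf Hypothesis, that is, the assertion that $\zeta(\tfrac12+it)=O_\varepsilon(t^{\varepsilon})$ as $t\to+\infty$ for every $\varepsilon>0$, is equivalent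 to the estimate $$\operatorname{Re}\tilde\eta_m(\tfrac12+it)=o(\log t)\qquad(t\to+\infty).$$ -/

import Mathlib

open Filter Topology MeasureTheory Asymptotics

/-- The nontrivial zeros of the Riemann zeta-function: all its zeros except `-2, -4, -6, …`. -/
def zetaNontrivialZeros : Set ℂ :=
  {s | riemannZeta s = 0 ∧ ¬ ∃ n : ℕ, s = -2 * ((n : ℂ) + 1)}

/-- `t` is the ordinate (imaginary part) of some nontrivial zero. -/
def IsZetaOrdinate (t : ℝ) : Prop :=
  ∃ ρ ∈ zetaNontrivialZeros, ρ.im = t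

/-- `f` is a branch of `σ ↦ log ζ(σ + it)` obtained by continuation along the horizontal line at
height `t` from `σ = +∞`, with the initial condition that it tends to `0` there. -/
structure IsLogZetaBranch (t : ℝ) (f : ℝ → ℂ) : Prop where
  continuous : Continuous f
  exp_eq : ∀ σ : ℝ, Complex.exp (f σ) = riemannZeta (σ + t * Complex.I)
  tendsto_zero : Tendsto f atTop (𝓝 0)

/-- A branch as in `IsLogZetaBranch` is unique. -/
theorem IsLogZetaBranch.unique {t : ℝ} {f g : ℝ → ℂ}
    (hf : IsLogZetaBranch t f) (hg : IsLogZetaBranch t g) : f = g := by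
  have key : ∀ z : ℂ, Complex.exp z = 1 → ‖z‖ < 1 → z = 0 := by
    intro z hz hn
    obtain ⟨n, rfl⟩ := Complex.exp_eq_one_iff.1 hz
    rcases eq_or_ne n 0 with h | h
    · simp [h]
    · exfalso
      have h1 : (1 : ℝ) ≤ |(n : ℝ)| := by exact_mod_cast Int.one_le_abs h
      have h2 : ‖(n : ℂ) * (2 * Real.pi * Complex.I)‖ = |(n : ℝ)| * (2 * Real.pi) := by
        simp [abs_of_pos Real.pi_pos]
      rw [h2] at hn
      nlinarith [Real.pi_gt_three]
  have hc : Continuous (fun σ => f σ - g σ) := hf.continuous.sub hg.continuous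
  have he : ∀ σ, Complex.exp (f σ - g σ) = 1 := by
    intro σ
    rw [Complex.exp_sub, hf.exp_eq, ← hg.exp_eq, div_self (Complex.exp_ne_zero _)]
  have hset : {σ | f σ - g σ = 0} = {σ | ‖f σ - g σ‖ < 1} := by
    ext σ
    constructor
    · intro h
      simp only [Set.mem_setOf_eq] at h ⊢
      simp [h]
    · intro h
      exact key _ (he σ) h
  have hclopen : IsClopen {σ | f σ - g σ = 0} := by
    refine ⟨isClosed_eq hc continuous_const, ?_⟩
    rw [hset]
    exact isOpen_lt hc.norm continuous_const
  have hlim : Tendsto (fun σ => ‖f σ - g σ‖) atTop (𝓝 0) := by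
    simpa using (hf.tendsto_zero.sub hg.tendsto_zero).norm
  obtain ⟨σ₀, h₀⟩ := (hlim.eventually (gt_mem_nhds one_pos)).exists
  have huniv := hclopen.eq_univ ⟨σ₀, by rw [hset]; exact h₀⟩
  funext σ
  have : σ ∈ {σ | f σ - g σ = 0} := by rw [huniv]; trivial
  exact sub_eq_zero.1 this

open Classical in
/-- `log ζ(σ + it)` by horizontal continuation from `σ = +∞`; meaningful when `t` is neither `0`
nor the ordinate of a nontrivial zero (otherwise no branch exists and the value is `0`). -/
noncomputable def logZetaRegular (σ t : ℝ) : ℂ :=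
  if h : ∃ f : ℝ → ℂ, IsLogZetaBranch t f then h.choose σ else 0

open Classical in
/-- `log ζ(σ + it)` for every `t`. For `t = 0` it is the limit from above, and if `t` is the
ordinate of a nontrivial zero it is the limit of the values at heights `t - sgn(t) ε`, `ε ↓ 0`. -/
noncomputable def logZeta (σ t : ℝ) : ℂ :=
  if t = 0 then limUnder (𝓝[>] (0 : ℝ)) (fun ε : ℝ => logZetaRegular σ ε)
  else if IsZetaOrdinate t then
    limUnder (𝓝[>] (0 : ℝ)) (fun ε : ℝ => logZetaRegular σ (t - Real.sign t * ε))
  else logZetaRegular σ t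

/-- `etaTilde m (σ + it)`: the `m`-fold iterated horizontal integral of `log ζ`. -/
noncomputable def etaTilde : ℕ → ℂ → ℂ
  | 0, s => logZeta s.re s.im
  | m + 1, s => ∫ α in Set.Ioi s.re, etaTilde m (α + s.im * Complex.I)

/-- The Lindelöf Hypothesis: `ζ(1/2 + it) = O(t ^ ε)` as `t → +∞`, for every `ε > 0`. -/
def LindelofHypothesis : Prop :=
  ∀ ε : ℝ, 0 < ε →
    (fun t : ℝ => riemannZeta (1 / 2 + t * Complex.I)) =O[atTop] (fun t : ℝ => t ^ ε)

/-! Put u = log|ζ| and let u_m be its m-fold horizontal tail integral (`zetaLogIter`). For m ≥ 1, Re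
s ≥ 1/2 and Im s ≥ 4 one has Re η̃_m = u_m (`re_etaTilde_succ_eq`): whatever the branch, Re log ζ =
log|ζ| off the zeros, and integration does not see the zeros. The theorem thus concerns only the
subharmonic function u and its tails. Taking tails preserves the sub-mean-value inequality (Fubini),
upper semicontinuity (Fatou) and exponential decay to the right; `TailAdmissible` packages these
properties.

Suppose the Lindelöf Hypothesis. A Phragmén–Lindelöf argument gives u ≤ ε log t uniformly for σ ≥
1/2. This does not yet control the integral of |u|, because u is very negative near zeros. But if
log|f| ≤ M on a disc and log|f(c)| ≥ -M at its centre, then Jensen's formula bounds the number of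
zeros by O(M), Borel–Carathéodory bounds the zero-free remainder, and the integral of |log|f|| over
a horizontal segment of length ℓ is O(M √ℓ) (`exists_integral_abs_log_norm_le`). With discs about 3
+ it, where ζ is close to 1, this is applied with M = O(ε log t) away from the critical line and
with the unconditional M = 3 log t on a short segment next to it. Hence u_1 = o(log t) uniformly for
σ ≥ 1/2, and further integrations keep this.

For the converse only an upper bound for u_m on the critical line is used. The maximum principle in
a strip carries it to all σ ≥ 1/2. One then descends from u_{k+1} to u_k
(`TailAdmissible.eventually_le_of_tailIntegral`). On a disc about 3 + it the function u_{k+1} is at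
most ε log t and its value at the centre is bounded, so its L¹ norm is O(ε log t + 1). The
sub-mean-value inequality with weight r² - |w|² bounds u_k(p) by a multiple of the integral of (r² -
|w|²) u_k(p + w); as u_k = -∂u_{k+1}/∂σ, integration by parts along horizontal chords makes this the
integral of -2 Re(w) u_{k+1}(p + w), which is small. Finally log|ζ| ≤ ε log t for σ ≥ 1/2 + δ, and
convexity between the lines σ = 1/4, where |ζ| ≤ t², and σ = 1/2 + δ gives the Lindelöf Hypothesis
on letting δ tend to 0. -/

/-! ### Factoring out zeros and the local structure of log|f| -/

open Metric in
/-- A function analytic on a closed disc and nonzero at its centre is a finite product of linear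
factors times a zero-free analytic function. -/
theorem AnalyticOnNhd.exists_eq_prod_mul {f : ℂ → ℂ} {c : ℂ} {R : ℝ} (hR : 0 < R)
    (hf : AnalyticOnNhd ℂ f (closedBall c R)) (hfc : f c ≠ 0) :
    ∃ (S : Finset ℂ) (g : ℂ → ℂ), AnalyticOnNhd ℂ g (closedBall c R) ∧
      (∀ z ∈ closedBall c R, g z ≠ 0) ∧
      (∀ u, u ∉ S → MeromorphicOn.divisor f (closedBall c R) u = 0) ∧
      ∀ z ∈ closedBall c R,
        f z = (∏ u ∈ S, (z - u) ^ (MeromorphicOn.divisor f (closedBall c R) u).toNat) * g z := by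
  set U := closedBall c R with hU
  set D := MeromorphicOn.divisor f U with hD
  have hcU : c ∈ U := mem_closedBall_self hR.le
  have hfin : D.support.Finite := D.finiteSupport (isCompact_closedBall c R)
  have hmer := hf.meromorphicOn
  have hord : ∀ u : U, meromorphicOrderAt f u ≠ ⊤ := by
    rw [← hmer.exists_meromorphicOrderAt_ne_top_iff_forall
      ⟨⟨c, hcU⟩, (convex_closedBall c R).isPreconnected⟩]
    refine ⟨⟨c, hcU⟩, ?_⟩
    have h1 := (hf c hcU).meromorphicOrderAt_eq
    rw [(hf c hcU).analyticOrderAt_eq_zero.mpr hfc] at h1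
    simp [h1]
  obtain ⟨g, hg, hg0, hfg⟩ := hmer.extract_zeros_poles hord hfin
  refine ⟨hfin.toFinset, g, hg, fun z hz => hg0 ⟨z, hz⟩, fun u hu => by simpa using hu, ?_⟩
  set F : ℂ → ℂ := fun z => (∏ u ∈ hfin.toFinset, (z - u) ^ (D u).toNat) * g z with hF
  have hprod : ∀ z, (∏ᶠ (u : ℂ), (fun x => x - u) ^ D u) z =
      ∏ u ∈ hfin.toFinset, (z - u) ^ (D u).toNat := by
    intro z
    rw [finprod_eq_prod_of_mulSupport_subset (s := hfin.toFinset)]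
    · rw [Finset.prod_apply]
      refine Finset.prod_congr rfl fun u _ => ?_
      have h0 : 0 ≤ D u := MeromorphicOn.AnalyticOnNhd.divisor_nonneg hf u
      simp only [Pi.pow_apply]
      conv_lhs => rw [← Int.toNat_of_nonneg h0]
      rw [zpow_natCast]
    · rw [Function.FactorizedRational.mulSupport]
      simp
  have hFan : AnalyticOnNhd ℂ F U := by
    intro z hz
    refine AnalyticAt.mul ?_ (hg z hz)
    apply Finset.analyticAt_fun_prod
    intro u _
    fun_prop
  -- The factorisation is known only off a discrete set; the identity theorem gives it in the open
  -- disc, and continuity on the boundary.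
  have hball : Set.EqOn f F (ball c R) := by
    intro z hz
    have hzU : z ∈ U := ball_subset_closedBall hz
    have h1 : ∀ᶠ y in 𝓝[≠] z, f y = F y := by
      have h2 := mem_codiscreteWithin.1 hfg z hzU
      rw [disjoint_principal_right] at h2
      have h3 : ∀ᶠ y in 𝓝[≠] z, y ∈ ball c R :=
        nhdsWithin_le_nhds (isOpen_ball.mem_nhds hz)
      filter_upwards [h2, h3] with y hy hy'
      by_contra hne
      refine hy ⟨ball_subset_closedBall hy', ?_⟩
      intro hy2
      apply hne
      have : f y = ((∏ᶠ (u : ℂ), (fun x => x - u) ^ D u) • g) y := hy2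
      rw [this]
      simp only [Pi.smul_apply', smul_eq_mul, hprod, hF]
    exact (((hf z hzU).frequently_eq_iff_eventually_eq (hFan z hzU)).1 h1.frequently).self_of_nhds
  intro z hz
  have hcl : closedBall c R ⊆ closure (ball c R) := by rw [closure_ball c hR.ne']
  exact hball.of_subset_closure hf.continuousOn hFan.continuousOn ball_subset_closedBall hcl hz

open Metric in
/-- The zeros of an analytic function in a smaller disc are counted with Jensen's inequality. -/
theorem AnalyticOnNhd.sum_divisor_toNat_le {f : ℂ → ℂ} {c : ℂ} {r R B : ℝ} (hr : 0 < r)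
    (hrR : r < R) (hB : 1 ≤ B) (hf : AnalyticOnNhd ℂ f (closedBall c R)) (hfc : f c ≠ 0)
    (hfB : ∀ z ∈ closedBall c R, ‖f z‖ ≤ B) (S : Finset ℂ) (hS : ∀ u ∈ S, u ∈ closedBall c r) :
    ∑ u ∈ S, ((MeromorphicOn.divisor f (closedBall c R) u).toNat : ℝ) ≤
      Real.log (B / ‖f c‖) / Real.log (R / r) := by
  have hR : 0 < R := hr.trans hrR
  have h1 := AnalyticOnNhd.sum_divisor_le (c := c) (r := r) (R := R) (M := B) (f := f)
    (by simpa using hr.ne') (by rwa [abs_of_pos hr, abs_of_pos hR]) hB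
    (by rwa [abs_of_pos hR]) hfc
    (by rw [abs_of_pos hR]; exact fun z hz => hfB z (sphere_subset_closedBall hz))
  refine le_trans ?_ h1
  rw [abs_of_pos hr]
  set D := MeromorphicOn.divisor f (closedBall c r)
  have hsub : closedBall c r ⊆ closedBall c R := closedBall_subset_closedBall hrR.le
  have hfr := hf.mono hsub
  have hDn : ∀ u, 0 ≤ D u := fun u => MeromorphicOn.AnalyticOnNhd.divisor_nonneg hfr u
  have hfin : D.support.Finite := D.finiteSupport (isCompact_closedBall c r)
  have h2 : ∑ᶠ u, D u = ∑ u ∈ hfin.toFinset ∪ S, D u := by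
    apply finsum_eq_sum_of_support_subset
    intro u hu
    simp only [Finset.coe_union, Set.mem_union, Finset.mem_coe, Set.Finite.mem_toFinset]
    exact Or.inl hu
  rw [h2]
  push_cast
  have h3 : ∀ u ∈ S, ((MeromorphicOn.divisor f (closedBall c R) u).toNat : ℝ) = (D u : ℝ) := by
    intro u hu
    have h4 : MeromorphicOn.divisor f (closedBall c R) u = D u := by
      rw [MeromorphicOn.AnalyticOnNhd.divisor_apply hf (hsub (hS u hu)),
        MeromorphicOn.AnalyticOnNhd.divisor_apply hfr (hS u hu)]
    rw [h4]
    exact_mod_cast congrArg (Int.cast : ℤ → ℝ) (Int.toNat_of_nonneg (hDn u))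
  rw [Finset.sum_congr rfl h3]
  refine Finset.sum_le_sum_of_subset_of_nonneg Finset.subset_union_right fun u _ _ => ?_
  exact_mod_cast hDn u

open Metric in
/-- A zero-free holomorphic function on a disc has a holomorphic logarithm. -/
theorem DifferentiableOn.exists_log_ball {g : ℂ → ℂ} {c : ℂ} {r : ℝ} (hr : 0 < r)
    (hg : DifferentiableOn ℂ g (ball c r)) (hg0 : ∀ z ∈ ball c r, g z ≠ 0) :
    ∃ h : ℂ → ℂ, DifferentiableOn ℂ h (ball c r) ∧ ∀ z ∈ ball c r, Complex.exp (h z) = g z := by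
  have hlog : DifferentiableOn ℂ (fun z => _root_.deriv g z / g z) (ball c r) :=
    DifferentiableOn.div (DifferentiableOn.deriv hg isOpen_ball) hg hg0
  obtain ⟨P, hP⟩ := hlog.isExactOn_ball
  have hc : c ∈ ball c r := mem_ball_self hr
  refine ⟨fun z => P z - P c + Complex.log (g c), ?_, ?_⟩
  · intro z hz
    exact (((hP z hz).differentiableAt.sub_const _).add_const _).differentiableWithinAt
  · have hQ : ∀ z ∈ ball c r, HasDerivAt (fun z => g z * Complex.exp (-P z)) 0 z := by
      intro z hz
      have h1 := ((hg z hz).differentiableAt (isOpen_ball.mem_nhds hz)).hasDerivAt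
      have h2 := h1.mul (hP z hz).neg.cexp
      have h5 : g z * (_root_.deriv g z / g z) = _root_.deriv g z := mul_div_cancel₀ _ (hg0 z hz)
      refine HasDerivAt.congr_deriv (f' := _) (HasDerivAt.congr_of_eventuallyEq h2 (Eventually.of_forall fun w => rfl)) ?_
      simp only [Pi.neg_apply]
      linear_combination (-Complex.exp (-P z)) * h5
    intro z hz
    have h3 : g z * Complex.exp (-P z) = g c * Complex.exp (-P c) := by
      refine (convex_ball c r).is_const_of_fderivWithin_eq_zero (𝕜 := ℂ)
        (f := fun z => g z * Complex.exp (-P z))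
        (fun z hz => (hQ z hz).differentiableAt.differentiableWithinAt) ?_ hz hc
      intro z hz
      rw [fderivWithin_of_isOpen isOpen_ball hz]
      ext
      simp [(hQ z hz).deriv]
    rw [Complex.exp_add, Complex.exp_sub, Complex.exp_log (hg0 c hc)]
    rw [Complex.exp_neg, Complex.exp_neg] at h3
    have := Complex.exp_ne_zero (P z)
    have := Complex.exp_ne_zero (P c)
    field_simp at h3 ⊢
    rw [← h3]
open Metric in
/-- Local decomposition of `log ‖f‖` into contributions of zeros and a bounded part, with all
constants proportional to the logarithmic size `M` of `f`. -/
theorem exists_log_norm_decomposition {r R : ℝ} (hr : 0 < r) (hrR : r < R) :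
    ∃ C : ℝ, 0 < C ∧ ∀ (f : ℂ → ℂ) (c : ℂ) (M : ℝ), 0 < M → AnalyticOnNhd ℂ f (closedBall c R) →
      (∀ z ∈ closedBall c R, ‖f z‖ ≤ Real.exp M) → Real.exp (-M) ≤ ‖f c‖ →
      ∃ (S : Finset ℂ) (k : ℂ → ℕ), (∀ u ∈ S, u ∈ closedBall c R) ∧
        ∑ u ∈ S, (k u : ℝ) ≤ C * M ∧
        ∀ z ∈ closedBall c r, f z ≠ 0 →
          |Real.log ‖f z‖ - ∑ u ∈ S, k u * Real.log (‖z - u‖ / (2 * R))| ≤ C * M := by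
  -- Only the zeros within distance `q` are divided out. The gap between `q` and `R` serves Jensen's
  -- count and the lower bound for the linear factors on the outer circle; the gap between `r` and
  -- `q` serves Borel–Carathéodory.
  obtain ⟨q, hrq, hqR⟩ := exists_between hrR
  have hq : 0 < q := hr.trans hrq
  have hR : 0 < R := hq.trans hqR
  have hlogq : 0 < Real.log (R / q) := Real.log_pos (by rwa [one_lt_div hq])
  set A : ℝ := 2 / Real.log (R / q) with hA
  have hApos : 0 < A := by positivity
  set Λ : ℝ := Real.log (2 * R / (R - q)) with hΛ
  have hΛpos : 0 ≤ Λ := Real.log_nonneg (by rw [one_le_div (by linarith)]; linarith)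
  set E : ℝ := 2 * (3 + A * Λ) * r / (q - r) + 2 + A * Λ with hE
  have hqr : 0 < q - r := by linarith
  have hEpos : 0 < E := by positivity
  refine ⟨A + E, by positivity, ?_⟩
  intro f c M hM' hf hfB hfc
  have hM : 0 ≤ M := hM'.le
  have hfc0 : f c ≠ 0 := by
    intro h
    rw [h, norm_zero] at hfc
    exact absurd hfc (not_le.2 (Real.exp_pos _))
  have hcR : c ∈ closedBall c R := mem_closedBall_self hR.le
  obtain ⟨S, g, hg, hg0, hS0, hfg⟩ := hf.exists_eq_prod_mul hR hfc0
  set k : ℂ → ℕ := fun u => (MeromorphicOn.divisor f (closedBall c R) u).toNat with hk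
  classical
  set S1 := S.filter (fun u => u ∈ closedBall c q) with hS1
  have hcount : ∑ u ∈ S1, (k u : ℝ) ≤ A * M := by
    refine (hf.sum_divisor_toNat_le hq hqR (B := Real.exp M) (Real.one_le_exp hM) hfc0 hfB S1
      (fun u hu => (Finset.mem_filter.1 hu).2)).trans ?_
    rw [hA, div_mul_eq_mul_div]
    apply div_le_div_of_nonneg_right _ hlogq.le
    rw [Real.log_div (Real.exp_pos _).ne' (by simpa using hfc0), Real.log_exp]
    have : -M ≤ Real.log ‖f c‖ := by
      rw [Real.le_log_iff_exp_le (by simpa using hfc0)]; exact hfc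
    linarith
  set N : ℝ := ∑ u ∈ S1, (k u : ℝ) with hN
  have hN0 : 0 ≤ N := Finset.sum_nonneg fun _ _ => Nat.cast_nonneg _
  -- the zero-free part on the smaller disc, with normalised linear factors removed
  set G : ℂ → ℂ := fun z => (∏ u ∈ S1, ((2 * R : ℝ) : ℂ) ^ k u) *
    ((∏ u ∈ S.filter (fun u => u ∉ closedBall c q), (z - u) ^ k u) * g z) with hG
  set Q : ℂ → ℂ := fun z => ∏ u ∈ S1, ((z - u) / ((2 * R : ℝ) : ℂ)) ^ k u with hQ
  have h2R : ((2 * R : ℝ) : ℂ) ≠ 0 := by exact_mod_cast (by positivity : (2 * R : ℝ) ≠ 0)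
  have hfac : ∀ z ∈ closedBall c R, f z = Q z * G z := by
    intro z hz
    rw [hfg z hz, ← Finset.prod_filter_mul_prod_filter_not S (fun u => u ∈ closedBall c q)]
    simp only [hQ, hG]
    rw [← mul_assoc, ← Finset.prod_mul_distrib, ← mul_assoc]
    congr 2
    refine Finset.prod_congr rfl fun u _ => ?_
    rw [← mul_pow, div_mul_cancel₀ _ h2R]
  have hGan : AnalyticOnNhd ℂ G (closedBall c R) := by
    intro z hz
    refine AnalyticAt.mul analyticAt_const (AnalyticAt.mul ?_ (hg z hz))
    apply Finset.analyticAt_fun_prod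
    intro u _
    fun_prop
  have hG0 : ∀ z ∈ closedBall c q, G z ≠ 0 := by
    intro z hz
    refine mul_ne_zero (Finset.prod_ne_zero_iff.2 fun u _ => pow_ne_zero _ h2R)
      (mul_ne_zero (Finset.prod_ne_zero_iff.2 fun u hu => pow_ne_zero _ ?_)
        (hg0 z (closedBall_subset_closedBall hqR.le hz)))
    intro h
    rw [sub_eq_zero] at h
    exact (Finset.mem_filter.1 hu).2 (h ▸ hz)
  have hQle : ∀ z ∈ closedBall c R, ‖Q z‖ ≤ 1 := by
    intro z hz
    simp only [hQ, norm_prod, norm_pow, norm_div]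
    refine Finset.prod_le_one (fun _ _ => by positivity) fun u hu => ?_
    refine pow_le_one₀ (by positivity) ?_
    rw [Complex.norm_real, Real.norm_of_nonneg (by positivity), div_le_one (by positivity)]
    have h1 := mem_closedBall.1 hz
    have h2 := mem_closedBall.1 (Finset.mem_filter.1 hu).2
    rw [← dist_eq_norm]
    have := dist_triangle_right z u c
    linarith
  have hQge : ∀ z ∈ sphere c R, Real.exp (-(N * Λ)) ≤ ‖Q z‖ := by
    intro z hz
    simp only [hQ, norm_prod, norm_pow, norm_div]
    rw [hN, Finset.sum_mul, ← Finset.sum_neg_distrib, Real.exp_sum]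
    refine Finset.prod_le_prod (fun _ _ => (Real.exp_pos _).le) fun u hu => ?_
    rw [show -((k u : ℝ) * Λ) = k u * (-Λ) by ring, Real.exp_nat_mul]
    refine pow_le_pow_left₀ (Real.exp_pos _).le ?_ _
    rw [hΛ, Real.exp_neg, Real.exp_log (div_pos (by positivity) (by linarith)), inv_div,
      Complex.norm_real, Real.norm_of_nonneg (by positivity)]
    refine div_le_div_of_nonneg_right ?_ (by positivity)
    have h1 := mem_sphere.1 hz
    have h2 := mem_closedBall.1 (Finset.mem_filter.1 hu).2
    rw [← dist_eq_norm]
    have := dist_triangle z u c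
    linarith
  -- Dividing by `Q` is cheap on the outer circle, far from the removed zeros; the maximum principle
  -- then carries the bound inside. At the centre |Q| ≤ 1, so the lower bound for `f` passes to `G`.
  have hGsphere : ∀ z ∈ sphere c R, ‖G z‖ ≤ Real.exp (M + N * Λ) := by
    intro z hz
    have hz' := sphere_subset_closedBall hz
    have h1 := hfB z hz'
    rw [hfac z hz', norm_mul] at h1
    have h2 : Real.exp (-(N * Λ)) * ‖G z‖ ≤ Real.exp M :=
      (mul_le_mul_of_nonneg_right (hQge z hz) (norm_nonneg _)).trans h1
    rw [Real.exp_neg, inv_mul_le_iff₀ (Real.exp_pos _)] at h2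
    rw [Real.exp_add, mul_comm]
    exact h2
  have hGball : ∀ z ∈ closedBall c R, ‖G z‖ ≤ Real.exp (M + N * Λ) := by
    intro z hz
    refine Complex.norm_le_of_forall_mem_frontier_norm_le (U := ball c R) isBounded_ball
      ?_ ?_ ?_
    · refine ⟨fun w hw => (hGan w (ball_subset_closedBall hw)).differentiableAt.differentiableWithinAt, ?_⟩
      rw [closure_ball c hR.ne']
      exact hGan.continuousOn
    · rw [frontier_ball c hR.ne']; exact hGsphere
    · rw [closure_ball c hR.ne']; exact hz
  have hGc : Real.exp (-M) ≤ ‖G c‖ := by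
    refine hfc.trans ?_
    rw [hfac c hcR, norm_mul]
    exact mul_le_of_le_one_left (norm_nonneg _) (hQle c hcR)
  obtain ⟨h, hh, hexp⟩ := DifferentiableOn.exists_log_ball hq (g := G) (c := c)
    (fun w hw => (hGan w (closedBall_subset_closedBall hqR.le
      (ball_subset_closedBall hw))).differentiableAt.differentiableWithinAt)
    (fun w hw => hG0 w (ball_subset_closedBall hw))
  have hlogG : ∀ z ∈ ball c q, Real.log ‖G z‖ = (h z).re := by
    intro z hz
    rw [← hexp z hz, Complex.norm_exp, Real.log_exp]
  have hcq : c ∈ ball c q := mem_ball_self hq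
  have hlow : -M ≤ (h c).re := by
    rw [← hlogG c hcq, Real.le_log_iff_exp_le (norm_pos_iff.2 (hG0 c (ball_subset_closedBall hcq)))]
    exact hGc
  have hup : ∀ z ∈ ball c q, (h z).re ≤ M + N * Λ := by
    intro z hz
    have hz0 := hG0 z (ball_subset_closedBall hz)
    rw [← hlogG z hz, Real.log_le_iff_le_exp (norm_pos_iff.2 hz0)]
    exact hGball z (closedBall_subset_closedBall hqR.le (ball_subset_closedBall hz))
  have hNΛ : N * Λ ≤ A * M * Λ := mul_le_mul_of_nonneg_right hcount hΛpos
  have hdiff : ∀ z ∈ closedBall c r, ‖h z - h c‖ ≤ 2 * (3 + A * Λ) * r / (q - r) * M := by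
    intro z hz
    have hz' : z - c ∈ ball (0 : ℂ) q := by
      rw [mem_ball_zero_iff, ← dist_eq_norm]
      exact lt_of_le_of_lt (mem_closedBall.1 hz) hrq
    have hshift : ∀ w ∈ ball (0 : ℂ) q, w + c ∈ ball c q := by
      intro w hw
      rw [mem_ball, dist_eq_norm, add_sub_cancel_right]
      exact mem_ball_zero_iff.1 hw
    -- The real part of h - h(c) is at most (M + NΛ) + M, with N ≤ AM, which fits under (3 + AΛ)M.
    have hb := Complex.borelCaratheodory_zero (f := fun w => h (w + c) - h c)
      (M := (3 + A * Λ) * M) (R := q) (z := z - c) (by positivity)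
      ((hh.comp (by fun_prop) hshift).sub_const _)
      (by
        intro w hw
        have h1 := hup _ (hshift w hw)
        simp only [Set.mem_ofPred_eq, Complex.sub_re]
        linarith) hq hz' (by simp)
    simp only [sub_add_cancel] at hb
    refine hb.trans ?_
    have hzr : ‖z - c‖ ≤ r := by rw [← dist_eq_norm]; exact mem_closedBall.1 hz
    calc 2 * ((3 + A * Λ) * M) * ‖z - c‖ / (q - ‖z - c‖)
        ≤ 2 * ((3 + A * Λ) * M) * r / (q - r) := by gcongr
      _ = _ := by ring
  refine ⟨S1, k, fun u hu => closedBall_subset_closedBall hqR.le (Finset.mem_filter.1 hu).2, ?_, ?_⟩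
  · refine hcount.trans ?_
    gcongr
    linarith
  · intro z hz hfz
    have hzR : z ∈ closedBall c R := closedBall_subset_closedBall hrR.le hz
    have hzq : z ∈ ball c q := closedBall_subset_ball hrq hz
    have hGz : G z ≠ 0 := hG0 z (ball_subset_closedBall hzq)
    have hQz : Q z ≠ 0 := by
      intro h0
      exact hfz (by rw [hfac z hzR, h0, zero_mul])
    have hlogQ : Real.log ‖Q z‖ = ∑ u ∈ S1, k u * Real.log (‖z - u‖ / (2 * R)) := by
      simp only [hQ, norm_prod]
      rw [Real.log_prod]
      · refine Finset.sum_congr rfl fun u _ => ?_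
        rw [norm_pow, Real.log_pow, norm_div, Complex.norm_real,
          Real.norm_of_nonneg (by positivity : (0 : ℝ) ≤ 2 * R)]
      · intro u hu
        rw [norm_ne_zero_iff]
        exact Finset.prod_ne_zero_iff.1 hQz u hu
    rw [hfac z hzR, norm_mul, Real.log_mul (norm_ne_zero_iff.2 hQz) (norm_ne_zero_iff.2 hGz),
      hlogQ, add_sub_cancel_left, hlogG z hzq]
    have h1 := (Complex.abs_re_le_norm (h z - h c)).trans (hdiff z hz)
    rw [Complex.sub_re] at h1
    have h2 := hup c hcq
    have h3 : |(h c).re| ≤ (2 + A * Λ) * M := by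
      rw [abs_le]
      have : 0 ≤ A * Λ * M := by positivity
      constructor <;> nlinarith
    have h4 : |(h z).re| ≤ |(h z).re - (h c).re| + |(h c).re| := by
      simpa using abs_add_le ((h z).re - (h c).re) ((h c).re)
    have h5 : 0 ≤ A * M := by positivity
    rw [hE]
    nlinarith
-- Integrals of |log|f|| over horizontal segments
theorem intervalIntegrable_abs_sub_rpow_neg_half (p a b : ℝ) :
    IntervalIntegrable (fun x => |x - p| ^ (-(1 / 2) : ℝ)) volume a b := by
  have hpos : ∀ d : ℝ, 0 ≤ d → IntervalIntegrable (fun x : ℝ => |x| ^ (-(1 / 2) : ℝ)) volume 0 d := by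
    intro d hd
    have h := intervalIntegral.intervalIntegrable_rpow' (a := 0) (b := d)
      (show (-1 : ℝ) < -(1 / 2) by norm_num)
    refine h.congr ?_
    intro x hx
    rw [Set.uIoc_of_le hd] at hx
    simp only [abs_of_pos hx.1]
  have h0 : ∀ d : ℝ, IntervalIntegrable (fun x : ℝ => |x| ^ (-(1 / 2) : ℝ)) volume 0 d := by
    intro d
    rcases le_total 0 d with hd | hd
    · exact hpos d hd
    · have h := hpos (-d) (by linarith)
      simpa using (IntervalIntegrable.comp_sub_left h 0)
  have h1 := ((h0 (a - p)).symm.trans (h0 (b - p))).comp_sub_right p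
  simpa using h1

/-- The bound is uniform in the position of the singularity: a segment containing `p` is split
there, and each half costs at most 2√(b - a). This is the source of the factor √(b - a) which makes
short segments negligible. -/
theorem integral_abs_sub_rpow_neg_half_le {p a b : ℝ} (hab : a ≤ b) :
    ∫ x in a..b, |x - p| ^ (-(1 / 2) : ℝ) ≤ 4 * √(b - a) := by
  have hpos : ∀ a b : ℝ, 0 ≤ a → a ≤ b →
      ∫ x in a..b, |x| ^ (-(1 / 2) : ℝ) ≤ 2 * √(b - a) := by
    intro a b ha hab
    have h1 : ∫ x in a..b, |x| ^ (-(1 / 2) : ℝ) = ∫ x in a..b, x ^ (-(1 / 2) : ℝ) := by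
      refine intervalIntegral.integral_congr fun x hx => ?_
      rw [Set.uIcc_of_le hab] at hx
      simp only [abs_of_nonneg (ha.trans hx.1)]
    rw [h1, integral_rpow (Or.inl (by norm_num))]
    norm_num
    rw [← Real.sqrt_eq_rpow, ← Real.sqrt_eq_rpow]
    have h2 : √b ≤ √(b - a) + √a := by
      rw [Real.sqrt_le_left (by positivity), add_sq, Real.sq_sqrt (by linarith), Real.sq_sqrt ha]
      have : 0 ≤ √(b - a) * √a := by positivity
      linarith
    linarith
  have hneg : ∀ a b : ℝ, a ≤ b → b ≤ 0 →
      ∫ x in a..b, |x| ^ (-(1 / 2) : ℝ) ≤ 2 * √(b - a) := by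
    intro a b hab hb
    have h := hpos (-b) (-a) (by linarith) (by linarith)
    have h2 := intervalIntegral.integral_comp_neg (a := a) (b := b)
      (fun x : ℝ => |x| ^ (-(1 / 2) : ℝ))
    simp only [abs_neg] at h2
    rw [h2]
    convert h using 3
    ring
  have hii : ∀ a b : ℝ, IntervalIntegrable (fun x => |x| ^ (-(1 / 2) : ℝ)) volume a b := by
    intro a b
    simpa using intervalIntegrable_abs_sub_rpow_neg_half 0 a b
  have hshift := intervalIntegral.integral_comp_sub_right (a := a) (b := b)
      (fun x : ℝ => |x| ^ (-(1 / 2) : ℝ)) p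
  rw [hshift, show b - a = (b - p) - (a - p) by ring]
  have hab' : a - p ≤ b - p := by linarith
  generalize a - p = a' at *
  generalize b - p = b' at *
  have hs : 0 ≤ √(b' - a') := Real.sqrt_nonneg _
  rcases le_total 0 a' with ha | ha
  · linarith [hpos a' b' ha hab']
  · rcases le_total b' 0 with hb | hb
    · linarith [hneg a' b' hab' hb]
    · rw [← intervalIntegral.integral_add_adjacent_intervals (hii a' 0) (hii 0 b')]
      have h1 := hneg a' 0 ha le_rfl
      have h2 := hpos 0 b' le_rfl hb
      have h3 : √(0 - a') ≤ √(b' - a') := Real.sqrt_le_sqrt (by linarith)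
      have h4 : √(b' - 0) ≤ √(b' - a') := Real.sqrt_le_sqrt (by linarith)
      linarith

/-- The distance to `u` is at least the horizontal distance, so the height of `u` plays no role, and
|log v| ≤ 2 v^(-1/2) for 0 < v ≤ 1 replaces the logarithm by an integrable power. -/
theorem abs_log_norm_sub_div_le {z u : ℂ} {R : ℝ} (hR : 0 < R) (hzu : ‖z - u‖ ≤ 2 * R)
    (hre : z.re ≠ u.re) :
    |Real.log (‖z - u‖ / (2 * R))| ≤ 2 * (2 * R) ^ (1 / 2 : ℝ) * |z.re - u.re| ^ (-(1 / 2) : ℝ) := by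
  have hx : 0 < |z.re - u.re| := abs_pos.2 (sub_ne_zero.2 hre)
  have hle : |z.re - u.re| ≤ ‖z - u‖ := by
    rw [← Complex.sub_re]; exact Complex.abs_re_le_norm _
  have hn : 0 < ‖z - u‖ := hx.trans_le hle
  set v := |z.re - u.re| / (2 * R) with hv
  have hv0 : 0 < v := by positivity
  have h1 : Real.log (‖z - u‖ / (2 * R)) ≤ 0 :=
    Real.log_nonpos (by positivity) (by rw [div_le_one (by positivity)]; exact hzu)
  have h2 : Real.log v ≤ Real.log (‖z - u‖ / (2 * R)) :=
    Real.log_le_log hv0 (by rw [hv]; gcongr)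
  rw [abs_of_nonpos h1]
  have h3 : Real.log (v ^ (-(1 / 2) : ℝ)) ≤ v ^ (-(1 / 2) : ℝ) :=
    (Real.log_le_sub_one_of_pos (by positivity)).trans (by linarith)
  rw [Real.log_rpow hv0] at h3
  have h4 : v ^ (-(1 / 2) : ℝ) = (2 * R) ^ (1 / 2 : ℝ) * |z.re - u.re| ^ (-(1 / 2) : ℝ) := by
    rw [hv, Real.div_rpow hx.le (by positivity), Real.rpow_neg (by positivity : (0:ℝ) ≤ 2 * R)]
    rw [div_inv_eq_mul, mul_comm]
  rw [h4] at h3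
  linarith

open Metric in
/-- `log ‖f‖` has small integral over short horizontal segments, uniformly in `f`. -/
theorem exists_integral_abs_log_norm_le {r R : ℝ} (hr : 0 < r) (hrR : r < R) :
    ∃ C : ℝ, 0 < C ∧ ∀ (f : ℂ → ℂ) (c : ℂ) (M : ℝ), 0 < M → AnalyticOnNhd ℂ f (closedBall c R) →
      (∀ z ∈ closedBall c R, ‖f z‖ ≤ Real.exp M) → Real.exp (-M) ≤ ‖f c‖ →
      ∀ a b y : ℝ, a ≤ b → (∀ x ∈ Set.Icc a b, (x + y * Complex.I : ℂ) ∈ closedBall c r) →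
        IntervalIntegrable (fun x : ℝ => Real.log ‖f (x + y * Complex.I)‖) volume a b ∧
        ∫ x in a..b, |Real.log ‖f (x + y * Complex.I)‖| ≤ C * M * √(b - a) := by
  obtain ⟨C, hC, hdec⟩ := exists_log_norm_decomposition hr hrR
  have hR : 0 < R := hr.trans hrR
  set D : ℝ := 2 * (2 * R) ^ (1 / 2 : ℝ) with hD
  have hDpos : 0 < D := by positivity
  refine ⟨C * √(2 * r) + C * (D * 4), by positivity, ?_⟩
  intro f c M hM hf hfB hfc a b y hab hseg
  obtain ⟨S, k, hS, hk, hlog⟩ := hdec f c M hM hf hfB hfc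
  -- A majorant whose total mass is linear in M, because the multiplicities sum to at most C * M. It
  -- can fail only at the finitely many abscissae of the removed zeros.
  set B : ℝ → ℝ := fun x => C * M + ∑ u ∈ S, k u * (D * |x - u.re| ^ (-(1 / 2) : ℝ)) with hB
  have hsub : ∀ x ∈ Set.Icc a b, (x + y * Complex.I : ℂ) ∈ closedBall c R := fun x hx =>
    closedBall_subset_closedBall hrR.le (hseg x hx)
  have hpt : ∀ x ∈ Set.Icc a b, (∀ u ∈ S, x ≠ u.re) →
      |Real.log ‖f (x + y * Complex.I)‖| ≤ B x := by
    intro x hx hxu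
    have hterm : ∀ u ∈ S, |k u * Real.log (‖(x + y * Complex.I : ℂ) - u‖ / (2 * R))| ≤
        k u * (D * |x - u.re| ^ (-(1 / 2) : ℝ)) := by
      intro u hu
      rw [abs_mul, Nat.abs_cast]
      refine mul_le_mul_of_nonneg_left ?_ (Nat.cast_nonneg _)
      have h1 := abs_log_norm_sub_div_le (z := (x + y * Complex.I : ℂ)) (u := u) hR ?_ ?_
      · simpa [hD] using h1
      · have h2 := mem_closedBall.1 (hsub x hx)
        have h3 := mem_closedBall.1 (hS u hu)
        have := dist_triangle_right (x + y * Complex.I : ℂ) u c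
        rw [← dist_eq_norm]
        linarith
      · simpa using hxu u hu
    have hsum := (Finset.abs_sum_le_sum_abs (fun u => k u *
      Real.log (‖(x + y * Complex.I : ℂ) - u‖ / (2 * R))) S).trans (Finset.sum_le_sum hterm)
    rcases eq_or_ne (f (x + y * Complex.I)) 0 with h0 | h0
    · rw [h0, norm_zero, Real.log_zero, abs_zero]
      have := (abs_nonneg _).trans hsum
      have : 0 < C * M := by positivity
      rw [hB]
      dsimp only
      linarith
    · have h1 := hlog _ (hseg x hx) h0
      have h2 := abs_add_le (Real.log ‖f (x + y * Complex.I)‖ - ∑ u ∈ S, k u *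
        Real.log (‖(x + y * Complex.I : ℂ) - u‖ / (2 * R))) (∑ u ∈ S, k u *
        Real.log (‖(x + y * Complex.I : ℂ) - u‖ / (2 * R)))
      rw [sub_add_cancel] at h2
      rw [hB]
      dsimp only
      linarith
  have hterm : ∀ u ∈ S, IntervalIntegrable
      (fun x => k u * (D * |x - u.re| ^ (-(1 / 2) : ℝ))) volume a b := fun u _ =>
    ((intervalIntegrable_abs_sub_rpow_neg_half u.re a b).const_mul D).const_mul _
  have hsumint : IntervalIntegrable (fun x => ∑ u ∈ S, k u * (D * |x - u.re| ^ (-(1 / 2) : ℝ)))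
      volume a b := by
    have := IntervalIntegrable.sum S hterm
    refine this.congr ?_
    intro x _
    simp
  have hBint : IntervalIntegrable B volume a b := intervalIntegrable_const.add hsumint
  have hae : ∀ᵐ x : ℝ ∂(volume.restrict (Set.Ioc a b)),
      |Real.log ‖f (x + y * Complex.I)‖| ≤ B x := by
    have hfin : ((fun u : ℂ => u.re) '' (S : Set ℂ)).Finite := S.finite_toSet.image _
    have h1 : ∀ᵐ x : ℝ ∂volume, x ∉ ((fun u : ℂ => u.re) '' (S : Set ℂ)) :=
      measure_eq_zero_iff_ae_notMem.1 (hfin.measure_zero _)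
    filter_upwards [ae_restrict_mem measurableSet_Ioc, ae_restrict_of_ae h1] with x hx hx'
    refine hpt x ⟨hx.1.le, hx.2⟩ fun u hu h => hx' ⟨u, hu, h.symm⟩
  have hmeas : AEStronglyMeasurable (fun x : ℝ => Real.log ‖f (x + y * Complex.I)‖)
      (volume.restrict (Set.Ioc a b)) := by
    have hc : ContinuousOn (fun x : ℝ => f (x + y * Complex.I)) (Set.Icc a b) :=
      hf.continuousOn.comp (by fun_prop) hsub
    have h1 : AEMeasurable (fun x : ℝ => f (x + y * Complex.I)) (volume.restrict (Set.Ioc a b)) :=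
      (hc.mono Set.Ioc_subset_Icc_self).aemeasurable measurableSet_Ioc
    exact (Real.measurable_log.comp_aemeasurable h1.norm).aestronglyMeasurable
  have hint : IntervalIntegrable (fun x : ℝ => Real.log ‖f (x + y * Complex.I)‖) volume a b := by
    rw [intervalIntegrable_iff_integrableOn_Ioc_of_le hab] at hBint ⊢
    exact Integrable.mono' hBint hmeas hae
  refine ⟨hint, ?_⟩
  have hba : b - a ≤ 2 * r := by
    have h1 := mem_closedBall.1 (hseg a ⟨le_rfl, hab⟩)
    have h2 := mem_closedBall.1 (hseg b ⟨hab, le_rfl⟩)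
    have h3 := dist_triangle_right (b + y * Complex.I : ℂ) (a + y * Complex.I) c
    have h4 : dist (b + y * Complex.I : ℂ) (a + y * Complex.I) = b - a := by
      rw [dist_eq_norm, add_sub_add_right_eq_sub, ← Complex.ofReal_sub, Complex.norm_real,
        Real.norm_of_nonneg (by linarith)]
    linarith
  calc ∫ x in a..b, |Real.log ‖f (x + y * Complex.I)‖|
      ≤ ∫ x in a..b, B x := by
        rw [intervalIntegral.integral_of_le hab, intervalIntegral.integral_of_le hab]
        rw [intervalIntegrable_iff_integrableOn_Ioc_of_le hab] at hBint hint
        exact integral_mono_ae hint.abs hBint hae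
    _ = C * M * (b - a) + ∑ u ∈ S, k u * (D * ∫ x in a..b, |x - u.re| ^ (-(1 / 2) : ℝ)) := by
        rw [hB, intervalIntegral.integral_add intervalIntegrable_const hsumint,
          intervalIntegral.integral_finsetSum hterm]
        simp only [intervalIntegral.integral_const, smul_eq_mul,
          intervalIntegral.integral_const_mul]
        ring
    _ ≤ C * M * (√(2 * r) * √(b - a)) + ∑ u ∈ S, k u * (D * (4 * √(b - a))) := by
        gcongr with u hu
        · have h1 := Real.mul_self_sqrt (sub_nonneg.2 hab)
          have h2 : √(b - a) ≤ √(2 * r) := Real.sqrt_le_sqrt hba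
          nlinarith [Real.sqrt_nonneg (b - a)]
        · exact integral_abs_sub_rpow_neg_half_le hab
    _ = C * M * (√(2 * r) * √(b - a)) + (∑ u ∈ S, (k u : ℝ)) * (D * (4 * √(b - a))) := by
        rw [Finset.sum_mul]
    _ ≤ C * M * (√(2 * r) * √(b - a)) + (C * M) * (D * (4 * √(b - a))) := by
        gcongr
    _ = _ := by ring

/-! ### A maximum principle on tall rectangles -/

open Metric in
theorem AnalyticOnNhd.circleAverage_re {f : ℂ → ℂ} {c : ℂ} {r : ℝ}
    (hf : AnalyticOnNhd ℂ f (closedBall c |r|)) :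
    Real.circleAverage (fun z => (f z).re) c r = (f c).re :=
  InnerProductSpace.HarmonicOnNhd.circleAverage_eq fun x hx => (hf x hx).harmonicAt_re

theorem Complex.cos_half_re (z : ℂ) :
    (Complex.cos (z / 2)).re = Real.cos (z.re / 2) * Real.cosh (z.im / 2) := by
  have h : z / 2 = ((z.re / 2 : ℝ) : ℂ) + ((z.im / 2 : ℝ) : ℂ) * Complex.I := by
    apply Complex.ext <;> simp
  rw [h, Complex.cos_add_mul_I, ← Complex.ofReal_cos, ← Complex.ofReal_cosh, ← Complex.ofReal_sin,
    ← Complex.ofReal_sinh]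
  simp [-Complex.ofReal_cos, -Complex.ofReal_cosh, -Complex.ofReal_sin, -Complex.ofReal_sinh]

open Metric in
/-- A function satisfying the sub-mean-value inequality on a rectangle of bounded width is
controlled at the middle height by its values on the vertical sides, up to an error which decays
with the height of the rectangle. -/
theorem le_of_submean_rectangle {u : ℂ → ℝ} {a b T K A B : ℝ} (hab : b - a ≤ 5 / 2)
    (hK : 0 < K) (hA : 0 ≤ A) (hB : 0 ≤ B)
    (husc : UpperSemicontinuousOn u {s : ℂ | (a ≤ s.re ∧ s.re ≤ b) ∧ |s.im - T| ≤ K})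
    (hsub : ∀ p : ℂ, a < p.re → p.re < b → |p.im - T| < K → u p ≤ 0 ∨ ∀ r > 0,
      closedBall p r ⊆ {s : ℂ | (a ≤ s.re ∧ s.re ≤ b) ∧ |s.im - T| ≤ K} →
        CircleIntegrable u p r ∧ u p ≤ Real.circleAverage u p r)
    (hvert : ∀ s : ℂ, s.re = a ∨ s.re = b → |s.im - T| ≤ K → u s ≤ A)
    (hall : ∀ s : ℂ, a ≤ s.re → s.re ≤ b → |s.im - T| ≤ K → u s ≤ B)
    {σ : ℝ} (hσa : a ≤ σ) (hσb : σ ≤ b) : u (σ + T * Complex.I) ≤ A + 4 * B / K := by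
  set Q : Set ℂ := {s : ℂ | (a ≤ s.re ∧ s.re ≤ b) ∧ |s.im - T| ≤ K} with hQ
  set z₀ : ℂ := ((a + b) / 2 : ℝ) + T * Complex.I with hz₀
  have hz₀re : z₀.re = (a + b) / 2 := by simp [hz₀]
  have hz₀im : z₀.im = T := by simp [hz₀]
  -- The barrier Re h = A + (2B / cosh(K/2)) cos(x/2) cosh(y/2), with x and y measured from the
  -- centre. Since |x/2| ≤ 5/8, the cosine is at least 1/2, so Re h ≥ A throughout and Re h ≥ B on
  -- the horizontal sides, while at middle height only 2B / cosh(K/2) ≤ 4B/K is added to A.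
  set h : ℂ → ℂ := fun s => (A : ℂ) + (2 * B / Real.cosh (K / 2) : ℝ) * Complex.cos ((s - z₀) / 2)
    with hh
  have hcoshK : 0 < Real.cosh (K / 2) := Real.cosh_pos _
  have hre : ∀ s, (h s).re = A + 2 * B / Real.cosh (K / 2) *
      (Real.cos ((s.re - z₀.re) / 2) * Real.cosh ((s.im - T) / 2)) := by
    intro s
    rw [hh]
    dsimp only
    rw [Complex.add_re, Complex.re_ofReal_mul, Complex.cos_half_re, Complex.ofReal_re,
      Complex.sub_re, Complex.sub_im, hz₀im]
  have hcos : ∀ s ∈ Q, 1 / 2 ≤ Real.cos ((s.re - z₀.re) / 2) := by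
    intro s hs
    refine le_trans ?_ (Real.one_sub_sq_div_two_le_cos)
    have h1 : |(s.re - z₀.re) / 2| ≤ 5 / 8 := by
      rw [hz₀re, abs_le]
      constructor <;> linarith [hs.1.1, hs.1.2]
    have := sq_le_sq' (by linarith [(abs_le.1 h1).1]) (abs_le.1 h1).2
    linarith
  have hA_le : ∀ s ∈ Q, A ≤ (h s).re := by
    intro s hs
    rw [hre]
    have h1 := hcos s hs
    have h2 := Real.cosh_pos ((s.im - T) / 2)
    have : 0 ≤ 2 * B / Real.cosh (K / 2) *
      (Real.cos ((s.re - z₀.re) / 2) * Real.cosh ((s.im - T) / 2)) := by positivity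
    linarith
  have hB_le : ∀ s ∈ Q, |s.im - T| = K → B ≤ (h s).re := by
    intro s hs hK'
    rw [hre]
    have h1 := hcos s hs
    have h2 : Real.cosh ((s.im - T) / 2) = Real.cosh (K / 2) := by
      rw [← Real.cosh_abs, abs_div, hK', abs_of_pos (by norm_num : (0 : ℝ) < 2)]
    rw [h2]
    have h3 : 2 * B / Real.cosh (K / 2) * (Real.cos ((s.re - z₀.re) / 2) * Real.cosh (K / 2)) =
      2 * B * Real.cos ((s.re - z₀.re) / 2) := by field_simp
    rw [h3]
    nlinarith
  have hhan : ∀ s, AnalyticAt ℂ h s := by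
    intro s
    refine analyticAt_const.add (analyticAt_const.mul ?_)
    exact (Complex.analyticAt_cos).comp (by fun_prop)
  have hQc : IsCompact Q := by
    have h1 : Q = Set.Icc a b ×ℂ Set.Icc (T - K) (T + K) := by
      ext s
      simp only [hQ, Set.mem_ofPred_eq, Complex.mem_reProdIm, Set.mem_Icc, abs_le]
      constructor
      · rintro ⟨h1, h2, h3⟩; exact ⟨h1, by linarith, by linarith⟩
      · rintro ⟨h1, h2, h3⟩; exact ⟨h1, by linarith, by linarith⟩
    rw [h1]
    exact isCompact_Icc.reProdIm isCompact_Icc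
  have hσQ : ((σ : ℂ) + T * Complex.I) ∈ Q := by
    simp [hQ, hσa, hσb, hK.le]
  obtain ⟨D, hD⟩ := hQc.isBounded.exists_norm_le
  -- The term κ|s|² makes the sub-mean-value inequality strict, so an interior maximum is impossible
  -- unless the alternative `u p ≤ 0` holds, which is harmless since Re h ≥ A ≥ 0. Afterwards κ
  -- tends to 0.
  have hmain : ∀ κ > 0, ∀ s ∈ Q, u s - (h s).re + κ * ‖s‖ ^ 2 ≤ κ * D ^ 2 := by
    intro κ hκ
    set v : ℂ → ℝ := fun s => u s + (κ * ‖s‖ ^ 2 - (h s).re) with hv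
    have hhc : Continuous h := continuous_iff_continuousAt.2 fun s => (hhan s).continuousAt
    have hvusc : UpperSemicontinuousOn v Q := by
      refine husc.add (ContinuousOn.upperSemicontinuousOn ?_)
      exact ((continuous_const.mul (continuous_norm.pow 2)).sub
        (Complex.continuous_re.comp hhc)).continuousOn
    obtain ⟨p, hpQ, hpmax⟩ := hvusc.exists_isMaxOn ⟨_, hσQ⟩ hQc
    have hpD : κ * ‖p‖ ^ 2 ≤ κ * D ^ 2 := by gcongr; exact hD p hpQ
    have hgoal : u p ≤ (h p).re → ∀ s ∈ Q, u s - (h s).re + κ * ‖s‖ ^ 2 ≤ κ * D ^ 2 := by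
      intro h1 s hs
      have h2 : v s ≤ v p := hpmax hs
      simp only [hv] at h2
      linarith
    by_cases hint : a < p.re ∧ p.re < b ∧ |p.im - T| < K
    · rcases hsub p hint.1 hint.2.1 hint.2.2 with h0 | hmean
      · exact hgoal (h0.trans (hA.trans (hA_le p hpQ)))
      · exfalso
        have hnhds : Q ∈ 𝓝 p := by
          have : IsOpen {s : ℂ | a < s.re ∧ s.re < b ∧ |s.im - T| < K} := by
            refine (isOpen_lt continuous_const Complex.continuous_re).inter
              ((isOpen_lt Complex.continuous_re continuous_const).inter
              (isOpen_lt (Complex.continuous_im.sub continuous_const).abs continuous_const))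
          refine Filter.mem_of_superset (this.mem_nhds hint) ?_
          rintro s ⟨h1, h2, h3⟩
          exact ⟨⟨h1.le, h2.le⟩, h3.le⟩
        obtain ⟨r, hr, hrQ⟩ := nhds_basis_closedBall.mem_iff.1 hnhds
        obtain ⟨hci, hle⟩ := hmean r hr hrQ
        -- On the circle |w - p| = r the quadratic term |w|² equals r² + 2 Re(p̄(w - p)) + |p|².
        -- Replacing it by this expression gives an analytic `e`, whose average is its value at `p`;
        -- the extra r² yields the contradiction.
        set e : ℂ → ℂ := fun w => h w - (κ : ℂ) * ((r ^ 2 : ℝ) +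
          2 * (starRingEnd ℂ p * (w - p)) + (‖p‖ ^ 2 : ℝ)) with he
        have hean : AnalyticOnNhd ℂ e (closedBall p |r|) := by
          intro w _
          refine (hhan w).sub ?_
          fun_prop
        have heavg := hean.circleAverage_re
        have heci : CircleIntegrable (fun w => (e w).re) p r := by
          apply ContinuousOn.circleIntegrable'
          exact Complex.continuous_re.comp_continuousOn
            (hean.continuousOn.mono sphere_subset_closedBall)
        have hle2 : Real.circleAverage u p r ≤
            Real.circleAverage (fun w => v p + (e w).re) p r := by
          refine Real.circleAverage_mono hci (circleIntegrable_const _ _ _ |>.add heci) ?_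
          intro w hw
          rw [abs_of_pos hr] at hw
          have h1 : v w ≤ v p := hpmax (hrQ (sphere_subset_closedBall hw))
          have h2 : ‖w‖ ^ 2 = r ^ 2 + 2 * (starRingEnd ℂ p * (w - p)).re + ‖p‖ ^ 2 := by
            have h3 : ‖w - p‖ = r := by rw [← dist_eq_norm]; exact mem_sphere.1 hw
            have h4 : r ^ 2 = Complex.normSq (w - p) := by
              rw [Complex.normSq_eq_norm_sq, h3]
            rw [h4, ← Complex.normSq_eq_norm_sq, ← Complex.normSq_eq_norm_sq]
            simp [Complex.normSq_apply]
            ring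
          have h3 : (e w).re = (h w).re - κ * ‖w‖ ^ 2 := by
            rw [h2, he]
            dsimp only
            rw [Complex.sub_re, Complex.re_ofReal_mul, Complex.add_re, Complex.add_re,
              Complex.ofReal_re, Complex.ofReal_re]
            simp [-Complex.ofReal_pow]
          simp only [hv] at h1 ⊢
          linarith
        have hsum : Real.circleAverage (fun w => v p + (e w).re) p r = v p + (e p).re := by
          rw [Real.circleAverage_fun_add (circleIntegrable_const _ _ _) heci, heavg,
            Real.circleAverage_const]
        have hep : (e p).re = (h p).re - κ * (r ^ 2 + ‖p‖ ^ 2) := by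
          rw [he]
          dsimp only
          rw [Complex.sub_re, Complex.re_ofReal_mul, Complex.add_re, Complex.add_re,
            Complex.ofReal_re, Complex.ofReal_re]
          simp [-Complex.ofReal_pow]
        rw [hsum, hep] at hle2
        have : 0 < κ * r ^ 2 := by positivity
        simp only [hv] at hle2
        nlinarith
    · apply hgoal
      by_cases h1 : p.re = a ∨ p.re = b
      · exact (hvert p h1 hpQ.2).trans (hA_le p hpQ)
      · push Not at h1
        have h2 : |p.im - T| = K := by
          refine le_antisymm hpQ.2 ?_
          by_contra h3
          exact hint ⟨lt_of_le_of_ne hpQ.1.1 (Ne.symm h1.1), lt_of_le_of_ne hpQ.1.2 h1.2,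
            not_le.1 h3⟩
        exact (hall p hpQ.1.1 hpQ.1.2 hpQ.2).trans (hB_le p hpQ h2)
  have hfin : u (σ + T * Complex.I) ≤ (h (σ + T * Complex.I)).re := by
    refine le_of_forall_pos_le_add fun ε hε => ?_
    have h1 := hmain (ε / (D ^ 2 + 1)) (by positivity) _ hσQ
    have h2 : ε / (D ^ 2 + 1) * D ^ 2 ≤ ε := by
      rw [div_mul_eq_mul_div, div_le_iff₀ (by positivity)]
      nlinarith
    have h3 : 0 ≤ ε / (D ^ 2 + 1) * ‖(σ : ℂ) + T * Complex.I‖ ^ 2 := by positivity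
    linarith
  refine hfin.trans ?_
  rw [hre]
  have h1 : ((σ : ℂ) + T * Complex.I).im - T = 0 := by simp
  rw [h1, zero_div, Real.cosh_zero, mul_one]
  have h2 : K / 2 ≤ Real.cosh (K / 2) := by
    have h3 := Real.self_le_sinh_iff.2 (by linarith : 0 ≤ K / 2)
    linarith [Real.sinh_lt_cosh (K / 2)]
  have h3 := Real.cos_le_one ((((σ : ℂ) + T * Complex.I).re - z₀.re) / 2)
  have h4 : 2 * B / Real.cosh (K / 2) ≤ 2 * B / (K / 2) := by gcongr
  have h5 : 2 * B / (K / 2) = 4 * B / K := by field_simp; ring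
  have h6 : 0 ≤ 2 * B / Real.cosh (K / 2) := by positivity
  nlinarith

/-! ### Elementary bounds for ζ to the right of the line Re s = 0 -/

open Set in
/-- The Mellin-type integral of the fractional part which continues `ζ` to `Re s > 0`. -/
noncomputable def fractIntegral (s : ℂ) : ℂ :=
  ∫ x in Ioi (1 : ℝ), ((Int.fract x : ℝ) : ℂ) * (x : ℂ) ^ (-(s + 1))

open Set in
theorem norm_fract_mul_cpow_le (s : ℂ) {x : ℝ} (hx : x ∈ Ioi (1 : ℝ)) :
    ‖((Int.fract x : ℝ) : ℂ) * (x : ℂ) ^ (-(s + 1))‖ ≤ x ^ (-(s.re + 1)) := by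
  have hx0 : 0 < x := zero_lt_one.trans hx
  rw [norm_mul, Complex.norm_cpow_eq_rpow_re_of_pos hx0, Complex.norm_real,
    Real.norm_of_nonneg (Int.fract_nonneg x)]
  have h : (-(s + 1)).re = -(s.re + 1) := by simp
  rw [h]
  exact mul_le_of_le_one_left (by positivity) (Int.fract_lt_one x).le

open Set in
theorem integrableOn_fract_mul_cpow {s : ℂ} (hs : 0 < s.re) :
    IntegrableOn (fun x : ℝ => ((Int.fract x : ℝ) : ℂ) * (x : ℂ) ^ (-(s + 1))) (Ioi 1) := by
  have h1 : IntegrableOn (fun x : ℝ => x ^ (-(s.re + 1))) (Ioi 1) :=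
    integrableOn_Ioi_rpow_of_lt (by linarith) one_pos
  refine Integrable.mono' h1 ?_ ?_
  · refine AEStronglyMeasurable.mul ?_ ?_
    · exact (Complex.measurable_ofReal.comp measurable_fract).aestronglyMeasurable
    · refine ContinuousOn.aestronglyMeasurable ?_ measurableSet_Ioi
      intro x hx
      refine ContinuousAt.continuousWithinAt ?_
      refine (Complex.continuousAt_ofReal_cpow_const _ _ (Or.inr ?_))
      exact (zero_lt_one.trans hx).ne'
  · filter_upwards [ae_restrict_mem measurableSet_Ioi] with x hx
    exact norm_fract_mul_cpow_le s hx

open Set in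
theorem norm_fractIntegral_le {s : ℂ} (hs : 0 < s.re) : ‖fractIntegral s‖ ≤ 1 / s.re := by
  have h1 : IntegrableOn (fun x : ℝ => x ^ (-(s.re + 1))) (Ioi 1) :=
    integrableOn_Ioi_rpow_of_lt (by linarith) one_pos
  refine (norm_integral_le_of_norm_le h1 ?_).trans (le_of_eq ?_)
  · filter_upwards [ae_restrict_mem measurableSet_Ioi] with x hx
    exact norm_fract_mul_cpow_le s hx
  · rw [integral_Ioi_rpow_of_lt (by linarith) one_pos]
    simp

-- The integral is the Mellin transform at -s of the fractional part cut off below 1. That function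
-- is bounded at infinity and vanishes near 0, so the transform is holomorphic where Re(-s) < 0.
open Set in
theorem differentiableAt_fractIntegral {s : ℂ} (hs : 0 < s.re) :
    DifferentiableAt ℂ fractIntegral s := by
  set f : ℝ → ℂ := (Ioi (1 : ℝ)).indicator fun x => ((Int.fract x : ℝ) : ℂ) with hf
  have hfb : ∀ x, ‖f x‖ ≤ 1 := by
    intro x
    rw [hf]
    refine (norm_indicator_le_norm_self _ _).trans ?_
    rw [Complex.norm_real, Real.norm_of_nonneg (Int.fract_nonneg x)]
    exact (Int.fract_lt_one x).le
  have hfm : Measurable f :=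
    (Complex.measurable_ofReal.comp measurable_fract).indicator measurableSet_Ioi
  have hmel : fractIntegral = fun s => mellin f (-s) := by
    ext s
    rw [fractIntegral, mellin, ← integral_indicator measurableSet_Ioi,
      ← integral_indicator measurableSet_Ioi]
    congr 1
    ext x
    simp only [hf, indicator]
    by_cases h1 : x ∈ Ioi (1 : ℝ)
    · have h0 : x ∈ Ioi (0 : ℝ) := mem_Ioi.2 (lt_trans one_pos (mem_Ioi.1 h1))
      simp only [h1, h0, if_true, smul_eq_mul]
      rw [mul_comm, show -(s + 1) = -s - 1 by ring]
    · simp [h1]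
  rw [hmel]
  have h := mellin_differentiableAt_of_isBigO_rpow (a := 0) (b := (-s).re - 1) (f := f) (s := -s)
    ?_ ?_ ?_ ?_ ?_
  · exact h.comp s differentiableAt_id.neg
  · refine LocallyIntegrable.locallyIntegrableOn ?_ _
    refine (locallyIntegrable_const (1 : ℝ)).mono hfm.aestronglyMeasurable ?_
    exact Eventually.of_forall fun x => by simpa using hfb x
  · refine IsBigO.of_bound 1 (Eventually.of_forall fun x => ?_)
    simpa using hfb x
  · simpa using hs
  · refine IsBigO.of_bound 1 ?_
    have : ∀ᶠ x : ℝ in 𝓝[>] 0, x < 1 := nhdsWithin_le_nhds (gt_mem_nhds one_pos)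
    filter_upwards [this] with x hx
    have : f x = 0 := by rw [hf]; exact indicator_of_notMem (not_lt.2 hx.le) _
    rw [this, norm_zero]
    positivity
  · linarith

open Set in
theorem riemannZeta_eq_fractIntegral_of_one_lt {s : ℂ} (hs : 1 < s.re) :
    riemannZeta s = s / (s - 1) - s * fractIntegral s := by
  have h1 := LSeries_eq_mul_integral (fun _ => (1 : ℂ)) (r := 1) zero_le_one hs
    ?_ ?_
  · have h2 : LSeries (fun _ => (1 : ℂ)) s = riemannZeta s := LSeries_one_eq_riemannZeta hs
    rw [h2] at h1
    rw [h1, fractIntegral]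
    have h3 : ∀ x ∈ Ioi (1 : ℝ), (∑ k ∈ Finset.Icc 1 ⌊x⌋₊, (1 : ℂ)) * (x : ℂ) ^ (-(s + 1)) =
        (x : ℂ) ^ (-s) - ((Int.fract x : ℝ) : ℂ) * (x : ℂ) ^ (-(s + 1)) := by
      intro x hx
      have hx0 : (0 : ℝ) < x := lt_trans one_pos hx
      have hx0' : (x : ℂ) ≠ 0 := by exact_mod_cast hx0.ne'
      have h4 : (x : ℂ) ^ (-s) = x * (x : ℂ) ^ (-(s + 1)) := by
        rw [show -s = 1 + -(s + 1) by ring, Complex.cpow_add _ _ hx0', Complex.cpow_one]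
      have h5 : ((⌊x⌋₊ : ℕ) : ℝ) = x - Int.fract x := by
        rw [natCast_floor_eq_intCast_floor hx0.le]
        simp [Int.self_sub_fract]
      have h6 : (∑ k ∈ Finset.Icc 1 ⌊x⌋₊, (1 : ℂ)) = (x : ℂ) - (Int.fract x : ℝ) := by
        simp only [Finset.sum_const, Nat.card_Icc, Nat.add_sub_cancel, nsmul_eq_mul, mul_one]
        rw [← Complex.ofReal_sub, ← h5]
        simp
      rw [h6, h4]
      ring
    rw [setIntegral_congr_fun measurableSet_Ioi h3, integral_sub
      (integrableOn_Ioi_cpow_of_lt (by simpa using hs) one_pos)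
      (integrableOn_fract_mul_cpow (by linarith)),
      integral_Ioi_cpow_of_lt (by simpa using hs) one_pos]
    have hs1 : s - 1 ≠ 0 := by
      intro h
      rw [sub_eq_zero.1 h] at hs
      simp at hs
    have hs2 : -s + 1 ≠ 0 := by
      intro h; apply hs1; linear_combination -h
    simp only [Complex.ofReal_one, Complex.one_cpow]
    field_simp
    ring
  · have := (LSeriesSummable_one_iff (s := s)).2 hs
    exact this
  · refine IsBigO.of_bound 1 (Eventually.of_forall fun n => ?_)
    simp

-- Multiplying by s - 1 removes the pole; both sides become holomorphic in the connected half plane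
-- Re s > 0 and agree near s = 2.
open Set in
theorem riemannZeta_eq_fractIntegral {s : ℂ} (hs : 0 < s.re) (hs1 : s ≠ 1) :
    riemannZeta s = s / (s - 1) - s * fractIntegral s := by
  have hU : IsOpen {s : ℂ | 0 < s.re} := isOpen_lt continuous_const Complex.continuous_re
  have hconv : Convex ℝ {s : ℂ | 0 < s.re} := convex_halfSpace_re_gt 0
  have h1 : AnalyticOnNhd ℂ riemannZeta₁ {s : ℂ | 0 < s.re} := fun z _ =>
    differentiable_riemannZeta₁.analyticAt z
  have h2 : AnalyticOnNhd ℂ (fun s => s - s * (s - 1) * fractIntegral s) {s : ℂ | 0 < s.re} := by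
    refine DifferentiableOn.analyticOnNhd (fun z hz => ?_) hU
    have := differentiableAt_fractIntegral hz
    exact DifferentiableAt.differentiableWithinAt (by fun_prop)
  have h3 := h1.eqOn_of_preconnected_of_eventuallyEq h2 hconv.isPreconnected
    (z₀ := 2) (by simp) ?_
  · have h4 := h3 hs
    have h5 : s - 1 ≠ 0 := sub_ne_zero.2 hs1
    rw [riemannZeta_eq_inv_sub_mul hs1, h4]
    field_simp
  · have : ∀ᶠ z : ℂ in 𝓝 2, 1 < z.re :=
      (isOpen_lt continuous_const Complex.continuous_re).mem_nhds (by simp)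
    filter_upwards [this] with z hz
    have hz1 : z ≠ 1 := by rintro rfl; simp at hz
    have h5 : z - 1 ≠ 0 := sub_ne_zero.2 hz1
    have h6 := riemannZeta_eq_fractIntegral_of_one_lt hz
    rw [riemannZeta_eq_inv_sub_mul hz1] at h6
    field_simp at h6
    linear_combination h6

/-- The constant is 1 + 4: |s - 1| ≥ 1 for the polar term, and 1/Re s ≤ 4 for the integral. -/
theorem norm_riemannZeta_le {s : ℂ} (hs : 1 / 4 ≤ s.re) (ht : 1 ≤ s.im) :
    ‖riemannZeta s‖ ≤ 5 * ‖s‖ := by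
  have hs0 : 0 < s.re := by linarith
  have hs1 : s ≠ 1 := by rintro rfl; norm_num at ht
  rw [riemannZeta_eq_fractIntegral hs0 hs1]
  have h1 : 1 ≤ ‖s - 1‖ := by
    refine ht.trans ((le_abs_self _).trans ?_)
    simpa using Complex.abs_im_le_norm (s - 1)
  have h2 : ‖s / (s - 1)‖ ≤ ‖s‖ := by
    rw [norm_div]; exact div_le_self (norm_nonneg _) h1
  have h3 : ‖fractIntegral s‖ ≤ 4 := by
    refine (norm_fractIntegral_le hs0).trans ?_
    rw [div_le_iff₀ hs0]; linarith
  calc _ ≤ ‖s / (s - 1)‖ + ‖s * fractIntegral s‖ := norm_sub_le _ _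
    _ ≤ ‖s‖ + ‖s‖ * 4 := by rw [norm_mul]; gcongr
    _ = _ := by ring

/-- Comparison of the Dirichlet series with ζ(2) gives 2^(2-σ), and log 2 > 1/2 turns this into 4
e^(-σ/2). The rate e^(-σ/2) reproduces itself, up to a factor 2, under tail integration, so one
shape of bound serves every iterate. -/
theorem norm_riemannZeta_sub_one_le {s : ℂ} (hs : 3 ≤ s.re) :
    ‖riemannZeta s - 1‖ ≤ 4 * Real.exp (-s.re / 2) ∧ ‖riemannZeta s - 1‖ ≤ 1 / 2 := by
  have hs1 : 1 < s.re := by linarith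
  have hsumm : Summable fun n : ℕ => 1 / (n + 1 : ℂ) ^ s := by
    have := (Complex.summable_one_div_nat_cpow (p := s)).2 hs1
    have h := (summable_nat_add_iff 1).2 this
    simpa using h
  have hz : riemannZeta s - 1 = ∑' n : ℕ, 1 / ((n + 1 : ℕ) + 1 : ℂ) ^ s := by
    rw [zeta_eq_tsum_one_div_nat_add_one_cpow hs1, hsumm.tsum_eq_zero_add]
    simp
  have h2 : HasSum (fun n : ℕ => 1 / ((n : ℝ) + 2) ^ 2) (Real.pi ^ 2 / 6 - 1) := by
    have h := (hasSum_nat_add_iff' 2).2 hasSum_zeta_two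
    simpa [Finset.sum_range_succ] using h
  have hterm : ∀ n : ℕ, ‖1 / ((n + 1 : ℕ) + 1 : ℂ) ^ s‖ ≤
      1 / ((n : ℝ) + 2) ^ 2 * (2 : ℝ) ^ (-(s.re - 2)) := by
    intro n
    have h3 : (((n + 1 : ℕ) : ℂ) + 1) = (((n : ℝ) + 2 : ℝ) : ℂ) := by push_cast; ring
    have hpos : (0 : ℝ) < (n : ℝ) + 2 := by positivity
    rw [h3, norm_div, norm_one, Complex.norm_cpow_eq_rpow_re_of_pos hpos]
    rw [show s.re = 2 + (s.re - 2) by ring, Real.rpow_add hpos]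
    rw [show 2 + (s.re - 2) - 2 = s.re - 2 by ring, Real.rpow_two, Real.rpow_neg (by norm_num),
      one_div, one_div, mul_inv]
    gcongr
    · linarith
    · linarith [(Nat.cast_nonneg n : (0 : ℝ) ≤ n)]
  have hb : ‖riemannZeta s - 1‖ ≤ (Real.pi ^ 2 / 6 - 1) * (2 : ℝ) ^ (-(s.re - 2)) := by
    rw [hz]
    exact tsum_of_norm_bounded (h2.mul_right _) hterm
  have hpi : Real.pi ^ 2 / 6 - 1 ≤ 1 := by nlinarith [Real.pi_lt_d2, Real.pi_pos]
  have hpow : 0 < (2 : ℝ) ^ (-(s.re - 2)) := by positivity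
  have hb' : ‖riemannZeta s - 1‖ ≤ (2 : ℝ) ^ (-(s.re - 2)) :=
    hb.trans (mul_le_of_le_one_left hpow.le hpi)
  constructor
  · refine hb'.trans ?_
    rw [show -(s.re - 2) = 2 + -s.re by ring, Real.rpow_add (by norm_num)]
    norm_num
    rw [Real.rpow_def_of_pos (by norm_num)]
    apply Real.exp_le_exp.2
    nlinarith [Real.log_two_gt_d9]
  · refine hb'.trans ?_
    calc (2 : ℝ) ^ (-(s.re - 2)) ≤ 2 ^ (-1 : ℝ) :=
        Real.rpow_le_rpow_of_exponent_le (by norm_num) (by linarith)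
      _ = 1 / 2 := by rw [Real.rpow_neg_one]; norm_num

theorem norm_log_riemannZeta_le {s : ℂ} (hs : 3 ≤ s.re) :
    ‖Complex.log (riemannZeta s)‖ ≤ 6 * Real.exp (-s.re / 2) := by
  obtain ⟨h1, h2⟩ := norm_riemannZeta_sub_one_le hs
  have h3 := Complex.norm_log_one_add_half_le_self h2
  rw [add_sub_cancel] at h3
  linarith

theorem riemannZeta_mem_slitPlane {s : ℂ} (hs : 3 ≤ s.re) :
    riemannZeta s ∈ Complex.slitPlane := by
  refine Complex.mem_slitPlane_of_norm_lt_one (z := riemannZeta s - 1) ?_ |> fun h => by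
    simpa using h
  exact (norm_riemannZeta_sub_one_le hs).2.trans_lt (by norm_num)

theorem abs_log_norm_riemannZeta_le {s : ℂ} (hs : 3 ≤ s.re) :
    |Real.log ‖riemannZeta s‖| ≤ 6 * Real.exp (-s.re / 2) := by
  rw [← Complex.log_re]
  exact (Complex.abs_re_le_norm _).trans (norm_log_riemannZeta_le hs)

/-- Away from the real axis `ζ` has no zeros outside the open critical strip. -/
theorem riemannZeta_ne_zero_of_im_ne_zero {s : ℂ} (him : s.im ≠ 0)
    (hs : s.re ≤ 0 ∨ 1 ≤ s.re) : riemannZeta s ≠ 0 := by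
  rcases hs with hs | hs
  · have hre : 1 ≤ (1 - s).re := by simp; linarith
    have him' : (1 - s).im ≠ 0 := by simpa using him
    have h1 := riemannZeta_one_sub (s := 1 - s) ?_ ?_
    · rw [sub_sub_cancel] at h1
      rw [h1]
      refine mul_ne_zero (mul_ne_zero (mul_ne_zero (mul_ne_zero two_ne_zero ?_) ?_) ?_) ?_
      · rw [Complex.cpow_ne_zero_iff]
        left
        exact_mod_cast (by positivity : (2 * Real.pi) ≠ 0)
      · exact Complex.Gamma_ne_zero_of_re_pos (by linarith)
      · rw [Complex.cos_ne_zero_iff]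
        intro k hk
        have h2 : 1 - s = 2 * k + 1 := by
          have hpi : (Real.pi : ℂ) ≠ 0 := by exact_mod_cast Real.pi_ne_zero
          field_simp at hk
          exact hk
        rw [h2] at him'
        simp at him'
      · exact riemannZeta_ne_zero_of_one_le_re hre
    · intro n h
      rw [h] at him'
      simp at him'
    · intro h
      rw [h] at him'
      simp at him'
  · exact riemannZeta_ne_zero_of_one_le_re hs

/-! ### Tail integrals of subharmonic functions -/

/-- The quarter plane to the right of the critical line in which all estimates take place. -/
def rightQuadrant : Set ℂ := {s | 1 / 2 ≤ s.re ∧ 4 ≤ s.im}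

theorem mem_rightQuadrant {s : ℂ} : s ∈ rightQuadrant ↔ 1 / 2 ≤ s.re ∧ 4 ≤ s.im := Iff.rfl

theorem add_mem_rightQuadrant {s : ℂ} (hs : s ∈ rightQuadrant) {x : ℝ} (hx : 0 ≤ x) :
    s + x ∈ rightQuadrant := by
  rw [mem_rightQuadrant] at hs ⊢
  simp
  exact ⟨by linarith, hs.2⟩

theorem one_le_log_of_four_le {t : ℝ} (ht : 4 ≤ t) : 1 ≤ Real.log t := by
  rw [Real.le_log_iff_exp_le (by linarith)]
  linarith [Real.exp_one_lt_d9]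

/-- The horizontal tail integral `∫_0^∞ u(s + x) dx`. -/
noncomputable def tailIntegral (u : ℂ → ℝ) (s : ℂ) : ℝ := ∫ x in Set.Ioi (0 : ℝ), u (s + x)

theorem integrableOn_Ioi_shift {E : Type*} [NormedAddCommGroup E] (F : ℂ → E) (σ t : ℝ) :
    IntegrableOn (fun x : ℝ => F ((σ + t * Complex.I : ℂ) + x)) (Set.Ioi 0) ↔
      IntegrableOn (fun α : ℝ => F (α + t * Complex.I)) (Set.Ioi σ) := by
  have hmp : MeasurePreserving (fun x : ℝ => x + σ) volume volume := measurePreserving_add_right _ _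
  have h := hmp.integrableOn_comp_preimage (Homeomorph.addRight σ).measurableEmbedding
    (f := fun α : ℝ => F (α + t * Complex.I)) (s := Set.Ioi σ)
  rw [← h]
  have h1 : (fun x : ℝ => x + σ) ⁻¹' Set.Ioi σ = Set.Ioi 0 := by ext x; simp
  rw [h1]
  have h2 : (fun x : ℝ => F ((σ + t * Complex.I : ℂ) + x)) =
      (fun α : ℝ => F (α + t * Complex.I)) ∘ fun x : ℝ => x + σ := by
    ext x
    simp only [Function.comp, Complex.ofReal_add]
    congr 1
    ring
  rw [h2]

theorem integral_Ioi_shift {E : Type*} [NormedAddCommGroup E] [NormedSpace ℝ E] (F : ℂ → E)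
    (σ t : ℝ) :
    ∫ x in Set.Ioi (0 : ℝ), F ((σ + t * Complex.I : ℂ) + x) =
      ∫ α in Set.Ioi σ, F (α + t * Complex.I) := by
  have hmp : MeasurePreserving (fun x : ℝ => x + σ) volume volume := measurePreserving_add_right _ _
  have h := hmp.setIntegral_preimage_emb (Homeomorph.addRight σ).measurableEmbedding
    (fun α : ℝ => F (α + t * Complex.I)) (Set.Ioi σ)
  rw [← h]
  have h1 : (fun x : ℝ => x + σ) ⁻¹' Set.Ioi σ = Set.Ioi 0 := by ext x; simp
  rw [h1]
  refine integral_congr_ae (Eventually.of_forall fun x => ?_)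
  simp only [Complex.ofReal_add]
  congr 1
  ring

theorem integrableOn_exp_neg_half (σ : ℝ) :
    IntegrableOn (fun x : ℝ => Real.exp (-x / 2)) (Set.Ioi σ) := by
  have := integrableOn_exp_mul_Ioi (a := -(1 / 2)) (by norm_num) σ
  refine this.congr_fun (fun x _ => ?_) measurableSet_Ioi
  simp only
  congr 1
  ring

theorem integral_exp_neg_half (σ : ℝ) :
    ∫ x in Set.Ioi σ, Real.exp (-x / 2) = 2 * Real.exp (-σ / 2) := by
  have := integral_exp_mul_Ioi (a := -(1 / 2)) (by norm_num) σ
  have h2 : ∫ x in Set.Ioi σ, Real.exp (-x / 2) = ∫ x in Set.Ioi σ, Real.exp (-(1 / 2) * x) := by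
    congr 1
    ext x
    congr 1
    ring
  rw [h2, this, show -(1 / 2) * σ = -σ / 2 by ring]
  ring

/-- Functions on the quadrant which are subharmonic off an exceptional set `Z`, decay to the right
and grow at most logarithmically along horizontal lines in mean. -/
structure TailAdmissible (u : ℂ → ℝ) (Z : Set ℂ) : Prop where
  measurable : Measurable u
  line : ∃ C : ℝ, 0 ≤ C ∧ ∀ s ∈ rightQuadrant,
    IntegrableOn (fun x : ℝ => u (s + x)) (Set.Ioi 0) ∧
      ∫ x in Set.Ioi (0 : ℝ), |u (s + x)| ≤ C * Real.log s.im * Real.exp (-s.re / 2)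
  upper : ∃ C : ℝ, 0 ≤ C ∧ ∀ s ∈ rightQuadrant, u s ≤ C * Real.log s.im * Real.exp (-s.re / 2)
  right : ∃ C : ℝ, 0 ≤ C ∧ ∀ s ∈ rightQuadrant, 3 ≤ s.re → |u s| ≤ C * Real.exp (-s.re / 2)
  countable : ∀ s : ℂ, {x : ℝ | s + x ∈ Z}.Countable
  submean : ∀ (p : ℂ) (r : ℝ), 0 < r → Metric.closedBall p r ⊆ rightQuadrant →
    CircleIntegrable u p r ∧ (p ∉ Z → u p ≤ Real.circleAverage u p r)
  usc : ∀ s ∈ rightQuadrant, s ∉ Z → UpperSemicontinuousWithinAt u rightQuadrant s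

namespace TailAdmissible

variable {u : ℂ → ℝ} {Z : Set ℂ}

theorem measurable_tailIntegral (hu : TailAdmissible u Z) : Measurable (tailIntegral u) := by
  have h : StronglyMeasurable (fun q : ℂ × ℝ => u (q.1 + q.2)) := by
    refine (hu.measurable.comp ?_).stronglyMeasurable
    exact measurable_fst.add (Complex.measurable_ofReal.comp measurable_snd)
  exact (h.integral_prod_right (ν := volume.restrict (Set.Ioi (0 : ℝ)))).measurable

theorem abs_tailIntegral_le (hu : TailAdmissible u Z) :
    ∃ C : ℝ, 0 ≤ C ∧ ∀ s ∈ rightQuadrant,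
      |tailIntegral u s| ≤ C * Real.log s.im * Real.exp (-s.re / 2) := by
  obtain ⟨C, hC, h⟩ := hu.line
  exact ⟨C, hC, fun s hs => (abs_integral_le_integral_abs).trans (h s hs).2⟩

theorem line_tail (hu : TailAdmissible u Z) : ∃ C : ℝ, 0 ≤ C ∧ ∀ s ∈ rightQuadrant,
    IntegrableOn (fun x : ℝ => tailIntegral u (s + x)) (Set.Ioi 0) ∧
      ∫ x in Set.Ioi (0 : ℝ), |tailIntegral u (s + x)| ≤
        C * Real.log s.im * Real.exp (-s.re / 2) := by
  obtain ⟨C, hC, h⟩ := hu.abs_tailIntegral_le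
  refine ⟨2 * C, by positivity, fun s hs => ?_⟩
  set B : ℝ → ℝ := fun x => C * Real.log s.im * Real.exp (-s.re / 2) * Real.exp (-x / 2) with hB
  have hBint : IntegrableOn B (Set.Ioi 0) := (integrableOn_exp_neg_half 0).const_mul _
  have hle : ∀ x ∈ Set.Ioi (0 : ℝ), |tailIntegral u (s + x)| ≤ B x := by
    intro x hx
    have h1 := h (s + x) (add_mem_rightQuadrant hs (le_of_lt hx))
    refine h1.trans (le_of_eq ?_)
    simp only [Complex.add_im, Complex.ofReal_im, add_zero, Complex.add_re, Complex.ofReal_re, hB]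
    rw [mul_assoc (C * Real.log s.im), ← Real.exp_add]
    congr 2
    ring
  have hm : AEStronglyMeasurable (fun x : ℝ => tailIntegral u (s + x))
      (volume.restrict (Set.Ioi 0)) := by
    refine (hu.measurable_tailIntegral.comp ?_).aestronglyMeasurable
    exact measurable_const.add Complex.measurable_ofReal
  have hint : IntegrableOn (fun x : ℝ => tailIntegral u (s + x)) (Set.Ioi 0) :=
    Integrable.mono' hBint hm ((ae_restrict_mem measurableSet_Ioi).mono hle)
  refine ⟨hint, ?_⟩
  calc _ ≤ ∫ x in Set.Ioi (0 : ℝ), B x :=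
        setIntegral_mono_on hint.abs hBint measurableSet_Ioi hle
    _ = _ := by
        rw [hB, integral_const_mul, integral_exp_neg_half]
        simp
        ring

theorem right_tail (hu : TailAdmissible u Z) :
    ∃ C : ℝ, 0 ≤ C ∧ ∀ s ∈ rightQuadrant, 3 ≤ s.re →
      |tailIntegral u s| ≤ C * Real.exp (-s.re / 2) := by
  obtain ⟨C, hC, h⟩ := hu.right
  refine ⟨2 * C, by positivity, fun s hs hs3 => ?_⟩
  set B : ℝ → ℝ := fun x => C * Real.exp (-s.re / 2) * Real.exp (-x / 2) with hB
  have hBint : IntegrableOn B (Set.Ioi 0) := (integrableOn_exp_neg_half 0).const_mul _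
  have hle : ∀ x ∈ Set.Ioi (0 : ℝ), ‖u (s + x)‖ ≤ B x := by
    intro x hx
    have hx' : 0 < x := hx
    have h1 := h (s + x) (add_mem_rightQuadrant hs (le_of_lt hx)) (by simp; linarith)
    refine h1.trans (le_of_eq ?_)
    simp only [Complex.add_re, Complex.ofReal_re, hB]
    rw [mul_assoc, ← Real.exp_add]
    congr 2
    ring
  calc |tailIntegral u s| ≤ ∫ x in Set.Ioi (0 : ℝ), B x :=
        norm_integral_le_of_norm_le hBint ((ae_restrict_mem measurableSet_Ioi).mono hle)
    _ = _ := by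
        rw [hB, integral_const_mul, integral_exp_neg_half]
        simp
        ring

theorem ae_notMem (hu : TailAdmissible u Z) (s : ℂ) :
    ∀ᵐ x : ℝ ∂(volume.restrict (Set.Ioi 0)), s + x ∉ Z :=
  ae_restrict_of_ae (measure_eq_zero_iff_ae_notMem.1 ((hu.countable s).measure_zero volume))

-- Fubini exchanges the circle and the tail. The inequality for `u` is needed at p + x only for
-- almost every x, and each horizontal line meets `Z` in a countable set; hence no exceptional point
-- remains for the tail.
open Metric in
theorem submean_tail (hu : TailAdmissible u Z) {p : ℂ} {r : ℝ} (hr : 0 < r)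
    (hp : closedBall p r ⊆ rightQuadrant) :
    CircleIntegrable (tailIntegral u) p r ∧
      tailIntegral u p ≤ Real.circleAverage (tailIntegral u) p r := by
  obtain ⟨C, hC, hline⟩ := hu.line
  have hcirc : ∀ θ, circleMap p r θ ∈ rightQuadrant := fun θ =>
    hp (circleMap_mem_closedBall p hr.le θ)
  obtain ⟨D, hD⟩ : ∃ D, ∀ θ, C * Real.log (circleMap p r θ).im *
      Real.exp (-(circleMap p r θ).re / 2) ≤ D := by
    refine ⟨C * (p.im + r), fun θ => ?_⟩
    have h1 := hcirc θ
    rw [mem_rightQuadrant] at h1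
    have h2 : Real.exp (-(circleMap p r θ).re / 2) ≤ 1 := Real.exp_le_one_iff.2 (by linarith)
    have h3 : Real.log (circleMap p r θ).im ≤ p.im + r := by
      refine (Real.log_le_self (by linarith)).trans ?_
      have h4 := mem_closedBall.1 (circleMap_mem_closedBall p hr.le θ)
      rw [dist_eq_norm] at h4
      have h5 := (Complex.abs_im_le_norm (circleMap p r θ - p)).trans h4
      rw [Complex.sub_im] at h5
      linarith [(abs_le.1 h5).2]
    have h4 := one_le_log_of_four_le h1.2
    calc _ ≤ C * Real.log (circleMap p r θ).im * 1 := by gcongr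
      _ ≤ _ := by rw [mul_one]; gcongr
  have hmeas : Measurable (fun q : ℝ × ℝ => u (circleMap p r q.1 + q.2)) := by
    refine hu.measurable.comp ?_
    exact ((continuous_circleMap p r).measurable.comp measurable_fst).add
      (Complex.measurable_ofReal.comp measurable_snd)
  set μ := (volume : Measure ℝ).restrict (Set.Ioc 0 (2 * Real.pi)) with hμ
  set ν := (volume : Measure ℝ).restrict (Set.Ioi 0) with hν
  have hint : Integrable (fun q : ℝ × ℝ => u (circleMap p r q.1 + q.2)) (μ.prod ν) := by
    rw [integrable_prod_iff hmeas.aestronglyMeasurable]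
    refine ⟨Eventually.of_forall fun θ => (hline _ (hcirc θ)).1, ?_⟩
    refine Integrable.mono' (integrable_const D)
      (hmeas.stronglyMeasurable.norm.integral_prod_right').aestronglyMeasurable ?_
    refine Eventually.of_forall fun θ => ?_
    rw [Real.norm_of_nonneg (integral_nonneg fun _ => norm_nonneg _)]
    exact ((hline _ (hcirc θ)).2).trans (hD θ)
  constructor
  · have h1 : Integrable (fun θ => tailIntegral u (circleMap p r θ)) μ := hint.integral_prod_left
    rw [CircleIntegrable, intervalIntegrable_iff_integrableOn_Ioc_of_le (by positivity)]
    exact h1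
  · have hshift : ∀ x : ℝ, 0 ≤ x → closedBall (p + x) r ⊆ rightQuadrant := by
      intro x hx w hw
      have h1 : w - x ∈ closedBall p r := by
        rw [mem_closedBall, dist_eq_norm] at hw ⊢
        rwa [show w - x - p = w - (p + x) by ring]
      have := add_mem_rightQuadrant (hp h1) hx
      simpa using this
    have hcm : ∀ x θ : ℝ, circleMap (p + x) r θ = circleMap p r θ + x := by
      intro x θ
      simp only [circleMap]
      ring
    have h1 : ∀ᵐ x : ℝ ∂ν, u (p + x) ≤ (2 * Real.pi)⁻¹ * ∫ θ, u (circleMap p r θ + x) ∂μ := by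
      filter_upwards [hu.ae_notMem p, ae_restrict_mem measurableSet_Ioi] with x hx hx0
      have h2 := (hu.submean (p + x) r hr (hshift x (le_of_lt hx0))).2 hx
      refine h2.trans (le_of_eq ?_)
      rw [Real.circleAverage_def, intervalIntegral.integral_of_le (by positivity), smul_eq_mul]
      simp_rw [hcm]
      rfl
    have hpq : p ∈ rightQuadrant := hp (mem_closedBall_self hr.le)
    calc tailIntegral u p ≤ ∫ x, (2 * Real.pi)⁻¹ * ∫ θ, u (circleMap p r θ + x) ∂μ ∂ν :=
          integral_mono_ae (hline p hpq).1 (hint.integral_prod_right.const_mul _) h1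
      _ = (2 * Real.pi)⁻¹ * ∫ θ, ∫ x, u (circleMap p r θ + x) ∂ν ∂μ := by
          rw [integral_const_mul, ← integral_integral_swap (f := fun (θ x : ℝ) => u (circleMap p r θ + x)) hint]
      _ = _ := by
          rw [Real.circleAverage_def, intervalIntegral.integral_of_le (by positivity), smul_eq_mul]
          rfl

/-- Fatou's lemma applied to g - u ≥ 0, where g is the integrable majorant supplied by `upper`,
uniform for heights up to Im s + 1. -/
theorem usc_tail (hu : TailAdmissible u Z) {s : ℂ} (hs : s ∈ rightQuadrant) :
    UpperSemicontinuousWithinAt (tailIntegral u) rightQuadrant s := by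
  obtain ⟨C, hC, hup⟩ := hu.upper
  obtain ⟨C', hC', hline⟩ := hu.line
  intro y hy
  by_contra hcon
  rw [not_eventually] at hcon
  -- restrict to nearby points of bounded height where the integral stays above `y`
  set S : Set ℂ := {w | w ∈ rightQuadrant ∧ w.im ≤ s.im + 1 ∧ y ≤ tailIntegral u w} with hS
  have hfreq : ∃ᶠ w in 𝓝 s, w ∈ S := by
    have h1 : ∀ᶠ w in 𝓝 s, w.im ≤ s.im + 1 :=
      (Complex.continuous_im.continuousAt.eventually (gt_mem_nhds (by linarith : s.im < s.im + 1))).mono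
        fun w hw => le_of_lt hw
    rw [frequently_nhdsWithin_iff] at hcon
    exact (hcon.and_eventually h1).mono fun w hw => ⟨hw.1.2, hw.2, not_lt.1 hw.1.1⟩
  have hne : (𝓝[S] s).NeBot := by
    rw [← mem_closure_iff_nhdsWithin_neBot, mem_closure_iff_frequently]
    exact hfreq
  set L := Real.log (s.im + 1) with hL
  set g : ℝ → ℝ := fun x => C * L * Real.exp (-x / 2) with hg
  have hgint : IntegrableOn g (Set.Ioi 0) := (integrableOn_exp_neg_half 0).const_mul _
  have hgm : Measurable g := by
    apply Continuous.measurable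
    rw [hg]
    fun_prop
  have hug : ∀ w : ℂ, w ∈ rightQuadrant → w.im ≤ s.im + 1 → ∀ x ∈ Set.Ioi (0 : ℝ),
      0 ≤ g x - u (w + x) := by
    intro w hw hwi x hx
    have h1 := hup _ (add_mem_rightQuadrant hw (le_of_lt hx))
    have hx' : 0 < x := hx
    simp only [Complex.add_im, Complex.ofReal_im, add_zero, Complex.add_re, Complex.ofReal_re] at h1
    have h2 := one_le_log_of_four_le hw.2
    have h3 : Real.log w.im ≤ L := Real.log_le_log (by linarith [hw.2]) hwi
    have h4 : Real.exp (-(w.re + x) / 2) ≤ Real.exp (-x / 2) :=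
      Real.exp_le_exp.2 (by linarith [hw.1])
    have h5 : C * Real.log w.im * Real.exp (-(w.re + x) / 2) ≤ g x := by
      rw [hg]
      dsimp only
      have h6 : 0 ≤ L := by linarith
      gcongr
    linarith
  set F : ℂ → ℝ → ENNReal := fun w x => ENNReal.ofReal (g x - u (w + x)) with hF
  have hFm : ∀ w, Measurable (F w) := by
    intro w
    refine (hgm.sub (hu.measurable.comp ?_)).ennreal_ofReal
    exact measurable_const.add Complex.measurable_ofReal
  have hfatou := lintegral_liminf_le (μ := volume.restrict (Set.Ioi (0 : ℝ))) (u := 𝓝[S] s) hFm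
  have hval : ∀ w : ℂ, w ∈ rightQuadrant → w.im ≤ s.im + 1 →
      ∫⁻ x in Set.Ioi (0 : ℝ), F w x =
        ENNReal.ofReal ((∫ x in Set.Ioi (0 : ℝ), g x) - tailIntegral u w) := by
    intro w hw hwi
    rw [tailIntegral, ← integral_sub hgint (hline w hw).1,
      ofReal_integral_eq_lintegral_ofReal (f := fun x => g x - u (w + x))
        (hgint.sub (hline w hw).1)]
    · filter_upwards [ae_restrict_mem measurableSet_Ioi] with x hx
      exact hug w hw hwi x hx
  have hright : liminf (fun w => ∫⁻ x in Set.Ioi (0 : ℝ), F w x) (𝓝[S] s) ≤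
      ENNReal.ofReal ((∫ x in Set.Ioi (0 : ℝ), g x) - y) := by
    refine liminf_le_of_frequently_le' (Eventually.frequently ?_)
    filter_upwards [self_mem_nhdsWithin] with w hw
    rw [hval w hw.1 hw.2.1]
    exact ENNReal.ofReal_le_ofReal (by linarith [hw.2.2])
  have hleft : ∫⁻ x in Set.Ioi (0 : ℝ), F s x ≤
      ∫⁻ x in Set.Ioi (0 : ℝ), liminf (fun w => F w x) (𝓝[S] s) := by
    refine lintegral_mono_ae ?_
    filter_upwards [hu.ae_notMem s, ae_restrict_mem measurableSet_Ioi] with x hx hx0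
    refine le_of_forall_lt fun c hc => ?_
    obtain ⟨c', hc1, hc2⟩ := exists_between hc
    refine hc1.trans_le (le_liminf_of_le (by isBoundedDefault) ?_)
    have husc := hu.usc (s + x) (add_mem_rightQuadrant hs (le_of_lt hx0)) hx
    have hc'top : c' ≠ ⊤ := ne_top_of_lt hc2
    have hc3 : c'.toReal < g x - u (s + x) := (ENNReal.lt_ofReal_iff_toReal_lt hc'top).1 hc2
    have h1 := husc (g x - c'.toReal) (by linarith)
    have hmap : Tendsto (fun w : ℂ => w + x) (𝓝[S] s) (𝓝[rightQuadrant] (s + x)) := by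
      refine tendsto_nhdsWithin_iff.2 ⟨?_, ?_⟩
      · exact (Continuous.tendsto (by fun_prop) s).mono_left nhdsWithin_le_nhds
      · filter_upwards [self_mem_nhdsWithin] with w hw
        exact add_mem_rightQuadrant hw.1 (le_of_lt hx0)
    filter_upwards [hmap.eventually h1] with w hw
    rw [← ENNReal.ofReal_toReal hc'top]
    exact ENNReal.ofReal_le_ofReal (by linarith)
  have hfin := (hleft.trans hfatou).trans hright
  rw [hval s hs (by linarith)] at hfin
  have hpos : 0 ≤ (∫ x in Set.Ioi (0 : ℝ), g x) - y := by
    obtain ⟨w, hw⟩ := hfreq.exists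
    have : 0 ≤ ∫ x in Set.Ioi (0 : ℝ), (g x - u (w + x)) :=
      setIntegral_nonneg measurableSet_Ioi fun x hx => hug w hw.1 hw.2.1 x hx
    rw [integral_sub hgint (hline w hw.1).1] at this
    have h2 : y ≤ tailIntegral u w := hw.2.2
    rw [tailIntegral] at h2
    linarith
  rw [ENNReal.ofReal_le_ofReal_iff hpos] at hfin
  linarith

/-- One integration removes the exceptional set for good. For log|ζ| that set consists of the zeros,
where the default `Real.log 0 = 0` spoils the sub-mean-value inequality. -/
theorem tail (hu : TailAdmissible u Z) : TailAdmissible (tailIntegral u) ∅ where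
  measurable := hu.measurable_tailIntegral
  line := hu.line_tail
  upper := by
    obtain ⟨C, hC, h⟩ := hu.abs_tailIntegral_le
    exact ⟨C, hC, fun s hs => (le_abs_self _).trans (h s hs)⟩
  right := hu.right_tail
  countable := fun s => by simp
  submean := fun p r hr hp => ⟨(hu.submean_tail hr hp).1, fun _ => (hu.submean_tail hr hp).2⟩
  usc := fun s hs _ => hu.usc_tail hs

end TailAdmissible

/-! ### Weighted averages over discs -/

open Metric in
theorem bounds_of_closedBall_subset_rightQuadrant {p : ℂ} {r : ℝ} (hr : 0 < r)
    (h : closedBall p r ⊆ rightQuadrant) : 1 / 2 ≤ p.re - r ∧ 4 ≤ p.im - r := by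
  constructor
  · have h1 : p - (r : ℂ) ∈ closedBall p r := by
      simp [abs_of_pos hr]
    simpa using (h h1).1
  · have h1 : p - (r : ℂ) * Complex.I ∈ closedBall p r := by
      simp [abs_of_pos hr]
    simpa using (h h1).2

open Metric in
theorem setIntegral_ball_eq_iterated {F : ℂ → ℝ} {r : ℝ} (hF : IntegrableOn F (ball 0 r)) :
    ∫ w in ball (0 : ℂ) r, F w =
      ∫ y : ℝ, ∫ x : ℝ, (ball (0 : ℂ) r).indicator F (x + y * Complex.I) := by
  have hmp := Complex.volume_preserving_equiv_real_prod.symm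
  rw [← integral_indicator measurableSet_ball, ← hmp.integral_comp']
  have hint : Integrable (fun q : ℝ × ℝ =>
      (ball (0 : ℂ) r).indicator F (Complex.measurableEquivRealProd.symm q)) :=
    (hmp.integrable_comp_emb Complex.measurableEquivRealProd.symm.measurableEmbedding).2
      ((integrable_indicator_iff measurableSet_ball).2 hF)
  rw [Measure.volume_eq_prod] at hint ⊢
  rw [integral_prod_symm _ hint]
  congr! 5 with y x
  rw [Complex.measurableEquivRealProd_symm_apply, Complex.mk_eq_add_mul_I]

theorem mem_ball_zero_iff_re_im {x y r : ℝ} (hr : 0 < r) :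
    (x + y * Complex.I : ℂ) ∈ Metric.ball (0 : ℂ) r ↔ x ^ 2 + y ^ 2 < r ^ 2 := by
  rw [mem_ball_zero_iff, ← abs_of_pos hr, ← abs_norm, ← sq_lt_sq, ← Complex.normSq_eq_norm_sq,
    Complex.normSq_add_mul_I, abs_of_pos hr]

/-- Integration by parts against a quadratic weight for a tail integral. -/
theorem integral_sq_sub_sq_mul_eq {g : ℝ → ℝ} {A b : ℝ} (hb : 0 ≤ b) (hA : A ≤ -b)
    (hg : IntegrableOn g (Set.Ioi A)) :
    ∫ x in (-b)..b, (b ^ 2 - x ^ 2) * g x =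
      ∫ x in (-b)..b, (-2 * x) * ∫ α in Set.Ioi x, g α := by
  have hle : -b ≤ b := by linarith
  have hgb : IntegrableOn g (Set.Ioi (-b)) := hg.mono_set (Set.Ioi_subset_Ioi hA)
  have hgi : IntervalIntegrable g volume (-b) b := by
    rw [intervalIntegrable_iff_integrableOn_Ioc_of_le hle]
    exact hgb.mono_set Set.Ioc_subset_Ioi_self
  set f : ℝ → ℝ := fun x => b ^ 2 - x ^ 2 with hf
  set G : ℝ → ℝ := fun x => ∫ v in (-b)..x, g v with hG
  have hfac : AbsolutelyContinuousOnInterval f (-b) b := by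
    apply ContDiffOn.absolutelyContinuousOnInterval
    exact ContDiff.contDiffOn (by rw [hf]; fun_prop)
  -- As `g` is merely integrable, its primitive is differentiable only almost everywhere; absolute
  -- continuity is what allows integration by parts.
  have hGac : AbsolutelyContinuousOnInterval G (-b) b :=
    hgi.absolutelyContinuousOnInterval_intervalIntegral Set.left_mem_uIcc
  have h1 := hfac.integral_mul_deriv_eq_deriv_mul hGac
  have hfd : ∀ x, deriv f x = -2 * x := by
    intro x
    have := ((hasDerivAt_pow 2 x).const_sub (b ^ 2)).deriv
    rw [hf, this]
    norm_num
  have h2 : ∫ x in (-b)..b, f x * deriv G x = ∫ x in (-b)..b, f x * g x := by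
    apply intervalIntegral.integral_congr_ae
    filter_upwards [hgi.ae_hasDerivAt_integral] with x hx hx'
    rw [(hx (Set.uIoc_subset_uIcc hx') (-b) Set.left_mem_uIcc).deriv]
  rw [h2] at h1
  simp only [hfd] at h1
  have h3 : ∀ x ∈ Set.uIcc (-b) b, ∫ α in Set.Ioi x, g α = (∫ α in Set.Ioi (-b), g α) - G x := by
    intro x hx
    rw [Set.uIcc_of_le hle] at hx
    have := intervalIntegral.integral_Ioi_sub_Ioi hgb hx.1
    rw [hG]
    linarith
  have h4 : ∫ x in (-b)..b, (-2 * x) * ∫ α in Set.Ioi x, g α =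
      ∫ x in (-b)..b, ((-2 * x) * (∫ α in Set.Ioi (-b), g α) - (-2 * x) * G x) := by
    refine intervalIntegral.integral_congr fun x hx => ?_
    rw [h3 x hx]
    ring
  have hGc : ContinuousOn G (Set.uIcc (-b) b) := hGac.continuousOn
  rw [h4, intervalIntegral.integral_sub, intervalIntegral.integral_mul_const,
    intervalIntegral.integral_const_mul, integral_id]
  · rw [h1]
    simp only [hf]
    ring
  · exact Continuous.intervalIntegrable (by fun_prop) _ _
  · exact ContinuousOn.intervalIntegrable ((by fun_prop : Continuous fun x : ℝ => -2 * x).continuousOn.mul hGc)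

namespace TailAdmissible

variable {u : ℂ → ℝ} {Z : Set ℂ}

-- By Fubini: each horizontal chord of the disc is part of a tail starting on the vertical line
-- through the leftmost point, and `line` bounds those tails uniformly in the height.
open Metric in
theorem integrableOn_ball (hu : TailAdmissible u Z) {p : ℂ} {r : ℝ} (hr : 0 < r)
    (hp : closedBall p r ⊆ rightQuadrant) :
    IntegrableOn (fun w => u (p + w)) (ball 0 r) := by
  obtain ⟨hre, him⟩ := bounds_of_closedBall_subset_rightQuadrant hr hp
  obtain ⟨C, hC, hline⟩ := hu.line
  have hmp := Complex.volume_preserving_equiv_real_prod.symm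
  rw [← integrable_indicator_iff measurableSet_ball,
    ← hmp.integrable_comp_emb Complex.measurableEquivRealProd.symm.measurableEmbedding,
    Measure.volume_eq_prod]
  have hm : Measurable ((ball (0 : ℂ) r).indicator fun w => u (p + w)) :=
    (hu.measurable.comp (measurable_const_add p)).indicator measurableSet_ball
  have hm' : Measurable (((ball (0 : ℂ) r).indicator fun w => u (p + w)) ∘
      Complex.measurableEquivRealProd.symm) :=
    hm.comp Complex.measurableEquivRealProd.symm.measurable
  rw [integrable_prod_iff' hm'.aestronglyMeasurable]
  -- each horizontal section is dominated by a tail to the right of the disc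
  set B : ℝ → ℝ → ℝ := fun y => (Set.Ioi (-r)).indicator fun x => |u (p + (x + y * Complex.I))| with hB
  have hle : ∀ x y : ℝ, |((ball (0 : ℂ) r).indicator (fun w => u (p + w)))
      (Complex.measurableEquivRealProd.symm (x, y))| ≤ B y x := by
    intro x y
    rw [Complex.measurableEquivRealProd_symm_apply, Complex.mk_eq_add_mul_I]
    by_cases h : (x + y * Complex.I : ℂ) ∈ ball (0 : ℂ) r
    · have hx : x ∈ Set.Ioi (-r) := by
        have h1 := (Complex.abs_re_le_norm _).trans_lt (mem_ball_zero_iff.1 h)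
        simp at h1
        exact (abs_lt.1 h1).1
      simp only [hB, Set.indicator_of_mem h, Set.indicator_of_mem hx]
      exact le_rfl
    · rw [Set.indicator_of_notMem h, abs_zero]
      exact Set.indicator_nonneg (fun _ _ => abs_nonneg _) _
  have hzero : ∀ x y : ℝ, r ≤ |y| → ((ball (0 : ℂ) r).indicator (fun w => u (p + w)))
      (Complex.measurableEquivRealProd.symm (x, y)) = 0 := by
    intro x y hy
    rw [Complex.measurableEquivRealProd_symm_apply, Complex.mk_eq_add_mul_I]
    refine Set.indicator_of_notMem (fun h => ?_) _
    have h1 := (Complex.abs_im_le_norm _).trans_lt (mem_ball_zero_iff.1 h)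
    simp at h1
    linarith
  have hsec : ∀ y : ℝ, |y| < r → Integrable (B y) ∧
      ∫ x, B y x ≤ C * Real.log (p.im + r) := by
    intro y hy
    obtain ⟨hy1, hy2⟩ := abs_lt.1 hy
    set s : ℂ := ((p.re - r : ℝ) : ℂ) + ((p.im + y : ℝ) : ℂ) * Complex.I with hs
    have hsre : s.re = p.re - r := by simp [hs]
    have hsim : s.im = p.im + y := by simp [hs]
    have hsq : s ∈ rightQuadrant := by
      rw [mem_rightQuadrant, hsre, hsim]
      exact ⟨hre, by linarith⟩
    obtain ⟨h1, h2⟩ := hline s hsq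
    have heq : ∀ x : ℝ, p + (x + y * Complex.I) = ((-r : ℝ) : ℂ) * 0 + (p + y * Complex.I + x) := by
      intro x; ring
    have hs' : s = ((-r : ℝ) + (0 : ℝ) * Complex.I) + (p + y * Complex.I) := by
      apply Complex.ext
      · rw [hsre]; simp; ring
      · rw [hsim]; simp
    set F : ℂ → ℝ := fun z => |u (p + y * Complex.I + z)| with hF
    have h3 : (fun x : ℝ => |u (s + x)|) =
        fun x : ℝ => F (((-r : ℝ) + (0 : ℝ) * Complex.I : ℂ) + x) := by
      ext x
      rw [hF, hs']
      dsimp only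
      congr 2
      ring
    have h4 : (fun x : ℝ => |u (p + (x + y * Complex.I))|) =
        fun x : ℝ => F (x + (0 : ℝ) * Complex.I) := by
      ext x
      rw [hF]
      dsimp only
      congr 2
      push_cast
      ring
    have h5 : IntegrableOn (fun x : ℝ => |u (s + x)|) (Set.Ioi 0) := h1.abs
    rw [h3, integrableOn_Ioi_shift, ← h4] at h5
    rw [h3, integral_Ioi_shift, ← h4] at h2
    refine ⟨(integrable_indicator_iff measurableSet_Ioi).2 h5, ?_⟩
    rw [hB]
    dsimp only
    rw [integral_indicator measurableSet_Ioi]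
    refine h2.trans ?_
    have h6 : Real.exp (-s.re / 2) ≤ 1 := Real.exp_le_one_iff.2 (by rw [hsre]; linarith)
    have h7 : Real.log s.im ≤ Real.log (p.im + r) := by
      rw [hsim]; exact Real.log_le_log (by linarith) (by linarith)
    have h8 : 1 ≤ Real.log s.im := one_le_log_of_four_le hsq.2
    calc _ ≤ C * Real.log s.im * 1 := by gcongr
      _ ≤ _ := by rw [mul_one]; gcongr
  have hint : ∀ y : ℝ, Integrable (fun x : ℝ => (((ball (0 : ℂ) r).indicator fun w => u (p + w)) ∘
      Complex.measurableEquivRealProd.symm) (x, y)) := by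
    intro y
    rcases lt_or_ge |y| r with hy | hy
    · refine Integrable.mono' (hsec y hy).1 ?_ (Eventually.of_forall fun x => hle x y)
      exact (hm'.comp (measurable_id.prodMk measurable_const)).aestronglyMeasurable
    · refine (integrable_zero ℝ ℝ volume).congr (Eventually.of_forall fun x => ?_)
      exact (hzero x y hy).symm
  refine ⟨Eventually.of_forall hint, ?_⟩
  refine Integrable.mono' (g := (Set.Ioo (-r) r).indicator fun _ => C * Real.log (p.im + r))
    ?_ ?_ ?_
  · rw [integrable_indicator_iff measurableSet_Ioo]
    exact integrableOn_const measure_Ioo_lt_top.ne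
  · exact (hm'.stronglyMeasurable.norm.integral_prod_left').aestronglyMeasurable
  · refine Eventually.of_forall fun y => ?_
    rw [Real.norm_of_nonneg (integral_nonneg fun _ => norm_nonneg _)]
    rcases lt_or_ge |y| r with hy | hy
    · rw [Set.indicator_of_mem (show y ∈ Set.Ioo (-r) r from abs_lt.1 hy)]
      exact (integral_mono (hint y).norm (hsec y hy).1 fun x => hle x y).trans (hsec y hy).2
    · have hy' : y ∉ Set.Ioo (-r) r := fun h => (not_lt.2 hy) (abs_lt.2 h)
      rw [Set.indicator_of_notMem hy']
      refine le_of_eq ?_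
      rw [integral_eq_zero_of_ae]
      refine Eventually.of_forall fun x => ?_
      simp only [Function.comp, Pi.zero_apply]
      rw [hzero x y hy, norm_zero]

open Metric in
/-- Sub-mean-value inequality over discs with a radial weight. -/
theorem mul_integral_le_integral_ball (hu : TailAdmissible u Z) {p : ℂ} {r : ℝ} (hr : 0 < r)
    (hp : closedBall p r ⊆ rightQuadrant) (hpZ : p ∉ Z) {k : ℝ → ℝ} (hk : Continuous k)
    (hk0 : ∀ ρ ∈ Set.Ico 0 r, 0 ≤ k ρ) :
    u p * ∫ w in ball (0 : ℂ) r, k ‖w‖ ≤ ∫ w in ball (0 : ℂ) r, k ‖w‖ * u (p + w) := by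
  obtain ⟨D, hD⟩ : ∃ D, ∀ w ∈ ball (0 : ℂ) r, ‖k ‖w‖‖ ≤ D := by
    obtain ⟨D, hD⟩ := (isCompact_closedBall (0 : ℂ) r).exists_bound_of_continuousOn
      (f := fun w => k ‖w‖) (by fun_prop)
    exact ⟨D, fun w hw => hD w (ball_subset_closedBall hw)⟩
  have hkm : Measurable fun w : ℂ => k ‖w‖ := (hk.comp continuous_norm).measurable
  have hint : IntegrableOn (fun w => k ‖w‖ * u (p + w)) (ball 0 r) :=
    (hu.integrableOn_ball hr hp).bdd_mul hkm.aestronglyMeasurable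
      ((ae_restrict_mem measurableSet_ball).mono hD)
  have hkint : IntegrableOn (fun w : ℂ => k ‖w‖) (ball 0 r) := by
    refine Integrable.mono' (g := fun _ => D) ?_ hkm.aestronglyMeasurable
      ((ae_restrict_mem measurableSet_ball).mono hD)
    exact integrableOn_const measure_ball_lt_top.ne
  set J := ∫ w in ball (0 : ℂ) r, k ‖w‖ * u (p + w) with hJ
  -- Rotations stand in for polar coordinates: the weighted integral over the disc is rotation
  -- invariant, so averaging it over θ and exchanging the integrals brings in the circle average of
  -- radius |w| for each w.
  set e : ℝ → ℂ → ℂ := fun θ w => Complex.exp (θ * Complex.I) * w with he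
  have hnorm : ∀ θ w, ‖e θ w‖ = ‖w‖ := by
    intro θ w
    rw [he]
    dsimp only
    rw [norm_mul, Complex.norm_exp_ofReal_mul_I, one_mul]
  have hrot : ∀ θ : ℝ, MeasurePreserving (e θ) volume volume ∧ MeasurableEmbedding (e θ) := by
    intro θ
    have h1 : e θ = (rotation (Circle.exp θ) : ℂ ≃ₗᵢ[ℝ] ℂ) := by
      ext w
      simp [he, rotation_apply]
    rw [h1]
    exact ⟨LinearIsometryEquiv.measurePreserving _,
      (rotation (Circle.exp θ)).toHomeomorph.measurableEmbedding⟩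
  have hpre : ∀ θ, e θ ⁻¹' ball (0 : ℂ) r = ball (0 : ℂ) r := by
    intro θ
    ext w
    simp only [Set.mem_preimage, mem_ball_zero_iff, hnorm]
  have hrotint : ∀ (F : ℂ → ℝ) (θ : ℝ), ∫ w in ball (0 : ℂ) r, F (e θ w) =
      ∫ w in ball (0 : ℂ) r, F w := by
    intro F θ
    have h1 := (hrot θ).1.setIntegral_preimage_emb (hrot θ).2 F (ball (0 : ℂ) r)
    rwa [hpre] at h1
  have hrotJ : ∀ θ : ℝ, ∫ w in ball (0 : ℂ) r, k ‖w‖ * u (p + e θ w) = J := by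
    intro θ
    have h1 := hrotint (fun w => k ‖w‖ * u (p + w)) θ
    simp only [hnorm] at h1
    exact h1
  set μ := (volume : Measure ℝ).restrict (Set.Ioc 0 (2 * Real.pi)) with hμ
  set ν := (volume : Measure ℂ).restrict (ball (0 : ℂ) r) with hν
  have hem : Measurable fun q : ℝ × ℂ => e q.1 q.2 := by
    apply Continuous.measurable
    rw [he]
    fun_prop
  have hmeas : Measurable fun q : ℝ × ℂ => k ‖q.2‖ * u (p + e q.1 q.2) :=
    (hkm.comp measurable_snd).mul (hu.measurable.comp (measurable_const.add hem))
  have hprod : Integrable (fun q : ℝ × ℂ => k ‖q.2‖ * u (p + e q.1 q.2)) (μ.prod ν) := by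
    rw [integrable_prod_iff hmeas.aestronglyMeasurable]
    constructor
    · refine Eventually.of_forall fun θ => ?_
      have h1 := ((hrot θ).1.integrableOn_comp_preimage (hrot θ).2
        (f := fun w => k ‖w‖ * u (p + w)) (s := ball (0 : ℂ) r)).2 hint
      rw [hpre] at h1
      refine Integrable.congr h1 (Eventually.of_forall fun w => ?_)
      simp only [Function.comp, hnorm]
    · refine (integrable_const (∫ w in ball (0 : ℂ) r, ‖k ‖w‖ * u (p + w)‖)).congr
        (Eventually.of_forall fun θ => ?_)
      dsimp only
      rw [← hrotint _ θ]
      simp only [hnorm]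
  have havg : ∀ w ∈ ball (0 : ℂ) r, w ≠ 0 →
      2 * Real.pi * (k ‖w‖ * u p) ≤ ∫ θ, k ‖w‖ * u (p + e θ w) ∂μ := by
    intro w hw hw0
    have hwn : 0 < ‖w‖ := norm_pos_iff.2 hw0
    have hsub : closedBall p ‖w‖ ⊆ rightQuadrant :=
      (closedBall_subset_closedBall (le_of_lt (mem_ball_zero_iff.1 hw))).trans hp
    have h1 := (hu.submean p ‖w‖ hwn hsub).2 hpZ
    rw [Real.circleAverage_eq_integral_add (Complex.arg w), smul_eq_mul,
      intervalIntegral.integral_of_le (by positivity)] at h1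
    have h2 : ∀ θ : ℝ, circleMap p ‖w‖ (θ + Complex.arg w) = p + e θ w := by
      intro θ
      simp only [circleMap, he]
      rw [Complex.ofReal_add, add_mul, Complex.exp_add]
      conv_rhs => rw [← Complex.norm_mul_exp_arg_mul_I w]
      ring
    simp only [h2] at h1
    rw [integral_const_mul]
    have h3 : 2 * Real.pi * u p ≤ ∫ θ, u (p + e θ w) ∂μ := by
      rw [inv_mul_eq_div, le_div_iff₀ (by positivity)] at h1
      linarith
    have h4 := mul_le_mul_of_nonneg_left h3 (hk0 ‖w‖ ⟨hwn.le, mem_ball_zero_iff.1 hw⟩)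
    linarith
  have hmain : 2 * Real.pi * (u p * ∫ w in ball (0 : ℂ) r, k ‖w‖) ≤ 2 * Real.pi * J := by
    calc 2 * Real.pi * (u p * ∫ w in ball (0 : ℂ) r, k ‖w‖)
        = ∫ w, 2 * Real.pi * (k ‖w‖ * u p) ∂ν := by
          rw [integral_const_mul, integral_mul_const, mul_comm (u p)]
      _ ≤ ∫ w, ∫ θ, k ‖w‖ * u (p + e θ w) ∂μ ∂ν := by
          refine integral_mono_ae ((hkint.mul_const _).const_mul _) hprod.integral_prod_right ?_
          have h0 : ∀ᵐ w ∂ν, w ∉ ({0} : Set ℂ) :=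
            ae_restrict_of_ae (measure_eq_zero_iff_ae_notMem.1 (by simp))
          filter_upwards [h0, ae_restrict_mem measurableSet_ball] with w hw0 hw
          exact havg w hw hw0
      _ = ∫ θ, ∫ w, k ‖w‖ * u (p + e θ w) ∂ν ∂μ := by
          rw [← integral_integral_swap (f := fun (θ : ℝ) (w : ℂ) => k ‖w‖ * u (p + e θ w)) hprod]
      _ = 2 * Real.pi * J := by
          simp only [hrotJ]
          rw [integral_const, hμ]
          simp [Real.pi_pos.le]
  exact le_of_mul_le_mul_left hmain (by positivity)

-- On the chord at height y the weight is b² - x² with b² = r² - y². It vanishes at both ends, so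
-- integrating by parts leaves no boundary term and replaces `u` by its tail.
open Metric in
theorem integral_ball_parabolic_eq (hu : TailAdmissible u Z) {p : ℂ} {r : ℝ} (hr : 0 < r)
    (hp : closedBall p r ⊆ rightQuadrant) :
    ∫ w in ball (0 : ℂ) r, (r ^ 2 - ‖w‖ ^ 2) * u (p + w) =
      ∫ w in ball (0 : ℂ) r, (-2 * w.re) * tailIntegral u (p + w) := by
  obtain ⟨hre, him⟩ := bounds_of_closedBall_subset_rightQuadrant hr hp
  obtain ⟨C, hC, hline⟩ := hu.line
  have hint1 : IntegrableOn (fun w => (r ^ 2 - ‖w‖ ^ 2) * u (p + w)) (ball 0 r) := by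
    refine (hu.integrableOn_ball hr hp).bdd_mul (c := r ^ 2)
      (Continuous.aestronglyMeasurable (by fun_prop))
      ((ae_restrict_mem measurableSet_ball).mono fun w hw => ?_)
    have h1 := mem_ball_zero_iff.1 hw
    rw [Real.norm_eq_abs, abs_le]
    constructor <;> nlinarith [norm_nonneg w]
  have hint2 : IntegrableOn (fun w => (-2 * w.re) * tailIntegral u (p + w)) (ball (0 : ℂ) r) := by
    refine (hu.tail.integrableOn_ball hr hp).bdd_mul (c := 2 * r)
      (Continuous.aestronglyMeasurable (by fun_prop))
      ((ae_restrict_mem measurableSet_ball).mono fun w hw => ?_)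
    have h1 := (Complex.abs_re_le_norm w).trans (mem_ball_zero_iff.1 hw).le
    rw [norm_mul]
    simp only [norm_neg, Real.norm_ofNat, Real.norm_eq_abs]
    linarith
  rw [setIntegral_ball_eq_iterated hint1, setIntegral_ball_eq_iterated hint2]
  congr 1
  ext y
  by_cases hy : y ^ 2 < r ^ 2
  · set b := √(r ^ 2 - y ^ 2) with hb
    have hb2 : b ^ 2 = r ^ 2 - y ^ 2 := Real.sq_sqrt (by linarith)
    have hb0 : 0 ≤ b := Real.sqrt_nonneg _
    have hbr : b ≤ r := by nlinarith [sq_nonneg y]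
    have hind : ∀ F : ℂ → ℝ, ∫ x : ℝ, (ball (0 : ℂ) r).indicator F (x + y * Complex.I) =
        ∫ x in (-b)..b, F (x + y * Complex.I) := by
      intro F
      rw [intervalIntegral.integral_of_le (by linarith), integral_Ioc_eq_integral_Ioo,
        ← integral_indicator measurableSet_Ioo]
      congr 1
      ext x
      have hiff : (x + y * Complex.I : ℂ) ∈ ball (0 : ℂ) r ↔ x ∈ Set.Ioo (-b) b := by
        rw [mem_ball_zero_iff_re_im hr, Set.mem_Ioo, ← abs_lt]
        nth_rewrite 1 [← abs_of_nonneg hb0]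
        rw [← sq_lt_sq, hb2]
        constructor <;> intro h <;> linarith
      by_cases hx : x ∈ Set.Ioo (-b) b
      · rw [Set.indicator_of_mem hx, Set.indicator_of_mem (hiff.2 hx)]
      · rw [Set.indicator_of_notMem hx, Set.indicator_of_notMem (fun h => hx (hiff.1 h))]
    rw [hind, hind]
    have hyr : |y| < r := by
      rw [← abs_of_pos hr]; exact sq_lt_sq.1 hy
    set F : ℂ → ℝ := fun z => u (p + y * Complex.I + z) with hF
    set s : ℂ := p - r + y * Complex.I with hs
    have hsq : s ∈ rightQuadrant := by
      rw [mem_rightQuadrant, hs]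
      simp
      exact ⟨by linarith, by linarith [(abs_lt.1 hyr).1]⟩
    have hg : IntegrableOn (fun α : ℝ => F (α + (0 : ℝ) * Complex.I)) (Set.Ioi (-r)) := by
      rw [← integrableOn_Ioi_shift]
      refine (hline s hsq).1.congr_fun (fun x _ => ?_) measurableSet_Ioi
      rw [hF, hs]
      dsimp only
      congr 1
      push_cast
      ring
    have h1 := integral_sq_sub_sq_mul_eq hb0 (by linarith : -r ≤ -b) hg
    calc _ = ∫ x in (-b)..b, (b ^ 2 - x ^ 2) * F (x + (0 : ℝ) * Complex.I) := by
          refine intervalIntegral.integral_congr fun x _ => ?_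
          rw [← Complex.normSq_eq_norm_sq, Complex.normSq_add_mul_I, hb2, hF]
          dsimp only
          congr 1
          · ring
          · congr 1
            push_cast
            ring
      _ = _ := h1
      _ = _ := by
          refine intervalIntegral.integral_congr fun x _ => ?_
          congr 1
          · simp
          · rw [← integral_Ioi_shift, tailIntegral]
            congr 1
            ext t
            rw [hF]
            dsimp only
            congr 1
            push_cast
            ring
  · have hzero : ∀ (F : ℂ → ℝ) (x : ℝ), (ball (0 : ℂ) r).indicator F (x + y * Complex.I) = 0 := by
      intro F x
      refine Set.indicator_of_notMem (fun h => hy ?_) _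
      rw [mem_ball_zero_iff_re_im hr] at h
      nlinarith [sq_nonneg x]
    simp only [hzero]

open Metric in
/-- A pointwise upper bound for `u` from the mean size of its tail integral. -/
theorem exists_le_mul_integral_abs_tail {r : ℝ} (hr : 0 < r) :
    ∃ C : ℝ, 0 < C ∧ ∀ (u : ℂ → ℝ) (Z : Set ℂ), TailAdmissible u Z → ∀ p : ℂ, p ∉ Z →
      closedBall p r ⊆ rightQuadrant →
        u p ≤ C * ∫ w in ball (0 : ℂ) r, |tailIntegral u (p + w)| := by
  set κ := ∫ w in ball (0 : ℂ) r, (r ^ 2 - ‖w‖ ^ 2) with hκ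
  have hκpos : 0 < κ := by
    have hpos : ∀ w ∈ ball (0 : ℂ) r, 0 < r ^ 2 - ‖w‖ ^ 2 := by
      intro w hw
      have := mem_ball_zero_iff.1 hw
      nlinarith [norm_nonneg w]
    rw [hκ, setIntegral_pos_iff_support_of_nonneg_ae]
    · have h1 : ball (0 : ℂ) r ⊆
          Function.support (fun w : ℂ => r ^ 2 - ‖w‖ ^ 2) ∩ ball (0 : ℂ) r :=
        fun w hw => ⟨(hpos w hw).ne', hw⟩
      exact (measure_ball_pos volume (0 : ℂ) hr).trans_le (measure_mono h1)
    · filter_upwards [ae_restrict_mem measurableSet_ball] with w hw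
      exact (hpos w hw).le
    · have : IntegrableOn (fun w : ℂ => r ^ 2 - ‖w‖ ^ 2) (closedBall 0 r) :=
        ContinuousOn.integrableOn_compact (isCompact_closedBall _ _) (by fun_prop)
      exact this.mono_set ball_subset_closedBall
  refine ⟨2 * r / κ, by positivity, fun u Z hu p hpZ hp => ?_⟩
  have h1 := hu.mul_integral_le_integral_ball hr hp hpZ (k := fun ρ => r ^ 2 - ρ ^ 2)
    (by fun_prop) (by
      intro ρ hρ
      have := hρ.1
      have := hρ.2
      nlinarith)
  rw [hu.integral_ball_parabolic_eq hr hp] at h1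
  have hint := (hu.tail.integrableOn_ball hr hp).abs
  have h2 : ∫ w in ball (0 : ℂ) r, (-2 * w.re) * tailIntegral u (p + w) ≤
      ∫ w in ball (0 : ℂ) r, 2 * r * |tailIntegral u (p + w)| := by
    refine le_trans (le_abs_self _) ?_
    rw [← Real.norm_eq_abs]
    refine norm_integral_le_of_norm_le (hint.const_mul (2 * r)) ?_
    filter_upwards [ae_restrict_mem measurableSet_ball] with w hw
    rw [norm_mul, Real.norm_eq_abs (tailIntegral u (p + w))]
    have h3 := (Complex.abs_re_le_norm w).trans (mem_ball_zero_iff.1 hw).le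
    refine mul_le_mul_of_nonneg_right ?_ (abs_nonneg _)
    rw [norm_mul]
    simp only [norm_neg, Real.norm_ofNat, Real.norm_eq_abs]
    linarith
  rw [integral_const_mul] at h2
  rw [div_mul_eq_mul_div, le_div_iff₀ hκpos]
  exact h1.trans h2

open Metric in
/-- An upper bound on a disc together with the value at the centre bounds the `L¹` norm. -/
theorem integral_abs_ball_le (hu : TailAdmissible u ∅) {p : ℂ} {r E : ℝ} (hr : 0 < r)
    (hp : closedBall p r ⊆ rightQuadrant) (hE : 0 ≤ E)
    (hle : ∀ w ∈ ball (0 : ℂ) r, u (p + w) ≤ E) :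
    ∫ w in ball (0 : ℂ) r, |u (p + w)| ≤ (2 * E - u p) * volume.real (ball (0 : ℂ) r) := by
  have h1 := hu.mul_integral_le_integral_ball hr hp (Set.notMem_empty p) (k := fun _ => 1)
    continuous_const (fun _ _ => zero_le_one)
  have hint := hu.integrableOn_ball hr hp
  have hc : IntegrableOn (fun _ : ℂ => 2 * E) (ball (0 : ℂ) r) :=
    integrableOn_const measure_ball_lt_top.ne
  -- From u ≤ E and E ≥ 0 follows |u| ≤ 2E - u, which is linear in u and open to the sub-mean-value
  -- inequality.
  calc ∫ w in ball (0 : ℂ) r, |u (p + w)| ≤ ∫ w in ball (0 : ℂ) r, (2 * E - u (p + w)) := by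
        refine setIntegral_mono_on hint.abs (hc.sub hint) measurableSet_ball fun w hw => ?_
        have := hle w hw
        rw [abs_le]
        constructor <;> linarith
    _ = 2 * E * volume.real (ball (0 : ℂ) r) - ∫ w in ball (0 : ℂ) r, u (p + w) := by
        rw [integral_sub hc hint, setIntegral_const, smul_eq_mul]
        ring
    _ ≤ _ := by
        simp only [setIntegral_const, one_mul, smul_eq_mul, mul_one] at h1
        linarith

end TailAdmissible

/-! ### The function log|ζ| is admissible -/

theorem analyticAt_riemannZeta {s : ℂ} (hs : s ≠ 1) : AnalyticAt ℂ riemannZeta s :=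
  analyticOn_riemannZeta s hs

theorem ne_one_of_im_pos {s : ℂ} (hs : 0 < s.im) : s ≠ 1 := by
  rintro rfl
  simp at hs

theorem measurable_riemannZeta : Measurable riemannZeta := by
  refine measurable_of_continuousOn_compl_singleton 1 ?_
  intro s hs
  exact (differentiableAt_riemannZeta hs).continuousAt.continuousWithinAt

theorem countable_riemannZetaZeros : riemannZetaZeros.Countable := by
  have h : riemannZetaZeros ⊆ ⋃ n : ℕ, Metric.closedBall (0 : ℂ) n ∩ riemannZetaZeros := by
    intro s hs
    obtain ⟨n, hn⟩ := exists_nat_ge ‖s‖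
    exact Set.mem_iUnion.2 ⟨n, by simpa using hn, hs⟩
  exact (Set.countable_iUnion fun n : ℕ =>
    ((isCompact_closedBall (0 : ℂ) n).inter_riemannZetaZeros_finite).countable).mono h

theorem countable_setOf_add_mem_riemannZetaZeros (s : ℂ) :
    {x : ℝ | s + x ∈ riemannZetaZeros}.Countable :=
  countable_riemannZetaZeros.preimage_of_injOn (f := fun x : ℝ => s + x)
    (Function.Injective.injOn fun x y h => by simpa using h)

open Metric in
theorem bounds_of_mem_closedBall {t r : ℝ} {z : ℂ} (hz : z ∈ closedBall (3 + t * Complex.I : ℂ) r) :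
    |z.re - 3| ≤ r ∧ |z.im - t| ≤ r := by
  have h := mem_closedBall.1 hz
  rw [dist_eq_norm] at h
  have h1 := (Complex.abs_re_le_norm _).trans h
  have h2 := (Complex.abs_im_le_norm _).trans h
  simp at h1 h2
  exact ⟨h1, h2⟩

open Metric in
theorem analyticOnNhd_riemannZeta_closedBall {t R : ℝ} (ht : 4 ≤ t) (hR : R ≤ 11 / 4) :
    AnalyticOnNhd ℂ riemannZeta (closedBall (3 + t * Complex.I : ℂ) R) := by
  intro z hz
  have h := bounds_of_mem_closedBall hz
  exact analyticAt_riemannZeta (ne_one_of_im_pos (by linarith [(abs_le.1 h.2).1]))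

open Metric in
theorem norm_riemannZeta_le_exp_of_mem_closedBall {t : ℝ} {z : ℂ} (ht : 4 ≤ t)
    (hz : z ∈ closedBall (3 + t * Complex.I : ℂ) (11 / 4)) :
    ‖riemannZeta z‖ ≤ Real.exp (3 * Real.log t) := by
  obtain ⟨h1, h2⟩ := bounds_of_mem_closedBall hz
  rw [abs_le] at h1 h2
  have h4 : Real.exp (3 * Real.log t) = t ^ 3 := by
    rw [show (3 : ℝ) * Real.log t = ((3 : ℕ) : ℝ) * Real.log t by norm_num, Real.exp_nat_mul,
      Real.exp_log (by linarith)]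
  rw [h4]
  have h5 := norm_riemannZeta_le (s := z) (by linarith) (by linarith)
  have h6 : ‖z‖ ≤ t + 17 / 2 := by
    have := Complex.norm_le_abs_re_add_abs_im z
    rw [abs_of_nonneg (by linarith), abs_of_nonneg (by linarith)] at this
    linarith
  rcases le_or_gt 5 t with h | h
  · have h7 : 5 * (t + 17 / 2) ≤ t ^ 3 := by nlinarith [sq_nonneg (t - 5)]
    linarith
  · have h8 : ‖z‖ ≤ 59 / 5 := by
      have hh := mem_closedBall.1 hz
      rw [dist_eq_norm] at hh
      have h9 : ‖z‖ ≤ ‖z - (3 + t * Complex.I)‖ + ‖(3 + t * Complex.I : ℂ)‖ := by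
        simpa using norm_add_le (z - (3 + t * Complex.I)) (3 + t * Complex.I)
      have h10 : ‖(3 + t * Complex.I : ℂ)‖ ≤ 6 := by
        have h11 : ‖(3 + t * Complex.I : ℂ)‖ ^ 2 ≤ 6 ^ 2 := by
          rw [← Complex.normSq_eq_norm_sq, show (3 + t * Complex.I : ℂ) = ((3 : ℝ) + t * Complex.I : ℂ) by simp,
            Complex.normSq_add_mul_I]
          nlinarith
        exact (pow_le_pow_iff_left₀ (norm_nonneg _) (by norm_num) two_ne_zero).1 h11
      linarith
    have h7 : (64 : ℝ) ≤ t ^ 3 := by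
      have := pow_le_pow_left₀ (by norm_num) ht 3
      norm_num at this
      exact this
    linarith

-- Discs are centred at 3 + it, where |ζ| ≥ 1/2. Radius 11/4 reaches Re s = 1/4, still inside the
-- region of the bound 5|s|, and radius 5/2 reaches the critical line; the logarithmic size is 3 log
-- t.
open Metric in
theorem exists_integral_abs_log_norm_riemannZeta_le :
    ∃ C : ℝ, 0 < C ∧ ∀ t : ℝ, 4 ≤ t → ∀ a b : ℝ, 1 / 2 ≤ a → a ≤ b → b ≤ 11 / 2 →
      IntervalIntegrable (fun x : ℝ => Real.log ‖riemannZeta (x + t * Complex.I)‖) volume a b ∧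
        ∫ x in a..b, |Real.log ‖riemannZeta (x + t * Complex.I)‖| ≤
          C * Real.log t * √(b - a) := by
  obtain ⟨C, hC, h⟩ := exists_integral_abs_log_norm_le (r := 5 / 2) (R := 11 / 4) (by norm_num)
    (by norm_num)
  refine ⟨3 * C, by positivity, fun t ht a b ha hab hb => ?_⟩
  have hlog := one_le_log_of_four_le ht
  have h1 := h riemannZeta (3 + t * Complex.I) (3 * Real.log t) (by positivity)
    (analyticOnNhd_riemannZeta_closedBall ht le_rfl)
    (fun z hz => norm_riemannZeta_le_exp_of_mem_closedBall ht hz) ?_ a b t hab ?_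
  · refine ⟨h1.1, h1.2.trans (le_of_eq (by ring))⟩
  · have h2 := (norm_riemannZeta_sub_one_le (s := 3 + t * Complex.I) (by simp)).2
    have h3 : 1 ≤ ‖riemannZeta (3 + t * Complex.I)‖ + ‖riemannZeta (3 + t * Complex.I) - 1‖ := by
      have := norm_sub_le (riemannZeta (3 + t * Complex.I)) (riemannZeta (3 + t * Complex.I) - 1)
      simpa using this
    have h4 : Real.exp (-(3 * Real.log t)) ≤ 1 / 2 := by
      have h5 : Real.exp (-(3 * Real.log t)) ≤ Real.exp (-1) := Real.exp_le_exp.2 (by linarith)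
      have h6 : Real.exp (-1) ≤ 1 / 2 := by
        rw [Real.exp_neg, one_div]
        exact inv_anti₀ (by norm_num) (by linarith [Real.exp_one_gt_d9])
      linarith
    linarith
  · intro x hx
    rw [mem_closedBall, dist_eq_norm,
      show (x + t * Complex.I - (3 + t * Complex.I) : ℂ) = ((x - 3 : ℝ) : ℂ) by push_cast; ring,
      Complex.norm_real, Real.norm_eq_abs, abs_le]
    constructor <;> linarith [hx.1, hx.2]

theorem log_norm_riemannZeta_le {s : ℂ} (hs : s ∈ rightQuadrant) (hs3 : s.re ≤ 3) :
    Real.log ‖riemannZeta s‖ ≤ 3 * Real.log s.im := by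
  have hlog := one_le_log_of_four_le hs.2
  by_cases h0 : riemannZeta s = 0
  · rw [h0]
    simp
    linarith
  · rw [Real.log_le_iff_le_exp (norm_pos_iff.2 h0)]
    refine norm_riemannZeta_le_exp_of_mem_closedBall hs.2 ?_
    rw [Metric.mem_closedBall, dist_eq_norm,
      show s - (3 + s.im * Complex.I) = ((s.re - 3 : ℝ) : ℂ) by
        apply Complex.ext <;> simp,
      Complex.norm_real, Real.norm_eq_abs, abs_le]
    constructor <;> linarith [hs.1]

theorem integrableOn_log_norm_riemannZeta_Ioi {σ t : ℝ} (hσ : 3 ≤ σ) :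
    IntegrableOn (fun x : ℝ => Real.log ‖riemannZeta (x + t * Complex.I)‖) (Set.Ioi σ) ∧
      ∫ x in Set.Ioi σ, |Real.log ‖riemannZeta (x + t * Complex.I)‖| ≤
        12 * Real.exp (-σ / 2) := by
  have hB : IntegrableOn (fun x : ℝ => 6 * Real.exp (-x / 2)) (Set.Ioi σ) :=
    (integrableOn_exp_neg_half σ).const_mul 6
  have hle : ∀ x ∈ Set.Ioi σ, |Real.log ‖riemannZeta (x + t * Complex.I)‖| ≤
      6 * Real.exp (-x / 2) := by
    intro x hx
    have hx' : σ < x := hx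
    have := abs_log_norm_riemannZeta_le (s := x + t * Complex.I) (by simp; linarith)
    simpa using this
  have hm : Measurable fun x : ℝ => Real.log ‖riemannZeta (x + t * Complex.I)‖ :=
    Real.measurable_log.comp (measurable_norm.comp (measurable_riemannZeta.comp (by fun_prop)))
  have hint : IntegrableOn (fun x : ℝ => Real.log ‖riemannZeta (x + t * Complex.I)‖) (Set.Ioi σ) :=
    Integrable.mono' hB hm.aestronglyMeasurable ((ae_restrict_mem measurableSet_Ioi).mono hle)
  refine ⟨hint, ?_⟩
  calc _ ≤ ∫ x in Set.Ioi σ, 6 * Real.exp (-x / 2) :=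
        setIntegral_mono_on hint.abs hB measurableSet_Ioi hle
    _ = _ := by
        rw [integral_const_mul, integral_exp_neg_half]
        ring

theorem exists_integral_Ioi_abs_log_norm_riemannZeta_le :
    ∃ C : ℝ, 0 ≤ C ∧ ∀ σ t : ℝ, 1 / 2 ≤ σ → 4 ≤ t →
      IntegrableOn (fun x : ℝ => Real.log ‖riemannZeta (x + t * Complex.I)‖) (Set.Ioi σ) ∧
        ∫ x in Set.Ioi σ, |Real.log ‖riemannZeta (x + t * Complex.I)‖| ≤
          C * Real.log t * Real.exp (-σ / 2) := by
  obtain ⟨C, hC, h⟩ := exists_integral_abs_log_norm_riemannZeta_le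
  -- The factor e^(3/2) makes e^(3/2) e^(-σ/2) ≥ 1 for σ ≤ 3, where no decay is available.
  refine ⟨(2 * C + 12) * Real.exp (3 / 2), by positivity, fun σ t hσ ht => ?_⟩
  have hlog := one_le_log_of_four_le ht
  have hexp : 1 ≤ Real.exp (3 / 2) := Real.one_le_exp (by norm_num)
  rcases le_or_gt 3 σ with h3 | h3
  · have h1 := integrableOn_log_norm_riemannZeta_Ioi (t := t) h3
    refine ⟨h1.1, h1.2.trans ?_⟩
    have h2 : 12 ≤ (2 * C + 12) * Real.exp (3 / 2) * Real.log t := by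
      calc (12 : ℝ) ≤ (2 * C + 12) * 1 * 1 := by linarith
        _ ≤ _ := by gcongr
    gcongr
  · have h1 := integrableOn_log_norm_riemannZeta_Ioi (t := t) (le_refl (3 : ℝ))
    obtain ⟨h2, h4⟩ := h t ht σ 3 hσ h3.le (by norm_num)
    have h5 : IntegrableOn (fun x : ℝ => Real.log ‖riemannZeta (x + t * Complex.I)‖)
        (Set.Ioc σ 3) := (intervalIntegrable_iff_integrableOn_Ioc_of_le h3.le).1 h2
    have hun : Set.Ioi σ = Set.Ioc σ 3 ∪ Set.Ioi 3 := (Set.Ioc_union_Ioi_eq_Ioi h3.le).symm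
    rw [hun]
    refine ⟨h5.union h1.1, ?_⟩
    rw [setIntegral_union (Set.Ioc_disjoint_Ioi le_rfl) measurableSet_Ioi h5.abs h1.1.abs,
      ← intervalIntegral.integral_of_le h3.le]
    have h6 : √(3 - σ) ≤ 2 := by
      rw [Real.sqrt_le_left (by norm_num)]
      linarith
    have h7 : Real.exp (-3 / 2) ≤ 1 := Real.exp_le_one_iff.2 (by norm_num)
    have h8 : 1 ≤ Real.exp (3 / 2) * Real.exp (-σ / 2) := by
      rw [← Real.exp_add]
      exact Real.one_le_exp (by linarith)
    calc _ ≤ C * Real.log t * 2 + 12 * 1 := by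
          refine add_le_add (h4.trans (by gcongr)) (h1.2.trans (by gcongr))
      _ ≤ (2 * C + 12) * Real.log t * 1 := by nlinarith
      _ ≤ (2 * C + 12) * Real.log t * (Real.exp (3 / 2) * Real.exp (-σ / 2)) := by gcongr
      _ = _ := by ring

-- Jensen's formula: the circle average exceeds the value at the centre by a sum over zeros, all of
-- whose terms are nonnegative.
open Metric in
theorem log_norm_riemannZeta_le_circleAverage {p : ℂ} {r : ℝ} (hr : 0 < r)
    (han : AnalyticOnNhd ℂ riemannZeta (closedBall p r)) (hp : riemannZeta p ≠ 0) :
    Real.log ‖riemannZeta p‖ ≤ Real.circleAverage (fun s => Real.log ‖riemannZeta s‖) p r := by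
  rw [← abs_of_pos hr] at han
  rw [AnalyticOnNhd.circleAverage_log_norm hr.ne' han hp]
  refine le_add_of_nonneg_left (finsum_nonneg fun u => ?_)
  by_cases hu : u ∈ closedBall p |r|
  · refine mul_nonneg (by exact_mod_cast MeromorphicOn.AnalyticOnNhd.divisor_nonneg han u) ?_
    rcases eq_or_ne p u with rfl | hpu
    · simp
    · refine Real.log_nonneg ?_
      rw [mem_closedBall', dist_eq_norm, abs_of_pos hr] at hu
      rw [← div_eq_mul_inv, one_le_div (norm_pos_iff.2 (sub_ne_zero.2 hpu))]
      exact hu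
  · rw [Function.locallyFinsuppWithin.apply_eq_zero_of_notMem _ hu]
    simp

open Metric in
theorem tailAdmissible_log_norm_riemannZeta :
    TailAdmissible (fun s => Real.log ‖riemannZeta s‖) riemannZetaZeros where
  measurable := Real.measurable_log.comp (measurable_norm.comp measurable_riemannZeta)
  line := by
    obtain ⟨C, hC, h⟩ := exists_integral_Ioi_abs_log_norm_riemannZeta_le
    refine ⟨C, hC, fun s hs => ?_⟩
    have h1 := h s.re s.im hs.1 hs.2
    have h2 := integrableOn_Ioi_shift (fun s => Real.log ‖riemannZeta s‖) s.re s.im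
    have h3 := integral_Ioi_shift (fun s => |Real.log ‖riemannZeta s‖|) s.re s.im
    rw [Complex.re_add_im] at h2 h3
    exact ⟨h2.2 h1.1, h3.le.trans h1.2⟩
  upper := by
    refine ⟨6 * Real.exp (3 / 2), by positivity, fun s hs => ?_⟩
    have hlog := one_le_log_of_four_le hs.2
    have hexp : 1 ≤ Real.exp (3 / 2) := Real.one_le_exp (by norm_num)
    rcases le_or_gt 3 s.re with h3 | h3
    · refine (le_abs_self _).trans ((abs_log_norm_riemannZeta_le h3).trans ?_)
      have : 6 ≤ 6 * Real.exp (3 / 2) * Real.log s.im := by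
        calc (6 : ℝ) = 6 * 1 * 1 := by norm_num
          _ ≤ _ := by gcongr
      gcongr
    · have h8 : 1 ≤ Real.exp (3 / 2) * Real.exp (-s.re / 2) := by
        rw [← Real.exp_add]
        exact Real.one_le_exp (by linarith)
      calc _ ≤ 3 * Real.log s.im := log_norm_riemannZeta_le hs h3.le
        _ ≤ 6 * Real.log s.im * 1 := by linarith
        _ ≤ 6 * Real.log s.im * (Real.exp (3 / 2) * Real.exp (-s.re / 2)) := by gcongr
        _ = _ := by ring
  right := ⟨6, by norm_num, fun s _ h3 => abs_log_norm_riemannZeta_le h3⟩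
  countable := countable_setOf_add_mem_riemannZetaZeros
  submean := by
    intro p r hr hp
    have han : AnalyticOnNhd ℂ riemannZeta (closedBall p |r|) := by
      rw [abs_of_pos hr]
      intro z hz
      exact analyticAt_riemannZeta (ne_one_of_im_pos (by linarith [(hp hz).2]))
    refine ⟨?_, fun hpZ => ?_⟩
    · exact MeromorphicOn.circleIntegrable_log_norm fun z hz =>
        (han z (sphere_subset_closedBall hz)).meromorphicAt
    · exact log_norm_riemannZeta_le_circleAverage hr (by rwa [abs_of_pos hr] at han) hpZ
  usc := by
    intro s hs hsZ
    have h1 : riemannZeta s ≠ 0 := hsZ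
    have h2 : ContinuousAt (fun s => Real.log ‖riemannZeta s‖) s := by
      refine ContinuousAt.log ?_ (norm_ne_zero_iff.2 h1)
      exact (differentiableAt_riemannZeta
        (ne_one_of_im_pos (by linarith [hs.2]))).continuousAt.norm
    exact h2.continuousWithinAt.upperSemicontinuousWithinAt

/-- The iterated horizontal tail integrals of `log ‖ζ‖`. -/
noncomputable def zetaLogIter : ℕ → ℂ → ℝ
  | 0 => fun s => Real.log ‖riemannZeta s‖
  | m + 1 => tailIntegral (zetaLogIter m)

theorem tailAdmissible_zetaLogIter_succ (m : ℕ) : TailAdmissible (zetaLogIter (m + 1)) ∅ := by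
  induction m with
  | zero => exact tailAdmissible_log_norm_riemannZeta.tail
  | succ m ih => exact ih.tail

/-! ### Convexity in vertical strips -/

open Metric in
theorem CircleIntegrable.re_affine (b c : ℝ) (p : ℂ) (r : ℝ) :
    CircleIntegrable (fun z => c * (b - z.re)) p r ∧
      Real.circleAverage (fun z : ℂ => c * (b - z.re)) p r = c * (b - p.re) := by
  constructor
  · exact ContinuousOn.circleIntegrable' (Continuous.continuousOn (by fun_prop))
  · have h : AnalyticOnNhd ℂ (fun z : ℂ => (c : ℂ) * (b - z)) (closedBall p |r|) := by
      intro z _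
      fun_prop
    simpa using h.circleAverage_re

open Metric in
/-- A convexity principle for subharmonic functions of logarithmic growth in a vertical strip. -/
theorem eventually_le_of_submean_strip {u : ℂ → ℝ} {a b C D : ℝ} (hab : a < b)
    (hba : b - a ≤ 5 / 2) (hC : 0 ≤ C) (hD : 0 ≤ D)
    (husc : UpperSemicontinuousOn u {s : ℂ | (a ≤ s.re ∧ s.re ≤ b) ∧ 4 ≤ s.im})
    (hsub : ∀ p : ℂ, u p ≤ 0 ∨ ∀ r > 0,
      closedBall p r ⊆ {s : ℂ | (a ≤ s.re ∧ s.re ≤ b) ∧ 4 ≤ s.im} →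
        CircleIntegrable u p r ∧ u p ≤ Real.circleAverage u p r)
    (hall : ∀ s : ℂ, a ≤ s.re → s.re ≤ b → 4 ≤ s.im → u s ≤ C * Real.log s.im)
    (hleft : ∀ ε > 0, ∀ᶠ t : ℝ in atTop, u (a + t * Complex.I) ≤ (D + ε) * Real.log t)
    (hright : ∀ ε > 0, ∀ᶠ t : ℝ in atTop, u (b + t * Complex.I) ≤ ε * Real.log t)
    {ε : ℝ} (hε : 0 < ε) :
    ∀ᶠ t : ℝ in atTop, ∀ σ : ℝ, a ≤ σ → σ ≤ b →
      u (σ + t * Complex.I) ≤ (ε + D * (b - σ) / (b - a)) * Real.log t := by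
  obtain ⟨T₁, hT₁⟩ := eventually_atTop.1 (hleft (ε / 4) (by positivity))
  obtain ⟨T₂, hT₂⟩ := eventually_atTop.1 (hright (ε / 4) (by positivity))
  have hlogev := Real.tendsto_log_atTop.eventually_ge_atTop ((D + ε / 4) / (ε / 4))
  filter_upwards [hlogev, eventually_ge_atTop 8, eventually_ge_atTop (2 * T₁),
    eventually_ge_atTop (2 * T₂), eventually_ge_atTop (32 * C / ε)] with T hl h8 h1 h2 h3 σ hσa hσb
  rw [div_le_iff₀ (by positivity)] at hl
  rw [div_le_iff₀ hε] at h3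
  have hlog := one_le_log_of_four_le (t := T) (by linarith)
  have hba' : 0 < b - a := sub_pos.2 hab
  -- The linear function interpolating between D log T on the left side and 0 on the right. With T
  -- frozen it is harmonic, and on the rectangle log Im s ≤ log T + 1.
  set c := D * Real.log T / (b - a) with hc
  have hc0 : 0 ≤ c := by positivity
  set Q : Set ℂ := {s : ℂ | (a ≤ s.re ∧ s.re ≤ b) ∧ |s.im - T| ≤ T / 2} with hQ
  have hQim : ∀ s : ℂ, |s.im - T| ≤ T / 2 → T / 2 ≤ s.im ∧ 4 ≤ s.im ∧
      Real.log s.im ≤ Real.log T + 1 := by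
    intro s hs
    rw [abs_le] at hs
    refine ⟨by linarith, by linarith, ?_⟩
    rw [← Real.log_exp 1, ← Real.log_mul (by linarith) (Real.exp_ne_zero _)]
    refine Real.log_le_log (by linarith) ?_
    nlinarith [Real.exp_one_gt_d9]
  have hQsub : Q ⊆ {s : ℂ | (a ≤ s.re ∧ s.re ≤ b) ∧ 4 ≤ s.im} :=
    fun s hs => ⟨hs.1, (hQim s hs.2).2.1⟩
  -- The rectangle has heights from T/2 to 3T/2, so the horizontal sides contribute 16 C log T / T,
  -- at most (ε/2) log T once T ≥ 32C/ε.
  have key := le_of_submean_rectangle (u := fun s => u s - c * (b - s.re)) (a := a) (b := b)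
    (T := T) (K := T / 2) (A := ε / 2 * Real.log T) (B := 2 * C * Real.log T) hba (by linarith)
    (by positivity) (by positivity) ?_ ?_ ?_ ?_ hσa hσb
  · have h4 : 4 * (2 * C * Real.log T) / (T / 2) ≤ ε / 2 * Real.log T := by
      rw [div_le_iff₀ (by linarith)]
      nlinarith
    have h5 : D * (b - σ) / (b - a) * Real.log T = c * (b - σ) := by
      rw [hc]
      ring
    rw [add_mul, h5]
    simp at key
    linarith
  · have hcont : Continuous fun s : ℂ => -(c * (b - s.re)) := by fun_prop
    simp_rw [sub_eq_add_neg (u _)]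
    exact (husc.mono hQsub).add (hcont.continuousOn.upperSemicontinuousOn)
  · intro p hpa hpb _
    rcases hsub p with h | h
    · left
      have : 0 ≤ c * (b - p.re) := mul_nonneg hc0 (by linarith)
      linarith
    · right
      intro r hr hpr
      obtain ⟨h4, h5⟩ := h r hr (hpr.trans hQsub)
      obtain ⟨h6, h7⟩ := CircleIntegrable.re_affine b c p r
      refine ⟨h4.sub h6, ?_⟩
      rw [Real.circleAverage_fun_sub h4 h6, h7]
      linarith
  · intro s hs hsT
    obtain ⟨h4, h5, h6⟩ := hQim s hsT
    have hs' : s = s.re + s.im * Complex.I := (Complex.re_add_im s).symm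
    rcases hs with h | h
    · have h7 := hT₁ s.im (by linarith)
      rw [← h, ← hs'] at h7
      have h8 : c * (b - s.re) = D * Real.log T := by
        rw [hc, h]
        field_simp
      have h9 : (D + ε / 4) * Real.log s.im ≤ (D + ε / 4) * (Real.log T + 1) := by gcongr
      linarith
    · have h7 := hT₂ s.im (by linarith)
      rw [← h, ← hs'] at h7
      have h9 : ε / 4 * Real.log s.im ≤ ε / 4 * (Real.log T + 1) := by gcongr
      rw [h]
      nlinarith
  · intro s hsa hsb hsT
    obtain ⟨h4, h5, h6⟩ := hQim s hsT
    have h7 := hall s hsa hsb h5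
    have h8 : C * Real.log s.im ≤ C * (Real.log T + 1) := by gcongr
    have : 0 ≤ c * (b - s.re) := mul_nonneg hc0 (by linarith)
    nlinarith

-- The positive part of log|ζ| is continuous across the zeros and needs the sub-mean-value
-- inequality only where |ζ| > 1. There it equals log|ζ|, and on the circle log|ζ| is at most its
-- positive part.
open Metric in
theorem posLog_norm_riemannZeta_le_circleAverage (p : ℂ) :
    Real.posLog ‖riemannZeta p‖ ≤ 0 ∨ ∀ r > 0, closedBall p r ⊆ {s : ℂ | 4 ≤ s.im} →
      CircleIntegrable (fun s => Real.posLog ‖riemannZeta s‖) p r ∧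
        Real.posLog ‖riemannZeta p‖ ≤
          Real.circleAverage (fun s => Real.posLog ‖riemannZeta s‖) p r := by
  by_cases h1 : ‖riemannZeta p‖ ≤ 1
  · left
    rw [(Real.posLog_eq_zero_iff _).2 (by simpa using h1)]
  right
  intro r hr hp
  push Not at h1
  have han : AnalyticOnNhd ℂ riemannZeta (closedBall p |r|) := by
    rw [abs_of_pos hr]
    intro z hz
    have : 4 ≤ z.im := hp hz
    exact analyticAt_riemannZeta (ne_one_of_im_pos (by linarith))
  have hci : CircleIntegrable (fun s => Real.posLog ‖riemannZeta s‖) p r := by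
    refine ContinuousOn.circleIntegrable' ?_
    exact Real.continuous_posLog.comp_continuousOn
      (han.continuousOn.norm.mono sphere_subset_closedBall)
  have hci' : CircleIntegrable (fun s => Real.log ‖riemannZeta s‖) p r :=
    MeromorphicOn.circleIntegrable_log_norm fun z hz =>
      (han z (sphere_subset_closedBall hz)).meromorphicAt
  refine ⟨hci, ?_⟩
  rw [Real.posLog_eq_log (by rw [abs_norm]; exact h1.le)]
  have h0 : riemannZeta p ≠ 0 := by
    intro h
    rw [h] at h1
    simp at h1
    linarith
  refine (log_norm_riemannZeta_le_circleAverage hr (by rwa [abs_of_pos hr] at han) h0).trans ?_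
  exact Real.circleAverage_mono hci' hci fun z _ => le_max_right _ _

theorem posLog_le_iff {x y : ℝ} (hy : 0 ≤ y) : Real.posLog x ≤ y ↔ Real.log x ≤ y := by
  rw [Real.posLog_apply, max_le_iff]
  exact ⟨fun h => h.2, fun h => ⟨hy, h⟩⟩

theorem continuousOn_posLog_norm_riemannZeta {S : Set ℂ} (hS : ∀ s ∈ S, 4 ≤ s.im) :
    ContinuousOn (fun s => Real.posLog ‖riemannZeta s‖) S := by
  refine Real.continuous_posLog.comp_continuousOn (ContinuousOn.norm fun s hs => ?_)
  exact (differentiableAt_riemannZeta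
    (ne_one_of_im_pos (by linarith [hS s hs]))).continuousAt.continuousWithinAt

theorem eventually_const_le_mul_log (C : ℝ) {ε : ℝ} (hε : 0 < ε) :
    ∀ᶠ t : ℝ in atTop, C ≤ ε * Real.log t := by
  filter_upwards [Real.tendsto_log_atTop.eventually_ge_atTop (C / ε)] with t ht
  rwa [div_le_iff₀ hε, mul_comm] at ht

theorem abs_log_norm_riemannZeta_le_six {s : ℂ} (hs : 3 ≤ s.re) :
    |Real.log ‖riemannZeta s‖| ≤ 6 := by
  refine (abs_log_norm_riemannZeta_le hs).trans ?_
  have : Real.exp (-s.re / 2) ≤ 1 := Real.exp_le_one_iff.2 (by linarith)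
  linarith

/-! ### The Lindelöf Hypothesis makes every iterate small -/

/-- Under the Lindelöf Hypothesis `log ‖ζ‖` is `o(log t)` from above, uniformly to the right of
the critical line. -/
theorem LindelofHypothesis.eventually_log_norm_le (h : LindelofHypothesis) {ε : ℝ} (hε : 0 < ε) :
    ∀ᶠ t : ℝ in atTop, ∀ σ : ℝ, 1 / 2 ≤ σ →
      Real.log ‖riemannZeta (σ + t * Complex.I)‖ ≤ ε * Real.log t := by
  have hright : ∀ ε > 0, ∀ᶠ t : ℝ in atTop, ∀ σ : ℝ, 3 ≤ σ →
      Real.posLog ‖riemannZeta (σ + t * Complex.I)‖ ≤ ε * Real.log t := by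
    intro ε hε
    filter_upwards [eventually_const_le_mul_log 6 hε] with t ht σ hσ
    rw [posLog_le_iff (by linarith)]
    exact (le_abs_self _).trans ((abs_log_norm_riemannZeta_le_six (by simpa using hσ)).trans ht)
  have key := eventually_le_of_submean_strip (u := fun s => Real.posLog ‖riemannZeta s‖)
    (a := 1 / 2) (b := 3) (C := 3) (D := 0) (by norm_num) (by norm_num) (by norm_num) le_rfl
    ?_ ?_ ?_ ?_ ?_ hε
  · filter_upwards [key, hright ε hε, eventually_ge_atTop 4] with t h1 h2 ht σ hσ
    have hlog := one_le_log_of_four_le ht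
    rw [← posLog_le_iff (by positivity)]
    rcases le_or_gt 3 σ with h3 | h3
    · exact h2 σ h3
    · simpa using h1 σ hσ h3.le
  · exact (continuousOn_posLog_norm_riemannZeta fun s hs => hs.2).upperSemicontinuousOn
  · intro p
    rcases posLog_norm_riemannZeta_le_circleAverage p with h1 | h1
    · exact Or.inl h1
    · exact Or.inr fun r hr hp => h1 r hr (hp.trans fun s hs => hs.2)
  · intro s h1 h2 h3
    have hlog := one_le_log_of_four_le h3
    rw [posLog_le_iff (by positivity)]
    exact log_norm_riemannZeta_le ⟨h1, h3⟩ h2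
  · intro ε hε
    obtain ⟨C, hC⟩ := (h (ε / 2) (by positivity)).bound
    filter_upwards [hC, eventually_ge_atTop 4,
      eventually_const_le_mul_log (Real.log (max C 1)) (half_pos hε)] with t h1 h4 h2
    have hlog := one_le_log_of_four_le h4
    rw [posLog_le_iff (by positivity)]
    push_cast
    by_cases h0 : riemannZeta (1 / 2 + t * Complex.I) = 0
    · rw [h0]
      simp
      positivity
    have hC1 : 0 < max C 1 := lt_max_of_lt_right one_pos
    calc _ ≤ Real.log (max C 1 * t ^ (ε / 2)) := by
          refine Real.log_le_log (norm_pos_iff.2 h0) (h1.trans ?_)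
          rw [Real.norm_of_nonneg (by positivity)]
          gcongr
          exact le_max_left _ _
      _ = Real.log (max C 1) + ε / 2 * Real.log t := by
          rw [Real.log_mul hC1.ne' (by positivity), Real.log_rpow (by linarith)]
      _ ≤ _ := by linarith
  · intro ε hε
    filter_upwards [hright ε hε] with t ht
    exact ht 3 le_rfl

theorem log_le_two_mul_log {t y : ℝ} (ht : 4 ≤ t) (hy : 0 < y) (hyt : y ≤ t + 5 / 2) :
    Real.log y ≤ 2 * Real.log t := by
  have h : Real.log (t ^ 2) = 2 * Real.log t := by
    rw [Real.log_pow]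
    norm_num
  rw [← h]
  exact Real.log_le_log hy (by nlinarith)

theorem half_le_norm_riemannZeta {s : ℂ} (hs : 3 ≤ s.re) : 1 / 2 ≤ ‖riemannZeta s‖ := by
  have h2 := (norm_riemannZeta_sub_one_le hs).2
  have h3 := norm_sub_le (riemannZeta s) (riemannZeta s - 1)
  simp at h3
  linarith

-- On the first δ of the segment the unconditional estimate costs O(√δ log t). The rest lies in a
-- disc of radius 5/2 - δ about 3 + it, and the Lindelöf bound holds on the disc of radius 5/2,
-- which stays in Re s ≥ 1/2.
open Metric in
theorem LindelofHypothesis.eventually_integral_abs_log_norm_le (h : LindelofHypothesis) {ε : ℝ}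
    (hε : 0 < ε) :
    ∀ᶠ t : ℝ in atTop,
      ∫ x in (1 / 2 : ℝ)..3, |Real.log ‖riemannZeta (x + t * Complex.I)‖| ≤ ε * Real.log t := by
  obtain ⟨C₁, hC₁, h₁⟩ := exists_integral_abs_log_norm_riemannZeta_le
  set δ := min 1 ((ε / (2 * C₁)) ^ 2) with hδ
  have hδ0 : 0 < δ := lt_min one_pos (by positivity)
  have hδ1 : δ ≤ 1 := min_le_left _ _
  have hδs : √δ ≤ ε / (2 * C₁) := by
    rw [Real.sqrt_le_left (by positivity)]
    exact min_le_right _ _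
  -- This constant may blow up as δ tends to 0, so δ is fixed first and ε' is chosen in terms of it.
  obtain ⟨C₂, hC₂, h₂⟩ := exists_integral_abs_log_norm_le (r := 5 / 2 - δ) (R := 5 / 2)
    (by linarith) (by linarith)
  set ε' := ε / (8 * C₂) with hε'
  have hε'0 : 0 < ε' := by positivity
  obtain ⟨T₀, hT₀⟩ := eventually_atTop.1 (h.eventually_log_norm_le hε'0)
  filter_upwards [eventually_ge_atTop 8, eventually_ge_atTop (T₀ + 5 / 2),
    eventually_const_le_mul_log 1 hε'0] with t ht hT h1
  have hlog := one_le_log_of_four_le (t := t) (by linarith)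
  obtain ⟨hi1, hb1⟩ := h₁ t (by linarith) (1 / 2) (1 / 2 + δ) le_rfl (by linarith) (by linarith)
  have hfar := h₂ riemannZeta (3 + t * Complex.I) (2 * ε' * Real.log t) (by positivity)
    (analyticOnNhd_riemannZeta_closedBall (by linarith) (by norm_num)) ?_ ?_ (1 / 2 + δ) 3 t
    (by linarith) ?_
  · obtain ⟨hi2, hb2⟩ := hfar
    rw [← intervalIntegral.integral_add_adjacent_intervals hi1.abs hi2.abs]
    have h3 : C₁ * Real.log t * √(1 / 2 + δ - 1 / 2) ≤ ε / 2 * Real.log t := by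
      rw [show 1 / 2 + δ - 1 / 2 = δ by ring]
      calc _ ≤ C₁ * Real.log t * (ε / (2 * C₁)) := by gcongr
        _ = _ := by field_simp
    have h4 : C₂ * (2 * ε' * Real.log t) * √(3 - (1 / 2 + δ)) ≤ ε / 2 * Real.log t := by
      have h5 : √(3 - (1 / 2 + δ)) ≤ 2 := by
        rw [Real.sqrt_le_left (by norm_num)]
        linarith
      calc _ ≤ C₂ * (2 * ε' * Real.log t) * 2 := by gcongr
        _ = _ := by
          rw [hε']
          field_simp
          ring
    linarith
  · intro z hz
    obtain ⟨h5, h6⟩ := bounds_of_mem_closedBall hz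
    rw [abs_le] at h5 h6
    have h7 := hT₀ z.im (by linarith) z.re (by linarith)
    rw [Complex.re_add_im] at h7
    by_cases h0 : riemannZeta z = 0
    · rw [h0, norm_zero]
      exact (Real.exp_pos _).le
    rw [← Real.log_le_iff_le_exp (norm_pos_iff.2 h0)]
    have h8 := log_le_two_mul_log (t := t) (y := z.im) (by linarith) (by linarith) (by linarith)
    nlinarith
  · have h5 := half_le_norm_riemannZeta (s := 3 + t * Complex.I) (by simp)
    have h6 : Real.exp (-(2 * ε' * Real.log t)) ≤ Real.exp (-1) :=
      Real.exp_le_exp.2 (by linarith)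
    have h7 : Real.exp (-1) ≤ 1 / 2 := by
      rw [Real.exp_neg, one_div]
      exact inv_anti₀ (by norm_num) (by linarith [Real.exp_one_gt_d9])
    linarith
  · intro x hx
    rw [mem_closedBall, dist_eq_norm,
      show (x + t * Complex.I - (3 + t * Complex.I) : ℂ) = ((x - 3 : ℝ) : ℂ) by push_cast; ring,
      Complex.norm_real, Real.norm_eq_abs, abs_le]
    constructor <;> linarith [hx.1, hx.2]

namespace TailAdmissible

variable {u : ℂ → ℝ} {Z : Set ℂ}

/-- Smallness of a tail integral follows from smallness of the integral over a bounded range. -/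
theorem eventually_abs_tailIntegral_le (hu : TailAdmissible u Z)
    (h : ∀ ε > 0, ∀ᶠ t : ℝ in atTop,
      ∫ x in (1 / 2 : ℝ)..3, |u (x + t * Complex.I)| ≤ ε * Real.log t) {ε : ℝ} (hε : 0 < ε) :
    ∀ᶠ t : ℝ in atTop, ∀ σ : ℝ, 1 / 2 ≤ σ →
      |tailIntegral u (σ + t * Complex.I)| ≤ ε * Real.log t := by
  obtain ⟨C, hC, hr⟩ := hu.right
  obtain ⟨C', hC', hline⟩ := hu.line
  filter_upwards [h (ε / 2) (half_pos hε), eventually_ge_atTop 4,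
    eventually_const_le_mul_log (2 * C) (half_pos hε)] with t h1 ht h2 σ hσ
  have hint : ∀ σ : ℝ, 1 / 2 ≤ σ →
      IntegrableOn (fun x : ℝ => u (x + t * Complex.I)) (Set.Ioi σ) := by
    intro σ hσ
    rw [← integrableOn_Ioi_shift]
    exact (hline (σ + t * Complex.I) ⟨by simpa using hσ, by simpa using ht⟩).1
  have hhalf := hint (1 / 2) le_rfl
  rw [tailIntegral, integral_Ioi_shift]
  calc |∫ α in Set.Ioi σ, u (α + t * Complex.I)|
      ≤ ∫ α in Set.Ioi σ, |u (α + t * Complex.I)| := abs_integral_le_integral_abs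
    _ ≤ ∫ α in Set.Ioi (1 / 2 : ℝ), |u (α + t * Complex.I)| :=
        setIntegral_mono_set hhalf.abs (Eventually.of_forall fun _ => abs_nonneg _)
          (Set.Ioi_subset_Ioi hσ).eventuallyLE
    _ = (∫ α in (1 / 2 : ℝ)..3, |u (α + t * Complex.I)|) +
          ∫ α in Set.Ioi (3 : ℝ), |u (α + t * Complex.I)| := by
        rw [intervalIntegral.integral_of_le (by norm_num),
          ← setIntegral_union (Set.Ioc_disjoint_Ioi le_rfl) measurableSet_Ioi
            (IntegrableOn.mono_set hhalf.abs Set.Ioc_subset_Ioi_self) (hint 3 (by norm_num)).abs,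
          Set.Ioc_union_Ioi_eq_Ioi (by norm_num)]
    _ ≤ ε / 2 * Real.log t + ε / 2 * Real.log t := by
        refine add_le_add h1 (le_trans ?_ h2)
        calc _ ≤ ∫ α in Set.Ioi (3 : ℝ), C * Real.exp (-α / 2) := by
              refine setIntegral_mono_on (hint 3 (by norm_num)).abs
                ((integrableOn_exp_neg_half 3).const_mul C) measurableSet_Ioi fun x hx => ?_
              have hx' : 3 < x := hx
              have := hr (x + t * Complex.I) ⟨by simp; linarith, by simpa using ht⟩
                (by simp; linarith)
              simpa using this
          _ = C * (2 * Real.exp (-3 / 2)) := by rw [integral_const_mul, integral_exp_neg_half]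
          _ ≤ C * (2 * 1) := by
              gcongr
              exact Real.exp_le_one_iff.2 (by norm_num)
          _ = 2 * C := by ring
    _ = ε * Real.log t := by ring

end TailAdmissible

/-- Only the first integration needs the analysis of zeros. Afterwards a two-sided pointwise bound
is available and is integrated over [1/2, 3]. -/
theorem LindelofHypothesis.eventually_abs_zetaLogIter_le (h : LindelofHypothesis) (m : ℕ) :
    ∀ ε > 0, ∀ᶠ t : ℝ in atTop, ∀ σ : ℝ, 1 / 2 ≤ σ →
      |zetaLogIter (m + 1) (σ + t * Complex.I)| ≤ ε * Real.log t := by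
  induction m with
  | zero =>
    intro ε hε
    exact tailAdmissible_log_norm_riemannZeta.eventually_abs_tailIntegral_le
      (fun ε hε => h.eventually_integral_abs_log_norm_le hε) hε
  | succ m ih =>
    intro ε hε
    refine (tailAdmissible_zetaLogIter_succ m).eventually_abs_tailIntegral_le (fun ε hε => ?_) hε
    filter_upwards [ih (ε / 3) (by positivity), eventually_ge_atTop 4] with t ht h4
    have hlog := one_le_log_of_four_le h4
    have h1 := intervalIntegral.norm_integral_le_of_norm_le_const
      (f := fun x : ℝ => |zetaLogIter (m + 1) (x + t * Complex.I)|) (a := 1 / 2) (b := 3)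
      (C := ε / 3 * Real.log t) fun x hx => by
        rw [Set.uIoc_of_le (by norm_num)] at hx
        rw [Real.norm_eq_abs, abs_abs]
        exact ht x hx.1.le
    refine (le_abs_self _).trans (h1.trans ?_)
    rw [abs_of_nonneg (by norm_num)]
    nlinarith

/-! ### From a small tail back to its integrand -/

open Metric in
theorem setIntegral_ball_add (f : ℂ → ℝ) (p c : ℂ) (r : ℝ) :
    ∫ w in ball (0 : ℂ) r, f (p + w) = ∫ w in ball (p - c) r, f (c + w) := by
  have h := (measurePreserving_add_left (volume : Measure ℂ) (p - c)).setIntegral_preimage_emb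
    (Homeomorph.addLeft (p - c)).measurableEmbedding (fun w => f (c + w)) (ball (p - c) r)
  rw [← h]
  have h1 : (fun w : ℂ => p - c + w) ⁻¹' ball (p - c) r = ball 0 r := by
    ext w
    simp [dist_eq_norm]
  rw [h1]
  refine integral_congr_ae (Eventually.of_forall fun w => ?_)
  simp only
  congr 1
  ring

namespace TailAdmissible

variable {u : ℂ → ℝ} {Z : Set ℂ}

theorem eventually_abs_le_right (hu : TailAdmissible u Z) {ε : ℝ} (hε : 0 < ε) :
    ∀ᶠ t : ℝ in atTop, ∀ σ : ℝ, 3 ≤ σ → |u (σ + t * Complex.I)| ≤ ε * Real.log t := by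
  obtain ⟨C, hC, h⟩ := hu.right
  filter_upwards [eventually_ge_atTop 4, eventually_const_le_mul_log C hε] with t ht h1 σ hσ
  refine (h (σ + t * Complex.I) ⟨by simp; linarith, by simpa using ht⟩ (by simpa using hσ)).trans
    (le_trans ?_ h1)
  refine mul_le_of_le_one_right hC (Real.exp_le_one_iff.2 ?_)
  simp
  linarith

/-- An upper bound on the critical line propagates to the right of it. -/
theorem eventually_le_of_critical_line (hu : TailAdmissible u ∅)
    (h : ∀ ε > 0, ∀ᶠ t : ℝ in atTop, u (1 / 2 + t * Complex.I) ≤ ε * Real.log t) {ε : ℝ}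
    (hε : 0 < ε) :
    ∀ᶠ t : ℝ in atTop, ∀ σ : ℝ, 1 / 2 ≤ σ → u (σ + t * Complex.I) ≤ ε * Real.log t := by
  obtain ⟨C, hC, hup⟩ := hu.upper
  have hsub : {s : ℂ | ((1 / 2 : ℝ) ≤ s.re ∧ s.re ≤ 3) ∧ 4 ≤ s.im} ⊆ rightQuadrant :=
    fun s hs => ⟨hs.1.1, hs.2⟩
  have key := eventually_le_of_submean_strip (u := u) (a := 1 / 2) (b := 3) (C := C) (D := 0)
    (by norm_num) (by norm_num) hC le_rfl
    (fun s hs => (hu.usc s (hsub hs) (Set.notMem_empty s)).mono hsub)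
    (fun p => Or.inr fun r hr hp => ⟨(hu.submean p r hr (hp.trans hsub)).1,
      (hu.submean p r hr (hp.trans hsub)).2 (Set.notMem_empty p)⟩) ?_ ?_ ?_ hε
  · filter_upwards [key, hu.eventually_abs_le_right hε] with t h1 h2 σ hσ
    rcases le_or_gt 3 σ with h3 | h3
    · exact (le_abs_self _).trans (h2 σ h3)
    · simpa using h1 σ hσ h3.le
  · intro s h1 h2 h3
    have hlog := one_le_log_of_four_le h3
    refine (hup s ⟨h1, h3⟩).trans ?_
    exact mul_le_of_le_one_right (by positivity) (Real.exp_le_one_iff.2 (by linarith))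
  · intro ε hε
    simpa using h ε hε
  · intro ε hε
    filter_upwards [hu.eventually_abs_le_right hε] with t ht
    exact (le_abs_self _).trans (ht 3 le_rfl)

open Metric in
/-- An upper bound for a tail integral gives one for the integrand, slightly to the right. -/
theorem eventually_le_of_tailIntegral (hu : TailAdmissible u Z) (hZ : ∀ s ∈ Z, u s ≤ 0)
    (h : ∀ δ > 0, ∀ ε > 0, ∀ᶠ t : ℝ in atTop, ∀ σ : ℝ, 1 / 2 + δ ≤ σ →
      tailIntegral u (σ + t * Complex.I) ≤ ε * Real.log t) {δ ε : ℝ} (hδ : 0 < δ) (hε : 0 < ε) :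
    ∀ᶠ t : ℝ in atTop, ∀ σ : ℝ, 1 / 2 + δ ≤ σ → u (σ + t * Complex.I) ≤ ε * Real.log t := by
  wlog hδ1 : δ ≤ 1 generalizing δ
  · filter_upwards [this one_pos le_rfl] with t ht σ hσ
    exact ht σ (by linarith)
  obtain ⟨C, hC, hCle⟩ := exists_le_mul_integral_abs_tail (r := δ / 4) (by positivity)
  obtain ⟨D, hD, hDle⟩ := hu.tail.right
  -- The large disc about 3 + it stays in Re s ≥ 1/2 + δ/2, where the hypothesis on the tail holds,
  -- and contains the disc of radius δ/4 about every p with 1/2 + δ ≤ σ < 3.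
  set R : ℝ := 5 / 2 - δ / 2 with hR
  set V := volume.real (ball (0 : ℂ) R) with hV
  have hV0 : 0 ≤ V := measureReal_nonneg
  set ε' := ε / (8 * (C * V + 1)) with hε'
  have hε'0 : 0 < ε' := by positivity
  obtain ⟨T₀, hT₀⟩ := eventually_atTop.1 (h (δ / 2) (by positivity) ε' hε'0)
  filter_upwards [eventually_ge_atTop 8, eventually_ge_atTop (T₀ + 5 / 2),
    eventually_const_le_mul_log (C * V * D) (half_pos hε), hu.eventually_abs_le_right hε]
    with t ht hT h1 h2 σ hσ
  rcases le_or_gt 3 σ with h3 | h3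
  · exact (le_abs_self _).trans (h2 σ h3)
  have hlog := one_le_log_of_four_le (t := t) (by linarith)
  set p : ℂ := σ + t * Complex.I with hp
  by_cases hpZ : p ∈ Z
  · exact (hZ p hpZ).trans (by positivity)
  set c : ℂ := 3 + t * Complex.I with hc
  have hpc : ‖p - c‖ = 3 - σ := by
    rw [hp, hc, show (σ + t * Complex.I - (3 + t * Complex.I) : ℂ) = ((σ - 3 : ℝ) : ℂ) by
      push_cast; ring, Complex.norm_real, Real.norm_eq_abs, abs_sub_comm,
      abs_of_pos (by linarith)]
  have hbig : closedBall c R ⊆ rightQuadrant := by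
    intro z hz
    obtain ⟨h5, h6⟩ := bounds_of_mem_closedBall hz
    rw [abs_le] at h5 h6
    exact ⟨by linarith, by linarith⟩
  have hsub : ball (p - c) (δ / 4) ⊆ ball 0 R := by
    refine ball_subset_ball' ?_
    rw [dist_zero_right, hpc]
    linarith
  have hsmall : closedBall p (δ / 4) ⊆ rightQuadrant := by
    refine (closedBall_subset_closedBall' ?_).trans hbig
    rw [dist_eq_norm, hpc]
    linarith
  have hmain := hCle u Z hu p hpZ hsmall
  have hEball : ∀ w ∈ ball (0 : ℂ) R, tailIntegral u (c + w) ≤ 2 * ε' * Real.log t := by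
    intro w hw
    have h7 : c + w ∈ closedBall c R := by
      simpa using (mem_ball_zero_iff.1 hw).le
    obtain ⟨h5, h6⟩ := bounds_of_mem_closedBall h7
    rw [abs_le] at h5 h6
    have h8 := hT₀ (c + w).im (by linarith) (c + w).re (by linarith)
    rw [Complex.re_add_im] at h8
    have h9 := log_le_two_mul_log (t := t) (y := (c + w).im) (by linarith) (by linarith)
      (by linarith)
    nlinarith
  -- At the centre the tail is bounded by a constant, which turns the one-sided bound into control
  -- of the L¹ norm.
  have hball := hu.tail.integral_abs_ball_le (p := c) (r := R) (by linarith) hbig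
    (by positivity) hEball
  have hcD : -tailIntegral u c ≤ D := by
    refine (neg_le_abs _).trans ((hDle c ⟨by simp [hc]; norm_num, by simp [hc]; linarith⟩
      (by simp [hc])).trans ?_)
    refine mul_le_of_le_one_right hD (Real.exp_le_one_iff.2 ?_)
    simp [hc]
    norm_num
  have hmono : ∫ w in ball (0 : ℂ) (δ / 4), |tailIntegral u (p + w)| ≤
      ∫ w in ball (0 : ℂ) R, |tailIntegral u (c + w)| := by
    rw [setIntegral_ball_add (fun z => |tailIntegral u z|) p c]
    exact setIntegral_mono_set (hu.tail.integrableOn_ball (by linarith) hbig).abs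
      (Eventually.of_forall fun _ => abs_nonneg _) hsub.eventuallyLE
  have hCV : 0 ≤ C * V := by positivity
  calc u p ≤ C * ∫ w in ball (0 : ℂ) (δ / 4), |tailIntegral u (p + w)| := hmain
    _ ≤ C * ((2 * (2 * ε' * Real.log t) - tailIntegral u c) * V) := by
        gcongr
        exact hmono.trans hball
    _ ≤ C * ((2 * (2 * ε' * Real.log t) + D) * V) := by
        gcongr
        linarith
    _ = 4 * ((C * V) * ε') * Real.log t + C * V * D := by ring
    _ ≤ 4 * (ε / 8) * Real.log t + ε / 2 * Real.log t := by
        have h10 : (C * V) * ε' ≤ ε / 8 := by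
          rw [hε', mul_div_assoc', div_le_iff₀ (by positivity)]
          nlinarith
        gcongr
    _ = ε * Real.log t := by ring

end TailAdmissible

/-- The maximum principle leaves the critical line once, at the top iterate. Each descent then costs
an arbitrarily small shift to the right, hence the quantification over all δ. -/
theorem eventually_log_norm_le_of_zetaLogIter {m : ℕ}
    (h : ∀ ε > 0, ∀ᶠ t : ℝ in atTop, zetaLogIter (m + 1) (1 / 2 + t * Complex.I) ≤ ε * Real.log t)
    {δ ε : ℝ} (hδ : 0 < δ) (hε : 0 < ε) :
    ∀ᶠ t : ℝ in atTop, ∀ σ : ℝ, 1 / 2 + δ ≤ σ →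
      Real.log ‖riemannZeta (σ + t * Complex.I)‖ ≤ ε * Real.log t := by
  have hdown : ∀ k : ℕ, (∀ δ > 0, ∀ ε > 0, ∀ᶠ t : ℝ in atTop, ∀ σ : ℝ, 1 / 2 + δ ≤ σ →
      zetaLogIter (k + 1) (σ + t * Complex.I) ≤ ε * Real.log t) →
      ∀ δ > 0, ∀ ε > 0, ∀ᶠ t : ℝ in atTop, ∀ σ : ℝ, 1 / 2 + δ ≤ σ →
        Real.log ‖riemannZeta (σ + t * Complex.I)‖ ≤ ε * Real.log t := by
    intro k
    induction k with
    | zero =>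
      intro hk δ hδ ε hε
      refine tailAdmissible_log_norm_riemannZeta.eventually_le_of_tailIntegral ?_ hk hδ hε
      intro s hs
      rw [mem_riemannZetaZeros.1 hs]
      simp
    | succ k ih =>
      intro hk
      refine ih fun δ hδ ε hε => ?_
      exact (tailAdmissible_zetaLogIter_succ k).eventually_le_of_tailIntegral (by simp) hk hδ hε
  refine hdown m (fun δ hδ ε hε => ?_) δ hδ ε hε
  filter_upwards [(tailAdmissible_zetaLogIter_succ m).eventually_le_of_critical_line h hε]
    with t ht σ hσ
  exact ht σ (by linarith)

/-! ### Recovering the Lindelöf Hypothesis on the critical line -/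

theorem norm_riemannZeta_le_im {s : ℂ} (h1 : 1 / 4 ≤ s.re) (h3 : 4 ≤ s.im) :
    ‖riemannZeta s‖ ≤ 5 * (s.re + s.im) := by
  refine (norm_riemannZeta_le h1 (by linarith)).trans ?_
  have := Complex.norm_le_abs_re_add_abs_im s
  rw [abs_of_nonneg (by linarith), abs_of_nonneg (by linarith)] at this
  linarith

theorem posLog_le_natCast_mul_log {x t : ℝ} {n : ℕ} (hx : 0 ≤ x) (ht : 1 ≤ t) (h : x ≤ t ^ n) :
    Real.posLog x ≤ n * Real.log t := by
  refine (Real.posLog_le_posLog hx h).trans ?_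
  rw [Real.posLog_pow, Real.posLog_eq_log (by rwa [abs_of_nonneg (by linarith)])]

/-- Smallness of `log ‖ζ‖` to the right of the critical line implies the Lindelöf Hypothesis. -/
theorem lindelofHypothesis_of_eventually_log_norm_le
    (h : ∀ δ > 0, ∀ ε > 0, ∀ᶠ t : ℝ in atTop, ∀ σ : ℝ, 1 / 2 + δ ≤ σ →
      Real.log ‖riemannZeta (σ + t * Complex.I)‖ ≤ ε * Real.log t) : LindelofHypothesis := by
  intro ε hε
  -- Interpolation at σ = 1/2 gives the exponent 2δ / (1/4 + δ) ≤ 8δ ≤ ε/2.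
  set δ := min 1 (ε / 16) with hδ
  have hδ0 : 0 < δ := lt_min one_pos (by positivity)
  have hδ1 : δ ≤ 1 := min_le_left _ _
  have hδε : δ ≤ ε / 16 := min_le_right _ _
  -- D = 2 because |ζ(1/4 + it)| ≤ t² for t ≥ 6; C = 3 because |ζ| ≤ t³ throughout the strip.
  have key := eventually_le_of_submean_strip (u := fun s => Real.posLog ‖riemannZeta s‖)
    (a := 1 / 4) (b := 1 / 2 + δ) (C := 3) (D := 2) (by linarith) (by linarith) (by norm_num)
    (by norm_num) ?_ ?_ ?_ ?_ ?_ (half_pos hε)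
  · refine IsBigO.of_bound 1 ?_
    filter_upwards [key, eventually_ge_atTop 4] with t h1 ht
    have hlog := one_le_log_of_four_le ht
    have h2 := h1 (1 / 2) (by norm_num) (by linarith)
    have h3 : 2 * (1 / 2 + δ - 1 / 2) / (1 / 2 + δ - 1 / 4) ≤ ε / 2 := by
      rw [div_le_iff₀ (by linarith)]
      nlinarith
    have h4 : Real.log ‖riemannZeta (1 / 2 + t * Complex.I)‖ ≤ ε * Real.log t := by
      rw [← posLog_le_iff (by positivity)]
      push_cast at h2
      refine h2.trans ?_
      gcongr
      linarith
    rw [Real.norm_of_nonneg (by positivity), one_mul]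
    by_cases h0 : riemannZeta (1 / 2 + t * Complex.I) = 0
    · rw [h0, norm_zero]
      positivity
    rwa [Real.log_le_iff_le_exp (norm_pos_iff.2 h0), mul_comm ε,
      ← Real.rpow_def_of_pos (by linarith)] at h4
  · exact (continuousOn_posLog_norm_riemannZeta fun s hs => hs.2).upperSemicontinuousOn
  · intro p
    rcases posLog_norm_riemannZeta_le_circleAverage p with h1 | h1
    · exact Or.inl h1
    · exact Or.inr fun r hr hp => h1 r hr (hp.trans fun s hs => hs.2)
  · intro s h1 h2 h3
    refine posLog_le_natCast_mul_log (n := 3) (norm_nonneg _) (by linarith)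
      ((norm_riemannZeta_le_im h1 h3).trans ?_)
    nlinarith [mul_self_nonneg (s.im - 4), mul_nonneg (by linarith : 0 ≤ s.im - 4) (mul_self_nonneg s.im)]
  · intro ε hε
    filter_upwards [eventually_ge_atTop 6] with t ht
    have hlog := one_le_log_of_four_le (t := t) (by linarith)
    have h1 := norm_riemannZeta_le_im (s := (1 / 4 : ℝ) + t * Complex.I) (by simp)
      (by simp; linarith)
    have h2 := posLog_le_natCast_mul_log (n := 2) (t := t) (norm_nonneg _) (by linarith)
      (h1.trans (by simp; nlinarith))
    push_cast at h2 ⊢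
    nlinarith
  · intro ε hε
    filter_upwards [h δ hδ0 ε hε, eventually_ge_atTop 4] with t h1 ht
    have hlog := one_le_log_of_four_le ht
    rw [posLog_le_iff (by positivity)]
    exact h1 (1 / 2 + δ) le_rfl

theorem lindelofHypothesis_iff_zetaLogIter (m : ℕ) :
    LindelofHypothesis ↔
      (fun t : ℝ => zetaLogIter (m + 1) (1 / 2 + t * Complex.I)) =o[atTop] fun t => Real.log t := by
  rw [isLittleO_iff]
  constructor
  · intro h ε hε
    filter_upwards [h.eventually_abs_zetaLogIter_le m ε hε, eventually_ge_atTop 4] with t h1 ht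
    have hlog := one_le_log_of_four_le ht
    rw [Real.norm_of_nonneg (by linarith : 0 ≤ Real.log t)]
    simpa using h1 (1 / 2) le_rfl
  · intro h
    refine lindelofHypothesis_of_eventually_log_norm_le fun δ hδ ε hε =>
      eventually_log_norm_le_of_zetaLogIter (m := m) (fun ε hε => ?_) hδ hε
    filter_upwards [h hε, eventually_ge_atTop 4] with t h1 ht
    have hlog := one_le_log_of_four_le ht
    rw [Real.norm_of_nonneg (by linarith : 0 ≤ Real.log t)] at h1
    exact (le_abs_self _).trans h1

/-! ### The branch of log ζ on horizontal lines -/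

theorem IsPreconnected.sub_eq_sub_of_exp_eq {X : Type*} [TopologicalSpace X] {S : Set X}
    (hS : IsPreconnected S) {f g : X → ℂ} (hf : ContinuousOn f S) (hg : ContinuousOn g S)
    (h : ∀ x ∈ S, Complex.exp (f x) = Complex.exp (g x)) {x y : X} (hx : x ∈ S) (hy : y ∈ S) :
    f x - g x = f y - g y := by
  have h1 : ∀ x ∈ S, Complex.exp (f x - g x) = 1 := fun x hx => by
    rw [Complex.exp_sub, h x hx, div_self (Complex.exp_ne_zero _)]
  exact Complex.isCoveringMap_exp.constOn_of_comp hS (hf.sub hg)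
    (fun a ha b hb => Subtype.ext ((h1 a ha).trans (h1 b hb).symm)) hx hy

theorem riemannZeta_ne_zero_of_not_isZetaOrdinate {t : ℝ} (ht : t ≠ 0) (h : ¬ IsZetaOrdinate t)
    (σ : ℝ) : riemannZeta (σ + t * Complex.I) ≠ 0 := by
  intro h0
  refine h ⟨σ + t * Complex.I, ⟨h0, ?_⟩, by simp⟩
  rintro ⟨n, hn⟩
  have := congrArg Complex.im hn
  simp at this
  exact ht this

theorem continuous_riemannZeta_line {t : ℝ} (ht : t ≠ 0) :
    Continuous fun σ : ℝ => riemannZeta (σ + t * Complex.I) := by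
  rw [continuous_iff_continuousAt]
  intro σ
  have h1 : (σ + t * Complex.I : ℂ) ≠ 1 := by
    intro h
    have := congrArg Complex.im h
    simp at this
    exact ht this
  exact ContinuousAt.comp (f := fun σ : ℝ => (σ + t * Complex.I : ℂ))
    (differentiableAt_riemannZeta h1).continuousAt (by fun_prop)

theorem continuousOn_log_riemannZeta_line {t : ℝ} (ht : t ≠ 0) :
    ContinuousOn (fun σ : ℝ => Complex.log (riemannZeta (σ + t * Complex.I))) (Set.Ici 3) :=
  (continuous_riemannZeta_line ht).continuousOn.clog fun σ hσ =>
    riemannZeta_mem_slitPlane (by simpa using hσ)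

theorem tendsto_log_riemannZeta_line (t : ℝ) :
    Tendsto (fun σ : ℝ => Complex.log (riemannZeta (σ + t * Complex.I))) atTop (𝓝 0) := by
  refine squeeze_zero_norm' (a := fun σ : ℝ => 6 * Real.exp (-σ / 2)) ?_ ?_
  · filter_upwards [eventually_ge_atTop 3] with σ hσ
    simpa using norm_log_riemannZeta_le (s := σ + t * Complex.I) (by simpa using hσ)
  · have h1 : Tendsto (fun σ : ℝ => σ / 2) atTop atTop := tendsto_id.atTop_div_const (by norm_num)
    have h2 := (Real.tendsto_exp_neg_atTop_nhds_zero.comp h1).const_mul 6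
    simpa [Function.comp_def, neg_div] using h2

/-- The zero-free curve σ ↦ ζ(σ + it) lifts through exp since the line is simply connected. For σ ≥
3 the lift differs from the principal logarithm by a constant period, which is subtracted. -/
theorem exists_isLogZetaBranch {t : ℝ} (ht : t ≠ 0) (h : ¬ IsZetaOrdinate t) :
    ∃ f, IsLogZetaBranch t f ∧
      ∀ σ : ℝ, 3 ≤ σ → f σ = Complex.log (riemannZeta (σ + t * Complex.I)) := by
  have hsc : IsSimplyConnected (Set.univ : Set ℝ) := by
    have := convex_univ (𝕜 := ℝ) (E := ℝ) |>.contractibleSpace Set.univ_nonempty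
    exact SimplyConnectedSpace.ofContractible _
  have hne := riemannZeta_ne_zero_of_not_isZetaOrdinate ht h
  obtain ⟨g, hgc, hg⟩ := Complex.exists_continuousOn_eqOn_exp_comp hsc isOpen_univ
    (continuous_riemannZeta_line ht).continuousOn (by rintro ⟨σ, -, h0⟩; exact hne σ h0)
  have hgc' : Continuous g := continuousOn_univ.1 hgc
  have hg' : ∀ σ : ℝ, Complex.exp (g σ) = riemannZeta (σ + t * Complex.I) :=
    fun σ => hg (Set.mem_univ σ)
  have hdiff : ∀ σ : ℝ, 3 ≤ σ → g σ - Complex.log (riemannZeta (σ + t * Complex.I)) =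
      g 3 - Complex.log (riemannZeta ((3 : ℝ) + t * Complex.I)) := by
    intro σ hσ
    refine (isPreconnected_Ici (a := (3 : ℝ))).sub_eq_sub_of_exp_eq hgc'.continuousOn
      (continuousOn_log_riemannZeta_line ht) (fun x _ => ?_) hσ Set.self_mem_Ici
    rw [hg', Complex.exp_log (hne x)]
  set k := g 3 - Complex.log (riemannZeta ((3 : ℝ) + t * Complex.I)) with hk
  have hk1 : Complex.exp k = 1 := by
    rw [hk, Complex.exp_sub, hg', Complex.exp_log (hne 3), div_self (hne 3)]
  have heq : ∀ σ : ℝ, 3 ≤ σ → g σ - k = Complex.log (riemannZeta (σ + t * Complex.I)) := by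
    intro σ hσ
    rw [← hdiff σ hσ]
    ring
  refine ⟨fun σ => g σ - k, ⟨by fun_prop, fun σ => ?_, ?_⟩, heq⟩
  · rw [Complex.exp_sub, hg', hk1, div_one]
  · refine (tendsto_log_riemannZeta_line t).congr' ?_
    filter_upwards [eventually_ge_atTop 3] with σ hσ
    exact (heq σ hσ).symm

theorem isLogZetaBranch_logZetaRegular {t : ℝ} (ht : t ≠ 0) (h : ¬ IsZetaOrdinate t) :
    IsLogZetaBranch t (fun σ => logZetaRegular σ t) := by
  obtain ⟨f, hf, -⟩ := exists_isLogZetaBranch ht h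
  have hex : ∃ f, IsLogZetaBranch t f := ⟨f, hf⟩
  have : (fun σ => logZetaRegular σ t) = hex.choose := by
    ext σ
    rw [logZetaRegular, dif_pos hex]
  rw [this]
  exact hex.choose_spec

theorem logZetaRegular_eq_log {t σ : ℝ} (ht : t ≠ 0) (h : ¬ IsZetaOrdinate t) (hσ : 3 ≤ σ) :
    logZetaRegular σ t = Complex.log (riemannZeta (σ + t * Complex.I)) := by
  obtain ⟨f, hf, hlog⟩ := exists_isLogZetaBranch ht h
  have := (isLogZetaBranch_logZetaRegular ht h).unique hf
  rw [← hlog σ hσ, ← this]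

/-- At heights without a branch the default value 0 is continuous too, so limits over heights are
measurable with no exception. -/
theorem continuous_logZetaRegular (t : ℝ) : Continuous fun σ => logZetaRegular σ t := by
  by_cases h : ∃ f, IsLogZetaBranch t f
  · have : (fun σ => logZetaRegular σ t) = h.choose := by
      ext σ
      rw [logZetaRegular, dif_pos h]
    rw [this]
    exact h.choose_spec.continuous
  · have : (fun σ => logZetaRegular σ t) = fun _ => 0 := by
      ext σ
      rw [logZetaRegular, dif_neg h]
    rw [this]
    exact continuous_const

theorem IsZetaOrdinate.exists_mem_zeros {t : ℝ} (ht : t ≠ 0) (h : IsZetaOrdinate t) :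
    ∃ ρ ∈ riemannZetaZeros, ρ.im = t ∧ 0 ≤ ρ.re ∧ ρ.re ≤ 1 := by
  obtain ⟨ρ, hρ, hρt⟩ := h
  refine ⟨ρ, hρ.1, hρt, ?_⟩
  by_contra hcon
  refine riemannZeta_ne_zero_of_im_ne_zero (s := ρ) (by rwa [hρt]) ?_ hρ.1
  by_contra h2
  push Not at h2
  exact hcon ⟨h2.1.le, h2.2.le⟩

/-- Zeros with ordinate in (0, γ) lie in the compact rectangle [0, 1] × [0, γ], hence are finite in
number. -/
theorem eventually_not_isZetaOrdinate {γ : ℝ} (hγ : 0 < γ) :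
    ∀ᶠ t in 𝓝[<] γ, ¬ IsZetaOrdinate t := by
  have hK : IsCompact (Set.Icc (0 : ℝ) 1 ×ℂ Set.Icc 0 γ) := isCompact_Icc.reProdIm isCompact_Icc
  have h1 : ∀ᶠ t in 𝓝[<] γ, ∀ ρ ∈ (Set.Icc (0 : ℝ) 1 ×ℂ Set.Icc 0 γ) ∩ riemannZetaZeros,
      ρ.im < γ → ρ.im < t := by
    rw [eventually_all_finite hK.inter_riemannZetaZeros_finite]
    intro ρ _
    by_cases h : ρ.im < γ
    · filter_upwards [Ioo_mem_nhdsLT h] with t ht _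
      exact ht.1
    · exact Eventually.of_forall fun t h' => absurd h' h
  filter_upwards [h1, Ioo_mem_nhdsLT hγ] with t ht ht2 hord
  obtain ⟨ρ, hρ, hρt, hre⟩ := hord.exists_mem_zeros ht2.1.ne'
  have := ht ρ ⟨Complex.mem_reProdIm.2 ⟨hre, by rw [hρt]; exact ⟨ht2.1.le, ht2.2.le⟩⟩, hρ⟩
    (by rw [hρt]; exact ht2.2)
  linarith

/-- A logarithm of `z - u`, continuous in `z` on a neighbourhood of the part of the line
`Im z = γ` where `z ≠ u`, and below that line as long as `Im u` is not met. -/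
noncomputable def logSubBelow (γ : ℝ) (u z : ℂ) : ℂ :=
  if γ ≤ u.im then Complex.log (Complex.I * (z - u)) - (Real.pi / 2 : ℝ) * Complex.I
  else Complex.log (-Complex.I * (z - u)) + (Real.pi / 2 : ℝ) * Complex.I

theorem exp_logSubBelow {γ : ℝ} {u z : ℂ} (h : z ≠ u) :
    Complex.exp (logSubBelow γ u z) = z - u := by
  have h0 : z - u ≠ 0 := sub_ne_zero.2 h
  have hpi : Complex.exp ((Real.pi / 2 : ℝ) * Complex.I) = Complex.I := by
    push_cast
    exact Complex.exp_pi_div_two_mul_I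
  rw [logSubBelow]
  split_ifs
  · rw [Complex.exp_sub, Complex.exp_log (mul_ne_zero Complex.I_ne_zero h0), hpi,
      mul_div_cancel_left₀ _ Complex.I_ne_zero]
  · rw [Complex.exp_add, Complex.exp_log (mul_ne_zero (neg_ne_zero.2 Complex.I_ne_zero) h0), hpi]
    linear_combination (u - z) * Complex.I_mul_I

/-- The cut runs vertically upwards from `u` when `u` is at or above the line, and downwards when it
is below. Neither cut meets the points considered. -/
theorem continuousAt_logSubBelow {γ : ℝ} {u z : ℂ} (h : z ≠ u) (hz : z.im ≤ γ)
    (hu : u.im < γ → u.im < z.im) : ContinuousAt (logSubBelow γ u) z := by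
  have hre : z.im = u.im → z.re - u.re ≠ 0 := fun him hre =>
    h (Complex.ext (sub_eq_zero.1 hre) him)
  by_cases hγ : γ ≤ u.im
  · have : logSubBelow γ u = fun z => Complex.log (Complex.I * (z - u)) -
        (Real.pi / 2 : ℝ) * Complex.I := by
      ext z
      rw [logSubBelow, if_pos hγ]
    rw [this]
    refine ContinuousAt.sub (ContinuousAt.clog (by fun_prop) ?_) continuousAt_const
    rw [Complex.mem_slitPlane_iff]
    rcases (hz.trans hγ).lt_or_eq with h1 | h1
    · left
      simpa using h1
    · right
      simpa using hre h1
  · have : logSubBelow γ u = fun z => Complex.log (-Complex.I * (z - u)) +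
        (Real.pi / 2 : ℝ) * Complex.I := by
      ext z
      rw [logSubBelow, if_neg hγ]
    rw [this]
    refine ContinuousAt.add (ContinuousAt.clog (by fun_prop) ?_) continuousAt_const
    rw [Complex.mem_slitPlane_iff]
    left
    simpa using hu (not_le.1 hγ)

theorem abs_im_logSubBelow_le (γ : ℝ) (u z : ℂ) : |(logSubBelow γ u z).im| ≤ 2 * Real.pi := by
  have h1 := Complex.abs_arg_le_pi (Complex.I * (z - u))
  have h2 := Complex.abs_arg_le_pi (-Complex.I * (z - u))
  rw [logSubBelow]
  rw [abs_le] at h1 h2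
  split_ifs
  · rw [Complex.sub_im, Complex.log_im, Complex.im_ofReal_mul, Complex.I_im, abs_le]
    constructor <;> linarith [h1.1, h1.2]
  · rw [Complex.add_im, Complex.log_im, Complex.im_ofReal_mul, Complex.I_im, abs_le]
    constructor <;> linarith [h2.1, h2.2]

open Metric in
/-- Just below and on a horizontal line, `ζ` has a logarithm which is continuous away from the
zeros and has bounded imaginary part on the line. -/
theorem exists_log_riemannZeta_below {γ : ℝ} (hγ : 4 ≤ γ) :
    ∃ (H : ℂ → ℂ) (B y : ℝ), y < γ ∧
      (∀ z : ℂ, 1 / 2 ≤ z.re → z.re ≤ 3 → y < z.im → z.im ≤ γ → riemannZeta z ≠ 0 →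
        ContinuousAt H z ∧ Complex.exp (H z) = riemannZeta z) ∧
      ∀ σ : ℝ, 1 / 2 ≤ σ → σ ≤ 3 → |(H (σ + γ * Complex.I)).im| ≤ B := by
  set c : ℂ := 3 + γ * Complex.I with hc
  have han := analyticOnNhd_riemannZeta_closedBall hγ (le_refl (11 / 4))
  have hc0 : riemannZeta c ≠ 0 := by
    rw [← norm_pos_iff]
    linarith [half_le_norm_riemannZeta (s := c) (by simp [hc])]
  obtain ⟨S, g, hg, hg0, -, hprod⟩ := han.exists_eq_prod_mul (by norm_num) hc0
  set k : ℂ → ℕ := fun u =>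
    (MeromorphicOn.divisor riemannZeta (closedBall c (11 / 4)) u).toNat with hk
  have hgd : DifferentiableOn ℂ g (ball c (11 / 4)) := fun z hz =>
    (hg z (ball_subset_closedBall hz)).differentiableAt.differentiableWithinAt
  obtain ⟨h, hh, hexp⟩ := hgd.exists_log_ball (by norm_num)
    fun z hz => hg0 z (ball_subset_closedBall hz)
  have hball : ∀ z : ℂ, 1 / 2 ≤ z.re → z.re ≤ 3 → γ - 1 ≤ z.im → z.im ≤ γ →
      z ∈ ball c (11 / 4) := by
    intro z h1 h2 h3 h4
    rw [mem_ball, dist_eq_norm, ← pow_lt_pow_iff_left₀ (norm_nonneg _) (by norm_num) two_ne_zero,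
      ← Complex.normSq_eq_norm_sq, Complex.normSq_apply]
    simp [hc]
    nlinarith
  -- There are finitely many zeros in the disc, so a thin strip below height γ has none of them in
  -- its interior.
  have hy : ∀ᶠ y in 𝓝[<] γ, ∀ u ∈ (S : Set ℂ), u.im < γ → u.im < y := by
    rw [eventually_all_finite S.finite_toSet]
    intro u _
    by_cases hu : u.im < γ
    · filter_upwards [Ioo_mem_nhdsLT hu] with y hy _
      exact hy.1
    · exact Eventually.of_forall fun y h' => absurd h' hu
  obtain ⟨y, hyS, hyγ⟩ := (hy.and (Ioo_mem_nhdsLT (by linarith : γ - 1 < γ))).exists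
  have hline : ∀ σ ∈ Set.Icc (1 / 2 : ℝ) 3, (σ + γ * Complex.I : ℂ) ∈ ball c (11 / 4) :=
    fun σ hσ => hball _ (by simpa using hσ.1) (by simpa using hσ.2) (by simp) (by simp)
  obtain ⟨Bh, hBh⟩ : ∃ Bh, ∀ σ ∈ Set.Icc (1 / 2 : ℝ) 3, ‖h (σ + γ * Complex.I)‖ ≤ Bh := by
    refine isCompact_Icc.exists_bound_of_continuousOn ?_
    exact hh.continuousOn.comp (Continuous.continuousOn (by fun_prop)) hline
  -- The logarithm is assembled from the factorisation of ζ: one cut logarithm per zero, plus a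
  -- holomorphic logarithm of the zero-free factor. Each cut logarithm has imaginary part at most
  -- 2π, so the total stays bounded even beside zeros on the line.
  refine ⟨fun z => (∑ u ∈ S, (k u : ℂ) * logSubBelow γ u z) + h z,
    (∑ u ∈ S, (k u : ℝ) * (2 * Real.pi)) + Bh, y, hyγ.2, ?_, ?_⟩
  · intro z h1 h2 h3 h4 h0
    have hz := hball z h1 h2 (by linarith [hyγ.1]) h4
    have hzc := ball_subset_closedBall hz
    have hne : ∀ u ∈ S, k u ≠ 0 → z ≠ u := by
      rintro u hu hku rfl
      refine h0 ?_
      rw [hprod z hzc, Finset.prod_eq_zero hu, zero_mul]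
      rw [sub_self]
      exact zero_pow hku
    constructor
    · refine ContinuousAt.add (tendsto_finsetSum _ fun u hu => ?_)
        (hh.continuousOn.continuousAt (isOpen_ball.mem_nhds hz))
      by_cases hku : k u = 0
      · simp [hku]
      · exact ContinuousAt.mul continuousAt_const (continuousAt_logSubBelow (hne u hu hku) h4
          fun hu' => (hyS u hu hu').trans h3)
    · rw [Complex.exp_add, Complex.exp_sum, hexp z hz, hprod z hzc]
      congr 1
      refine Finset.prod_congr rfl fun u hu => ?_
      rw [Complex.exp_nat_mul]
      by_cases hku : k u = 0
      · have hku' : (MeromorphicOn.divisor riemannZeta (closedBall c (11 / 4)) u).toNat = 0 := hku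
        rw [hku, hku', pow_zero, pow_zero]
      · rw [exp_logSubBelow (hne u hu hku)]
  · intro σ h1 h2
    rw [Complex.add_im, Complex.im_sum]
    refine (abs_add_le _ _).trans (add_le_add ((Finset.abs_sum_le_sum_abs _ _).trans ?_)
      ((Complex.abs_im_le_norm _).trans (hBh σ ⟨h1, h2⟩)))
    refine Finset.sum_le_sum fun u _ => ?_
    rw [← Complex.ofReal_natCast, Complex.im_ofReal_mul, abs_mul, Nat.abs_cast]
    gcongr
    exact abs_im_logSubBelow_le γ u _

theorem riemannZeta_ne_zero_of_three_le {s : ℂ} (hs : 3 ≤ s.re) : riemannZeta s ≠ 0 :=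
  Complex.slitPlane_ne_zero (riemannZeta_mem_slitPlane hs)

/-- Two continuous logarithms on the same segment differ by a constant, read off at σ = 3 where the
branch is the principal logarithm. The point is that `H` is the same for all heights just below γ.
-/
theorem exists_logZetaRegular_eq_of_le {γ : ℝ} (hγ : 4 ≤ γ) :
    ∃ (H : ℂ → ℂ) (B y : ℝ), y < γ ∧
      (∀ σ : ℝ, 1 / 2 ≤ σ → σ ≤ 3 → riemannZeta (σ + γ * Complex.I) ≠ 0 →
        ContinuousAt H (σ + γ * Complex.I)) ∧
      (∀ σ : ℝ, 1 / 2 ≤ σ → σ ≤ 3 → |(H (σ + γ * Complex.I)).im| ≤ B) ∧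
      ∀ t : ℝ, y < t → t ≤ γ → ¬ IsZetaOrdinate t → ∀ σ : ℝ, 1 / 2 ≤ σ → σ ≤ 3 →
        logZetaRegular σ t = H (σ + t * Complex.I) +
          (Complex.log (riemannZeta (3 + t * Complex.I)) - H (3 + t * Complex.I)) := by
  obtain ⟨H, B, y, hy, hH, hB⟩ := exists_log_riemannZeta_below hγ
  refine ⟨H, B, max y 0, max_lt hy (by linarith), fun σ h1 h2 h0 =>
    (hH _ (by simpa using h1) (by simpa using h2) (by simpa using hy) (by simp) h0).1, hB, ?_⟩
  intro t hyt htγ hord σ h1 h2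
  have ht0 : t ≠ 0 := ((le_max_right y 0).trans_lt hyt).ne'
  have hne := riemannZeta_ne_zero_of_not_isZetaOrdinate ht0 hord
  have hbr := isLogZetaBranch_logZetaRegular ht0 hord
  have hHt : ∀ x ∈ Set.Icc (1 / 2 : ℝ) 3, ContinuousAt H (x + t * Complex.I) ∧
      Complex.exp (H (x + t * Complex.I)) = riemannZeta (x + t * Complex.I) := fun x hx =>
    hH _ (by simpa using hx.1) (by simpa using hx.2)
      (by simpa using (le_max_left y 0).trans_lt hyt) (by simpa using htγ) (hne x)
  have key := (isPreconnected_Icc (a := (1 / 2 : ℝ)) (b := 3)).sub_eq_sub_of_exp_eq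
    (f := fun x : ℝ => logZetaRegular x t) (g := fun x : ℝ => H (x + t * Complex.I))
    hbr.continuous.continuousOn
    (fun x hx => (ContinuousAt.comp (f := fun x : ℝ => (x + t * Complex.I : ℂ)) (hHt x hx).1
      (by fun_prop)).continuousWithinAt)
    (fun x hx => (hbr.exp_eq x).trans (hHt x hx).2.symm) (x := σ) (y := 3) ⟨h1, h2⟩
    ⟨by norm_num, le_rfl⟩
  rw [logZetaRegular_eq_log ht0 hord le_rfl] at key
  push_cast at key
  rw [← key]
  ring

theorem logZeta_eq_limUnder {σ γ : ℝ} (hγ : 0 < γ) (h : IsZetaOrdinate γ) :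
    logZeta σ γ = limUnder (𝓝[>] (0 : ℝ)) fun ε => logZetaRegular σ (γ - ε) := by
  rw [logZeta, if_neg hγ.ne', if_pos h, Real.sign_of_pos hγ]
  simp only [one_mul]

theorem tendsto_sub_nhdsGT_zero (γ : ℝ) :
    Tendsto (fun ε : ℝ => γ - ε) (𝓝[>] 0) (𝓝[<] γ) := by
  refine tendsto_nhdsWithin_iff.2 ⟨?_, ?_⟩
  · have : Tendsto (fun ε : ℝ => γ - ε) (𝓝 0) (𝓝 (γ - 0)) := by
      exact (continuous_const.sub continuous_id).tendsto 0
    rw [sub_zero] at this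
    exact this.mono_left nhdsWithin_le_nhds
  · filter_upwards [self_mem_nhdsWithin] with ε hε
    have : 0 < ε := hε
    exact sub_lt_self γ this

theorem continuousAt_log_riemannZeta_height {σ γ : ℝ} (hσ : 3 ≤ σ) (hγ : 0 < γ) :
    ContinuousAt (fun t : ℝ => Complex.log (riemannZeta (σ + t * Complex.I))) γ := by
  refine ContinuousAt.clog (ContinuousAt.comp (f := fun t : ℝ => (σ + t * Complex.I : ℂ))
    (differentiableAt_riemannZeta (ne_one_of_im_pos (by simpa using hγ))).continuousAt
    (by fun_prop)) (riemannZeta_mem_slitPlane (by simpa using hσ))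

/-- The limit from below exists at every nonzero of ζ, whether or not γ is an ordinate, and equals
the branch itself when it is not. Both cases of the definition of `logZeta` are thus covered by one
function `L`. -/
theorem exists_tendsto_logZetaRegular {γ : ℝ} (hγ : 4 ≤ γ) :
    ∃ (L : ℝ → ℂ) (B : ℝ), (∀ σ : ℝ, 1 / 2 ≤ σ → riemannZeta (σ + γ * Complex.I) ≠ 0 →
        Tendsto (fun t => logZetaRegular σ t) (𝓝[<] γ) (𝓝 (L σ)) ∧
          (¬ IsZetaOrdinate γ → logZetaRegular σ γ = L σ)) ∧
      (∀ σ : ℝ, 3 ≤ σ → L σ = Complex.log (riemannZeta (σ + γ * Complex.I))) ∧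
      ∀ σ : ℝ, 1 / 2 ≤ σ → σ ≤ 3 → |(L σ).im| ≤ B := by
  obtain ⟨H, B, y, hy, hH, hB, heq⟩ := exists_logZetaRegular_eq_of_le hγ
  have hγ0 : 0 < γ := by linarith
  have hB0 : 0 ≤ B := (abs_nonneg _).trans (hB 3 (by norm_num) le_rfl)
  refine ⟨fun σ => if 3 ≤ σ then Complex.log (riemannZeta (σ + γ * Complex.I)) else
    H (σ + γ * Complex.I) + (Complex.log (riemannZeta (3 + γ * Complex.I)) -
      H (3 + γ * Complex.I)), 2 * B + Real.pi, ?_, ?_, ?_⟩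
  · intro σ hσ h0
    by_cases h3 : 3 ≤ σ
    · simp only [if_pos h3]
      refine ⟨?_, fun hord => logZetaRegular_eq_log hγ0.ne' hord h3⟩
      refine ((continuousAt_log_riemannZeta_height h3 hγ0).tendsto.mono_left
        nhdsWithin_le_nhds).congr' ?_
      filter_upwards [eventually_not_isZetaOrdinate hγ0, Ioo_mem_nhdsLT hγ0] with t ht ht'
      exact (logZetaRegular_eq_log ht'.1.ne' ht h3).symm
    · simp only [if_neg h3]
      push Not at h3
      refine ⟨?_, fun hord => heq γ hy le_rfl hord σ hσ h3.le⟩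
      have hcont : ∀ x : ℝ, 1 / 2 ≤ x → x ≤ 3 → riemannZeta (x + γ * Complex.I) ≠ 0 →
          Tendsto (fun t : ℝ => H (x + t * Complex.I)) (𝓝[<] γ) (𝓝 (H (x + γ * Complex.I))) :=
        fun x h1 h2 h0 => Tendsto.mono_left (ContinuousAt.comp (x := γ)
          (f := fun t : ℝ => (x + t * Complex.I : ℂ)) (hH x h1 h2 h0) (by fun_prop)).tendsto
          nhdsWithin_le_nhds
      have h4 := hcont 3 (by norm_num) le_rfl (riemannZeta_ne_zero_of_three_le (by simp))
      have h5 := (continuousAt_log_riemannZeta_height (le_refl (3 : ℝ)) hγ0).tendsto.mono_left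
        (nhdsWithin_le_nhds (s := Set.Iio γ))
      push_cast at h4 h5
      refine ((hcont σ hσ h3.le h0).add (h5.sub h4)).congr' ?_
      filter_upwards [eventually_not_isZetaOrdinate hγ0, Ioo_mem_nhdsLT hy] with t ht ht'
      exact (heq t ht'.1 ht'.2.le ht σ hσ h3.le).symm
  · intro σ hσ
    simp only [if_pos hσ]
  · intro σ h1 h2
    have h3 := Complex.abs_arg_le_pi (riemannZeta (σ + γ * Complex.I))
    have h4 := Complex.abs_arg_le_pi (riemannZeta (3 + γ * Complex.I))
    have h5 := hB σ h1 h2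
    have h6 := hB 3 (by norm_num) le_rfl
    push_cast at h6
    rw [abs_le] at *
    dsimp only
    split_ifs
    · rw [Complex.log_im]
      constructor <;> linarith
    · rw [Complex.add_im, Complex.sub_im, Complex.log_im]
      constructor <;> linarith

/-- Outside the countable set of zeros on the line, `logZeta` is a genuine limit of branches and
hence a logarithm of ζ. Measurability is inherited from these continuous approximants. -/
theorem exists_logZeta_spec {t : ℝ} (ht : 4 ≤ t) :
    AEStronglyMeasurable (fun σ => logZeta σ t) (volume.restrict (Set.Ioi (1 / 2 : ℝ))) ∧
      (∀ σ : ℝ, 3 ≤ σ → logZeta σ t = Complex.log (riemannZeta (σ + t * Complex.I))) ∧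
      ∃ B : ℝ, ∀ᵐ σ : ℝ ∂(volume.restrict (Set.Ioi (1 / 2 : ℝ))),
        (logZeta σ t).re = Real.log ‖riemannZeta (σ + t * Complex.I)‖ ∧
          (σ ≤ 3 → |(logZeta σ t).im| ≤ B) := by
  obtain ⟨L, B, hL, hL3, hB⟩ := exists_tendsto_logZetaRegular ht
  have ht0 : 0 < t := by linarith
  have heq : ∀ σ : ℝ, 1 / 2 ≤ σ → riemannZeta (σ + t * Complex.I) ≠ 0 → logZeta σ t = L σ := by
    intro σ hσ h0
    by_cases hord : IsZetaOrdinate t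
    · rw [logZeta_eq_limUnder ht0 hord]
      exact ((hL σ hσ h0).1.comp (tendsto_sub_nhdsGT_zero t)).limUnder_eq
    · rw [logZeta, if_neg ht0.ne', if_neg hord]
      exact (hL σ hσ h0).2 hord
  have hexp : ∀ σ : ℝ, 1 / 2 ≤ σ → riemannZeta (σ + t * Complex.I) ≠ 0 →
      Complex.exp (L σ) = riemannZeta (σ + t * Complex.I) := by
    intro σ hσ h0
    have h1 : Tendsto (fun x : ℝ => Complex.exp (logZetaRegular σ x)) (𝓝[<] t)
        (𝓝 (Complex.exp (L σ))) := (Complex.continuous_exp.tendsto _).comp (hL σ hσ h0).1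
    have h2 : Tendsto (fun x : ℝ => riemannZeta (σ + x * Complex.I)) (𝓝[<] t)
        (𝓝 (riemannZeta (σ + t * Complex.I))) := Tendsto.mono_left
      (ContinuousAt.comp (x := t) (f := fun t : ℝ => (σ + t * Complex.I : ℂ))
        (differentiableAt_riemannZeta (ne_one_of_im_pos (by simpa using ht0))).continuousAt
        (by fun_prop)).tendsto nhdsWithin_le_nhds
    refine tendsto_nhds_unique (h1.congr' ?_) h2
    filter_upwards [eventually_not_isZetaOrdinate ht0, Ioo_mem_nhdsLT ht0] with x hx hx'
    exact (isLogZetaBranch_logZetaRegular hx'.1.ne' hx).exp_eq σ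
  have hae : ∀ᵐ σ : ℝ ∂(volume.restrict (Set.Ioi (1 / 2 : ℝ))),
      1 / 2 ≤ σ ∧ riemannZeta (σ + t * Complex.I) ≠ 0 := by
    have h1 : ∀ᵐ σ : ℝ, ((t * Complex.I : ℂ) + σ) ∉ riemannZetaZeros :=
      measure_eq_zero_iff_ae_notMem.1
        ((countable_setOf_add_mem_riemannZetaZeros (t * Complex.I)).measure_zero volume)
    filter_upwards [ae_restrict_of_ae h1, ae_restrict_mem measurableSet_Ioi] with σ h2 h3
    refine ⟨le_of_lt h3, fun h0 => h2 ?_⟩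
    rw [add_comm]
    exact h0
  refine ⟨?_, ?_, B, ?_⟩
  · refine aestronglyMeasurable_of_tendsto_ae (𝓝[<] t) (f := fun x σ => logZetaRegular σ x)
      (fun x => (continuous_logZetaRegular x).aestronglyMeasurable) ?_
    filter_upwards [hae] with σ hσ
    rw [heq σ hσ.1 hσ.2]
    exact (hL σ hσ.1 hσ.2).1
  · intro σ hσ
    rw [heq σ (by linarith) (riemannZeta_ne_zero_of_three_le (by simpa using hσ)), hL3 σ hσ]
  · filter_upwards [hae] with σ hσ
    rw [heq σ hσ.1 hσ.2, ← hexp σ hσ.1 hσ.2, Complex.norm_exp, Real.log_exp]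
    exact ⟨rfl, hB σ hσ.1⟩

/-- Real and imaginary parts are dominated separately on (1/2, 3], the former by the integrability
of log|ζ|. Without integrability the integral defining `etaTilde` would take the default value 0. -/
theorem integrableOn_logZeta {t : ℝ} (ht : 4 ≤ t) :
    IntegrableOn (fun σ => logZeta σ t) (Set.Ioi (1 / 2 : ℝ)) := by
  obtain ⟨hm, hlog, B, hB⟩ := exists_logZeta_spec ht
  obtain ⟨C, -, hC⟩ := exists_integral_Ioi_abs_log_norm_riemannZeta_le
  have hre := (hC (1 / 2) t le_rfl ht).1
  have hun : Set.Ioi (1 / 2 : ℝ) = Set.Ioc (1 / 2) 3 ∪ Set.Ioi 3 :=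
    (Set.Ioc_union_Ioi_eq_Ioi (by norm_num)).symm
  rw [hun]
  refine IntegrableOn.union ?_ ?_
  · have hsub : Set.Ioc (1 / 2 : ℝ) 3 ⊆ Set.Ioi (1 / 2) := Set.Ioc_subset_Ioi_self
    have hg : IntegrableOn (fun σ : ℝ => |Real.log ‖riemannZeta (σ + t * Complex.I)‖| + B)
        (Set.Ioc (1 / 2) 3) :=
      Integrable.add (IntegrableOn.mono_set hre.abs hsub)
        (integrableOn_const (by simp))
    refine Integrable.mono' hg (hm.mono_set hsub) ?_
    filter_upwards [ae_restrict_of_ae_restrict_of_subset hsub hB,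
      ae_restrict_mem measurableSet_Ioc] with σ h1 h2
    refine (Complex.norm_le_abs_re_add_abs_im _).trans ?_
    rw [h1.1]
    gcongr
    exact h1.2 h2.2
  · have hsub : Set.Ioi (3 : ℝ) ⊆ Set.Ioi (1 / 2) := Set.Ioi_subset_Ioi (by norm_num)
    refine Integrable.mono' ((integrableOn_exp_neg_half 3).const_mul 6) (hm.mono_set hsub) ?_
    filter_upwards [ae_restrict_mem measurableSet_Ioi] with σ hσ
    have hσ' : 3 < σ := hσ
    rw [hlog σ hσ'.le]
    simpa using norm_log_riemannZeta_le (s := σ + t * Complex.I) (by simpa using hσ'.le)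

/-! ### The real part of the iterated integrals of log ζ -/

theorem continuousOn_setIntegral_Ioi {f : ℝ → ℂ} {a : ℝ} (hf : IntegrableOn f (Set.Ioi a)) :
    ContinuousOn (fun σ => ∫ x in Set.Ioi σ, f x) (Set.Ioi a) := by
  have hF : Integrable ((Set.Ioi a).indicator f) := (integrable_indicator_iff measurableSet_Ioi).2 hf
  have hc := intervalIntegral.continuous_primitive (fun b c => hF.intervalIntegrable (a := b) (b := c)) a
  refine ((continuous_const (y := ∫ x in Set.Ioi a, f x)).sub hc).continuousOn.congr fun σ hσ => ?_
  have hσ' : a < σ := hσ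
  have h1 : ∫ x in a..σ, (Set.Ioi a).indicator f x = ∫ x in Set.Ioc a σ, f x := by
    rw [intervalIntegral.integral_of_le hσ'.le]
    refine setIntegral_congr_fun measurableSet_Ioc fun x hx => ?_
    exact Set.indicator_of_mem (s := Set.Ioi a) hx.1 f
  dsimp only [Pi.sub_apply]
  rw [h1, ← Set.Ioc_union_Ioi_eq_Ioi hσ'.le,
    setIntegral_union (Set.Ioc_disjoint_Ioi le_rfl) measurableSet_Ioi
      (hf.mono_set Set.Ioc_subset_Ioi_self) (hf.mono_set (Set.Ioi_subset_Ioi hσ'.le))]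
  ring

/-- Integrability to the right of `1/2` with exponentially decaying tails passes to the tail
integral. -/
theorem integrableOn_setIntegral_Ioi {f : ℝ → ℂ} (hf : IntegrableOn f (Set.Ioi (1 / 2 : ℝ)))
    {C : ℝ} (hC : ∀ σ : ℝ, 1 / 2 ≤ σ → ∫ x in Set.Ioi σ, ‖f x‖ ≤ C * Real.exp (-σ / 2)) :
    IntegrableOn (fun σ => ∫ x in Set.Ioi σ, f x) (Set.Ioi (1 / 2 : ℝ)) ∧
      ∀ σ : ℝ, 1 / 2 ≤ σ →
        ∫ y in Set.Ioi σ, ‖∫ x in Set.Ioi y, f x‖ ≤ 2 * C * Real.exp (-σ / 2) := by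
  have hB : ∀ σ : ℝ, IntegrableOn (fun x : ℝ => C * Real.exp (-x / 2)) (Set.Ioi σ) :=
    fun σ => (integrableOn_exp_neg_half σ).const_mul C
  have hle : ∀ y : ℝ, 1 / 2 ≤ y → ‖∫ x in Set.Ioi y, f x‖ ≤ C * Real.exp (-y / 2) :=
    fun y hy => (norm_integral_le_integral_norm _).trans (hC y hy)
  have hint : IntegrableOn (fun σ => ∫ x in Set.Ioi σ, f x) (Set.Ioi (1 / 2 : ℝ)) :=
    Integrable.mono' (hB _)
      ((continuousOn_setIntegral_Ioi hf).aestronglyMeasurable measurableSet_Ioi)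
      ((ae_restrict_mem measurableSet_Ioi).mono fun y hy => hle y (le_of_lt hy))
  refine ⟨hint, fun σ hσ => ?_⟩
  calc _ ≤ ∫ y in Set.Ioi σ, C * Real.exp (-y / 2) :=
        setIntegral_mono_on (IntegrableOn.mono_set hint.norm (Set.Ioi_subset_Ioi hσ)) (hB σ)
          measurableSet_Ioi fun y hy => hle y (hσ.trans (le_of_lt hy))
    _ = _ := by
        rw [integral_const_mul, integral_exp_neg_half]
        ring

/-- The constant may depend on t: the estimate serves only to keep every iterate integrable at a
fixed height. -/
theorem exists_integral_norm_logZeta_le {t : ℝ} (ht : 4 ≤ t) :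
    ∃ C : ℝ, ∀ σ : ℝ, 1 / 2 ≤ σ → ∫ x in Set.Ioi σ, ‖logZeta x t‖ ≤ C * Real.exp (-σ / 2) := by
  have hint := integrableOn_logZeta ht
  obtain ⟨-, hlog, -⟩ := exists_logZeta_spec ht
  set A := ∫ x in Set.Ioi (1 / 2 : ℝ), ‖logZeta x t‖ with hA
  have hA0 : 0 ≤ A := integral_nonneg fun _ => norm_nonneg _
  refine ⟨A * Real.exp (3 / 2) + 12, fun σ hσ => ?_⟩
  rcases le_or_gt 3 σ with h3 | h3
  · calc _ ≤ ∫ x in Set.Ioi σ, 6 * Real.exp (-x / 2) := by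
          refine setIntegral_mono_on (IntegrableOn.mono_set hint.norm (Set.Ioi_subset_Ioi hσ))
            ((integrableOn_exp_neg_half σ).const_mul 6) measurableSet_Ioi fun x hx => ?_
          have hx' : 3 ≤ x := h3.trans (le_of_lt hx)
          rw [hlog x hx']
          simpa using norm_log_riemannZeta_le (s := x + t * Complex.I) (by simpa using hx')
      _ = 12 * Real.exp (-σ / 2) := by
          rw [integral_const_mul, integral_exp_neg_half]
          ring
      _ ≤ _ := by
          gcongr
          have : 0 ≤ A * Real.exp (3 / 2) := by positivity
          linarith
  · have h8 : 1 ≤ Real.exp (3 / 2) * Real.exp (-σ / 2) := by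
      rw [← Real.exp_add]
      exact Real.one_le_exp (by linarith)
    calc _ ≤ A := setIntegral_mono_set hint.norm (Eventually.of_forall fun _ => norm_nonneg _)
          (Set.Ioi_subset_Ioi hσ).eventuallyLE
      _ ≤ A * (Real.exp (3 / 2) * Real.exp (-σ / 2)) := le_mul_of_one_le_right hA0 h8
      _ ≤ _ := by
          have : 0 ≤ 12 * Real.exp (-σ / 2) := by positivity
          linarith

theorem etaTilde_succ_line (m : ℕ) (σ t : ℝ) :
    etaTilde (m + 1) (σ + t * Complex.I) =
      ∫ α in Set.Ioi σ, etaTilde m (α + t * Complex.I) := by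
  simp [etaTilde]

theorem zetaLogIter_succ_line (m : ℕ) (σ t : ℝ) :
    zetaLogIter (m + 1) (σ + t * Complex.I) =
      ∫ α in Set.Ioi σ, zetaLogIter m (α + t * Complex.I) :=
  integral_Ioi_shift (zetaLogIter m) σ t

/-- Integrability, decay and the identity of real parts are carried together through the induction,
since taking real parts under the integral needs integrability at each stage. -/
theorem etaTilde_line {t : ℝ} (ht : 4 ≤ t) (m : ℕ) :
    IntegrableOn (fun σ : ℝ => etaTilde m (σ + t * Complex.I)) (Set.Ioi (1 / 2 : ℝ)) ∧
      (∃ C : ℝ, ∀ σ : ℝ, 1 / 2 ≤ σ →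
        ∫ x in Set.Ioi σ, ‖etaTilde m (x + t * Complex.I)‖ ≤ C * Real.exp (-σ / 2)) ∧
      ∀ᵐ σ : ℝ ∂(volume.restrict (Set.Ioi (1 / 2 : ℝ))),
        (etaTilde m (σ + t * Complex.I)).re = zetaLogIter m (σ + t * Complex.I) := by
  induction m with
  | zero =>
    obtain ⟨-, -, B, hB⟩ := exists_logZeta_spec ht
    have h0 : ∀ σ : ℝ, etaTilde 0 (σ + t * Complex.I) = logZeta σ t := by
      intro σ
      simp [etaTilde]
    simp only [h0]
    exact ⟨integrableOn_logZeta ht, exists_integral_norm_logZeta_le ht, hB.mono fun σ h => h.1⟩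
  | succ m ih =>
    obtain ⟨hint, ⟨C, hC⟩, hre⟩ := ih
    obtain ⟨h1, h2⟩ := integrableOn_setIntegral_Ioi hint hC
    simp only [etaTilde_succ_line, zetaLogIter_succ_line]
    refine ⟨h1, ⟨2 * C, h2⟩, ?_⟩
    filter_upwards [ae_restrict_mem measurableSet_Ioi] with σ hσ
    have hsub : Set.Ioi σ ⊆ Set.Ioi (1 / 2 : ℝ) := Set.Ioi_subset_Ioi (le_of_lt hσ)
    have h3 := integral_re (𝕜 := ℂ) (hint.mono_set hsub)
    simp only [RCLike.re_to_complex] at h3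
    rw [← h3]
    exact integral_congr_ae (ae_restrict_of_ae_restrict_of_subset hsub hre)

/-- One integration upgrades the almost everywhere identity to every σ ≥ 1/2, in particular to the
critical line itself. -/
theorem re_etaTilde_succ_eq {m : ℕ} {σ t : ℝ} (hσ : 1 / 2 ≤ σ) (ht : 4 ≤ t) :
    (etaTilde (m + 1) (σ + t * Complex.I)).re = zetaLogIter (m + 1) (σ + t * Complex.I) := by
  obtain ⟨hint, -, hre⟩ := etaTilde_line ht m
  have hsub : Set.Ioi σ ⊆ Set.Ioi (1 / 2 : ℝ) := Set.Ioi_subset_Ioi hσ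
  have h3 := integral_re (𝕜 := ℂ) (hint.mono_set hsub)
  simp only [RCLike.re_to_complex] at h3
  rw [etaTilde_succ_line, zetaLogIter_succ_line, ← h3]
  exact integral_congr_ae (ae_restrict_of_ae_restrict_of_subset hsub hre)

theorem proposition1 (m : ℕ) (hm : 1 ≤ m) :
    LindelofHypothesis ↔
      (fun t : ℝ => (etaTilde m (1 / 2 + t * Complex.I)).re) =o[atTop]
        (fun t : ℝ => Real.log t) := by
  obtain ⟨k, rfl⟩ : ∃ k, m = k + 1 := ⟨m - 1, by omega⟩
  rw [lindelofHypothesis_iff_zetaLogIter k]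
  refine isLittleO_congr ?_ EventuallyEq.rfl
  filter_upwards [eventually_ge_atTop 4] with t ht
  simpa using (re_etaTilde_succ_eq (m := k) (σ := 1 / 2) le_rfl ht).symm
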